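/- Let $\widetilde W\ge 0$ be a real random variable with density $1$ at $0$, i.e. $\Pr[\widetilde W<t]=t+o(t)$ as $t\to0^+$. Let $K_n$ be the complete graph on $n$ vertices whose edge weights are i.i.d. copies of $\widetilde W$, let $T$ be a set of $m\ge1$ of its vertices (the terminals) and let $r$ be a vertex (the root). A Steiner tree is a subtree of $K_n$ that contains all vertices of $T$ (and possibly others), and its weight is the sum of its edge weights. Denote by $D_k$ the minimum weight of a Steiner tree that contains $r$ and all of whose vertices are within distance $k$ of $r$ in the tree, and by $B_d$ the minimum weight of a Steiner tree of diameter at most $d$ (distances count edges). Let $n\to\infty$, where $T$, $r$, $m$ and $k$ may vary with $n$ and the law of $\widetilde W$ is fixed, and suppose that $k\ge2$ and $$\log_2\log n-\log_2\log(en/m)-k\to\infty .$$ Then, in probability, $$D_k=(1-2^{-k}\pm o(1))\sqrt{\frac{8m}{n}}\left(\frac{\sqrt{2mn}}{2^k}\right)^{\frac1{2^k-1}},\qquad B_{2k}=(1-2^{-k}\pm o(1))\sqrt{\frac{8m}{n}}\left(\frac{\sqrt{2mn}}{2^k}\right)^{\frac1{2^k-1}},$$ $$B_{2k+1}=(1-2^{-k}\pm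 o(1))\sqrt{\frac{8m}{n}}\left(\frac{\sqrt{mn/2}}{2^k}\right)^{\frac1{2^k-1}}.$$ If moreover $\mathbb E[\widetilde W]<\infty$, then the expectations of $D_k$, $B_{2k}$ and $B_{2k+1}$ are finite and satisfy the same three formulas. All these formulas are also valid for $k=1$ when $\widetilde W$ is exponential with mean $1$. -/

import Mathlib

open MeasureTheory ProbabilityTheory Filter Topology Asymptotics

namespace SteinerTree

/-- The total weight of the edges of the subgraph `H` of the edge-weighted graph `G`. -/
noncomputable def weight {V : Type*} {G : SimpleGraph V} [Fintype G.edgeSet]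
    (w : G.edgeSet → ℝ) (H : G.Subgraph) : ℝ :=
  ∑ e : G.edgeSet, Set.indicator {e : G.edgeSet | (e : Sym2 V) ∈ H.edgeSet} w e

/-- `H` is a Steiner tree of `G` for the set `T` of terminals: a subgraph which is a tree and
contains every terminal (and possibly further vertices). -/
structure IsSteinerTree {V : Type*} {G : SimpleGraph V} (T : Finset V) (H : G.Subgraph) :
    Prop where
  isTree : H.coe.IsTree
  terminal_mem : ∀ v ∈ T, v ∈ H.verts

/-- `H` contains the root `r`, and all its vertices are within distance `k` of `r` in `H`. -/
def HasDepthLE {V : Type*} {G : SimpleGraph V} (r : V) (k : ℕ) (H : G.Subgraph) : Prop :=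
  ∃ hr : r ∈ H.verts, H.coe.eccent ⟨r, hr⟩ ≤ (k : ℕ∞)

/-- Any two vertices of `H` are within distance `d` of each other in `H`. -/
def HasDiamLE {V : Type*} {G : SimpleGraph V} (d : ℕ) (H : G.Subgraph) : Prop :=
  H.coe.ediam ≤ (d : ℕ∞)

/-- The minimum weight of a Steiner tree for the terminals `T` of depth at most `k` from the
root `r`. (In a finite graph the infimum is over finitely many trees.) -/
noncomputable def minDepthWeight {V : Type*} {G : SimpleGraph V} [Fintype G.edgeSet]
    (w : G.edgeSet → ℝ) (T : Finset V) (r : V) (k : ℕ) : ℝ :=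
  sInf (weight w '' {H : G.Subgraph | IsSteinerTree T H ∧ HasDepthLE r k H})

/-- The minimum weight of a Steiner tree for the terminals `T` of diameter at most `d`. -/
noncomputable def minDiamWeight {V : Type*} {G : SimpleGraph V} [Fintype G.edgeSet]
    (w : G.edgeSet → ℝ) (T : Finset V) (d : ℕ) : ℝ :=
  sInf (weight w '' {H : G.Subgraph | IsSteinerTree T H ∧ HasDiamLE d H})

/-- The law `μ` has density `1` at `0`: `μ [0, t) = t + o(t)` as `t → 0+`, for a law `μ`
of a nonnegative random variable. -/
structure HasDensityOneAtZero (μ : Measure ℝ) : Prop where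
  nonneg : ∀ᵐ x ∂μ, 0 ≤ x
  density : (fun t : ℝ => μ.real (Set.Iio t) - t) =o[𝓝[>] 0] (fun t : ℝ => t)

/-- `√(8m/n) (x / 2^k)^(1/(2^k-1))`. -/
noncomputable def scale (n m k : ℕ) (x : ℝ) : ℝ :=
  √(8 * (m : ℝ) / n) * (x / 2 ^ k) ^ (1 / ((2 : ℝ) ^ k - 1))

/-- `X j = (a j ± o(1)) * s j` in probability, as `j → ∞`. -/
def AsympInProbability {Ω : ℕ → Type*} [∀ j, MeasurableSpace (Ω j)] (P : ∀ j, Measure (Ω j))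
    (X : ∀ j, Ω j → ℝ) (a s : ℕ → ℝ) : Prop :=
  ∀ ε : ℝ, 0 < ε →
    Tendsto (fun j => P j {ω | ε ≤ |X j ω / s j - a j|}) atTop (𝓝 0)

/-- `X j` is integrable, and `E[X j] = (a j ± o(1)) * s j`, as `j → ∞`. -/
def AsympInExpectation {Ω : ℕ → Type*} [∀ j, MeasurableSpace (Ω j)] (P : ∀ j, Measure (Ω j))
    (X : ∀ j, Ω j → ℝ) (a s : ℕ → ℝ) : Prop :=
  (∀ j, Integrable (X j) (P j)) ∧
    Tendsto (fun j => (∫ ω, X j ω ∂(P j)) / s j - a j) atTop (𝓝 0)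

end SteinerTree

/-! Suppose that ℓ_i vertices sit on level i of a tree. About n ℓ_i t vertices are joined to them by
edges of weight less than t, and these edges have mean weight about t/2. So ℓ_{i+1} vertices on the
next level cost about ℓ_{i+1}²/(2nℓ_i), reached with threshold t_{i+1} = ℓ_{i+1}/(nℓ_i). Attaching
the m terminals to the ℓ_{k-1} vertices of the last inner level costs about m/ℓ_{k-1}. With ρ = ℓ_0
roots, the total is minimised by ℓ_{i+1} = 2 z^(2^(k-i-1)) ℓ_i, where z^(2^k-1) = √(2mn)/(ρ 2^k).
The costs of successive levels then double, and the last one is half of s = √(8m/n) z. The sum s/2 +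
s/4 + ... + s/2^k is (1 - 2^{-k}) s. Depth k and diameter 2k mean ρ = 1. Diameter 2k+1 means ρ = 2,
together with a central edge of cost o(s).

Lower bound. Every admissible tree contains a forest given by levels and parents
(`exists_forest_of_hasDiamLE_even`, `exists_forest_of_hasDiamLE_odd`). Linear duality with prices
t_i per vertex of level i bounds the cost of all forests at once (`le_forestCost`). The dual
constraints need two estimates uniform over all vertex sets S: the total gain Σ (t - w_e)⁺ over
edges at S is at most about n t²|S|/2 (`exists_measure_level_le`), and attaching the terminals to S
costs at least about m/|S|, hence lies above a tangent line g - l|S| (`exists_measure_attach_le`).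
Both come from Chernoff bounds and a union bound over sets whose size is comparable with that of a
level.

Upper bound. The graph is explored level by level with thresholds slightly above t_i. The edges from
the last level to unexplored vertices are still fresh, so attaching the terminals costs the expected
amount (`lintegral_explore_le`, `lintegral_sum_attachCap_le`). One vertex r is never explored. If
the exploration fails, all terminals are attached to r, by edges independent of the failure; the
failure probability decays exponentially in z^(2^(k-1)), which beats the polynomial cost of this
fallback.

The upper bound is proved for weights cut off at B. With B = 2s no moment is needed, and together
with the lower bound in probability it gives convergence in probability. With B = ⊤ it gives the
expectation. The growth condition on k ensures z → ∞ and (n/m)^4 ≤ z (`exists_params_of_log_le`).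
For k = 1 the ρ roots are attached to directly, their number does not grow, and the exact
exponential tail replaces the density at 0. -/

namespace SteinerTree

set_option linter.unusedSectionVars false

/-! ### Independence under the product measure and Chernoff bounds. -/

section Product

variable {ι κ : Type*} [Fintype ι] {μ : Measure ℝ} [IsProbabilityMeasure μ]

/-- Independence of disjoint blocks of coordinates, phrased for functions of the whole weight vector
so that it applies to random edge sets after splitting into cases. -/
lemma lintegral_mul_of_dependsOn_disjoint {f g : (ι → ℝ) → ENNReal} {S T : Set ι}
    (hf : Measurable f) (hg : Measurable g) (hfS : DependsOn f S) (hgT : DependsOn g T)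
    (hST : Disjoint S T) :
    ∫⁻ w, f w * g w ∂(Measure.pi fun _ : ι => μ) =
      (∫⁻ w, f w ∂(Measure.pi fun _ : ι => μ)) * ∫⁻ w, g w ∂(Measure.pi fun _ : ι => μ) := by
  classical
  have hind : iIndepFun (fun (i : ι) (w : ι → ℝ) => w i) (Measure.pi fun _ : ι => μ) :=
    iIndepFun_pi (μ := fun _ : ι => μ) (X := fun _ x => x) (fun _ => aemeasurable_id)
  have hdis : Disjoint (Finset.univ.filter (· ∈ S)) (Finset.univ.filter (· ∈ T)) := by
    rw [Finset.disjoint_left]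
    intro i hi hi'
    simp only [Finset.mem_filter, Finset.mem_univ, true_and] at hi hi'
    exact Set.disjoint_left.1 hST hi hi'
  have h := hind.indepFun_finset _ _ hdis (fun i => measurable_pi_apply i)
  -- A block of coordinates is extended by 0 to a full vector; f and g do not notice, since they
  -- depend only on their own block.
  let ext : ∀ A : Finset ι, (A → ℝ) → ι → ℝ := fun A x i => if hi : i ∈ A then x ⟨i, hi⟩ else 0
  have hext : ∀ A, Measurable (ext A) := by
    intro A
    refine measurable_pi_lambda _ fun i => ?_
    by_cases hi : i ∈ A
    · simpa [ext, hi] using measurable_pi_apply (⟨i, hi⟩ : A)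
    · simp [ext, hi]
  have h2 := h.comp (hf.comp (hext (Finset.univ.filter (· ∈ S))))
    (hg.comp (hext (Finset.univ.filter (· ∈ T))))
  have e1 : (f ∘ ext (Finset.univ.filter (· ∈ S))) ∘
      (fun (w : ι → ℝ) (i : (Finset.univ.filter (· ∈ S) : Finset ι)) => w i) = f := by
    funext w
    refine hfS fun i hi => ?_
    simp [ext, hi]
  have e2 : (g ∘ ext (Finset.univ.filter (· ∈ T))) ∘
      (fun (w : ι → ℝ) (i : (Finset.univ.filter (· ∈ T) : Finset ι)) => w i) = g := by
    funext w
    refine hgT fun i hi => ?_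
    simp [ext, hi]
  rw [e1, e2] at h2
  exact lintegral_mul_eq_lintegral_mul_lintegral_of_indepFun hf hg h2

lemma lintegral_prod_of_dependsOn_disjoint {f : κ → (ι → ℝ) → ENNReal} {D : κ → Set ι}
    (B : Finset κ) (hf : ∀ v ∈ B, Measurable (f v)) (hD : ∀ v ∈ B, DependsOn (f v) (D v))
    (hdis : ∀ u ∈ B, ∀ v ∈ B, u ≠ v → Disjoint (D u) (D v)) :
    ∫⁻ w, ∏ v ∈ B, f v w ∂(Measure.pi fun _ : ι => μ) =
      ∏ v ∈ B, ∫⁻ w, f v w ∂(Measure.pi fun _ : ι => μ) := by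
  classical
  induction B using Finset.induction_on with
  | empty => simp
  | insert a B ha ih =>
    simp only [Finset.prod_insert ha]
    rw [lintegral_mul_of_dependsOn_disjoint (S := D a) (T := ⋃ v ∈ B, D v)
      (hf a (Finset.mem_insert_self _ _))
      (Finset.measurable_prod _ fun v hv => hf v (Finset.mem_insert_of_mem hv))
      (hD a (Finset.mem_insert_self _ _)), ih (fun v hv => hf v (Finset.mem_insert_of_mem hv))
      (fun v hv => hD v (Finset.mem_insert_of_mem hv))
      (fun u hu v hv => hdis u (Finset.mem_insert_of_mem hu) v (Finset.mem_insert_of_mem hv))]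
    · intro x y hxy
      refine Finset.prod_congr rfl fun v hv => hD v (Finset.mem_insert_of_mem hv) fun i hi => ?_
      exact hxy i (Set.mem_biUnion hv hi)
    · rw [Set.disjoint_iUnion₂_right]
      intro v hv
      refine hdis a (Finset.mem_insert_self _ _) v (Finset.mem_insert_of_mem hv) ?_
      rintro rfl
      exact ha hv

/-- By convexity e^(θx) ≤ 1 + (e^θ - 1)x on [0, 1], and 1 + u ≤ e^u. -/
lemma lintegral_exp_mul_le {Ω : Type*} [MeasurableSpace Ω] {P : Measure Ω}
    [IsProbabilityMeasure P] {X : Ω → ℝ} (hX : Measurable X) (h01 : ∀ w, X w ∈ Set.Icc (0 : ℝ) 1)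
    (θ : ℝ) {c : ℝ} (hc : (Real.exp θ - 1) * ∫ w, X w ∂P ≤ c) :
    ∫⁻ w, ENNReal.ofReal (Real.exp (θ * X w)) ∂P ≤ ENNReal.ofReal (Real.exp c) := by
  have hint : Integrable X P :=
    Integrable.of_mem_Icc 0 1 hX.aemeasurable (Eventually.of_forall h01)
  have hle : ∀ w, Real.exp (θ * X w) ≤ 1 + (Real.exp θ - 1) * X w := by
    intro w
    obtain ⟨h0, h1⟩ := h01 w
    have := convexOn_exp.2 (Set.mem_univ θ) (Set.mem_univ (0 : ℝ)) h0 (sub_nonneg.2 h1)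
      (by ring)
    simp only [smul_eq_mul, mul_zero, add_zero, Real.exp_zero, mul_one] at this
    rw [mul_comm]
    linarith
  have hint2 : Integrable (fun w => 1 + (Real.exp θ - 1) * X w) P :=
    (integrable_const 1).add (hint.const_mul _)
  calc ∫⁻ w, ENNReal.ofReal (Real.exp (θ * X w)) ∂P
      ≤ ∫⁻ w, ENNReal.ofReal (1 + (Real.exp θ - 1) * X w) ∂P :=
        lintegral_mono fun w => ENNReal.ofReal_le_ofReal (hle w)
    _ = ENNReal.ofReal (∫ w, (1 + (Real.exp θ - 1) * X w) ∂P) := by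
        rw [ofReal_integral_eq_lintegral_ofReal hint2]
        exact Eventually.of_forall fun w => (Real.exp_pos _).le.trans (hle w)
    _ ≤ ENNReal.ofReal (Real.exp c) := by
        refine ENNReal.ofReal_le_ofReal ?_
        rw [integral_add (integrable_const 1) (hint.const_mul _), integral_const_mul]
        simp only [integral_const, probReal_univ, smul_eq_mul, mul_one]
        have := Real.add_one_le_exp c
        linarith

/-- Exponential Markov inequality. Since θ may have either sign, it serves both tails. -/
lemma measure_sum_ge_le_of_exp {X : κ → (ι → ℝ) → ℝ} {D : κ → Set ι} (B : Finset κ)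
    (hX : ∀ v ∈ B, Measurable (X v)) (h01 : ∀ v ∈ B, ∀ w, X v w ∈ Set.Icc (0 : ℝ) 1)
    (hD : ∀ v ∈ B, DependsOn (X v) (D v))
    (hdis : ∀ u ∈ B, ∀ v ∈ B, u ≠ v → Disjoint (D u) (D v)) {θ c a b : ℝ}
    (hc : ∀ v ∈ B, (Real.exp θ - 1) * ∫ w, X v w ∂(Measure.pi fun _ : ι => μ) ≤ c)
    (hb : B.card * c - a ≤ b) :
    (Measure.pi fun _ : ι => μ) {w | a ≤ θ * ∑ v ∈ B, X v w} ≤ ENNReal.ofReal (Real.exp b) := by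
  have hmeas : ∀ v ∈ B, Measurable fun w => ENNReal.ofReal (Real.exp (θ * X v w)) := fun v hv =>
    (Real.measurable_exp.comp ((hX v hv).const_mul θ)).ennreal_ofReal
  have h1 : ∫⁻ w, ENNReal.ofReal (Real.exp (θ * ∑ v ∈ B, X v w)) ∂(Measure.pi fun _ : ι => μ) ≤
      ENNReal.ofReal (Real.exp (B.card * c)) := by
    have e : ∀ w, ENNReal.ofReal (Real.exp (θ * ∑ v ∈ B, X v w)) =
        ∏ v ∈ B, ENNReal.ofReal (Real.exp (θ * X v w)) := by
      intro w
      rw [Finset.mul_sum, Real.exp_sum, ENNReal.ofReal_prod_of_nonneg]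
      exact fun _ _ => (Real.exp_pos _).le
    simp_rw [e]
    rw [lintegral_prod_of_dependsOn_disjoint (D := D) B hmeas ?_ hdis]
    · calc _ ≤ ∏ _v ∈ B, ENNReal.ofReal (Real.exp c) :=
            Finset.prod_le_prod' fun v hv => lintegral_exp_mul_le (hX v hv) (h01 v hv) θ (hc v hv)
        _ = _ := by
            rw [Finset.prod_const, ← ENNReal.ofReal_pow (Real.exp_pos _).le, ← Real.exp_nat_mul]
    · intro v hv x y hxy
      simp only [hD v hv hxy]
  have h2 := mul_meas_ge_le_lintegral₀ (μ := Measure.pi fun _ : ι => μ)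
    (f := fun w => ENNReal.ofReal (Real.exp (θ * ∑ v ∈ B, X v w)))
    ((Real.measurable_exp.comp
      ((Finset.measurable_sum _ fun v hv => hX v hv).const_mul θ)).ennreal_ofReal.aemeasurable)
    (ENNReal.ofReal (Real.exp a))
  have h3 : {w | a ≤ θ * ∑ v ∈ B, X v w} ⊆ {w | ENNReal.ofReal (Real.exp a) ≤
      ENNReal.ofReal (Real.exp (θ * ∑ v ∈ B, X v w))} := by
    intro w hw
    exact ENNReal.ofReal_le_ofReal (Real.exp_le_exp.2 hw)
  have h4 : ENNReal.ofReal (Real.exp a) * (Measure.pi fun _ : ι => μ) {w | a ≤ θ * ∑ v ∈ B, X v w}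
      ≤ ENNReal.ofReal (Real.exp (B.card * c)) :=
    (mul_le_mul_right (measure_mono h3) _).trans (h2.trans h1)
  have h5 : ENNReal.ofReal (Real.exp (-a)) * ENNReal.ofReal (Real.exp a) = 1 := by
    rw [← ENNReal.ofReal_mul (Real.exp_pos _).le, ← Real.exp_add]; simp
  calc _ = ENNReal.ofReal (Real.exp (-a)) * (ENNReal.ofReal (Real.exp a) *
        (Measure.pi fun _ : ι => μ) {w | a ≤ θ * ∑ v ∈ B, X v w}) := by
        rw [← mul_assoc, h5, one_mul]
    _ ≤ ENNReal.ofReal (Real.exp (-a)) * ENNReal.ofReal (Real.exp (B.card * c)) :=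
        mul_le_mul_right h4 _
    _ = ENNReal.ofReal (Real.exp (B.card * c - a)) := by
        rw [← ENNReal.ofReal_mul (Real.exp_pos _).le, ← Real.exp_add]; ring_nf
    _ ≤ _ := ENNReal.ofReal_le_ofReal (Real.exp_le_exp.2 hb)

/-- Chernoff's bound for the upper tail of a sum of independent variables in `[0, 1]`. -/
theorem chernoff_upper {X : κ → (ι → ℝ) → ℝ} {D : κ → Set ι} (B : Finset κ)
    (hX : ∀ v ∈ B, Measurable (X v)) (h01 : ∀ v ∈ B, ∀ w, X v w ∈ Set.Icc (0 : ℝ) 1)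
    (hD : ∀ v ∈ B, DependsOn (X v) (D v))
    (hdis : ∀ u ∈ B, ∀ v ∈ B, u ≠ v → Disjoint (D u) (D v)) {p l δ : ℝ}
    (hp : ∀ v ∈ B, ∫ w, X v w ∂(Measure.pi fun _ : ι => μ) ≤ p) (hl : B.card * p ≤ l)
    (hl0 : 0 ≤ l) (hδ : 0 < δ) (hδ1 : δ ≤ 1) :
    (Measure.pi fun _ : ι => μ) {w | (1 + δ) * l ≤ ∑ v ∈ B, X v w} ≤
      ENNReal.ofReal (Real.exp (-(δ ^ 2 / 4 * l))) := by
  have hθ : Real.exp (δ / 2) - 1 ≤ δ / 2 + (δ / 2) ^ 2 := by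
    have := Real.abs_exp_sub_one_sub_id_le (x := δ / 2) (by rw [abs_of_pos] <;> linarith)
    linarith [abs_le.1 this]
  have hθ0 : 0 ≤ Real.exp (δ / 2) - 1 := by
    have := Real.add_one_le_exp (δ / 2); linarith
  -- With θ = δ/2 the exponent is at most (δ/2 + δ²/4)l - (δ/2)(1 + δ)l = -δ²l/4. The lower tail
  -- uses θ = -δ/2 in the same way.
  refine (measure_mono ?_).trans (measure_sum_ge_le_of_exp (μ := μ) B hX h01 hD hdis
    (θ := δ / 2) (c := (Real.exp (δ / 2) - 1) * p) (a := δ / 2 * ((1 + δ) * l))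
    (fun v hv => mul_le_mul_of_nonneg_left (hp v hv) hθ0) ?_)
  · intro w hw
    have hw' : (1 + δ) * l ≤ ∑ v ∈ B, X v w := hw
    exact mul_le_mul_of_nonneg_left hw' (by positivity)
  · have : (B.card : ℝ) * ((Real.exp (δ / 2) - 1) * p) ≤ (δ / 2 + (δ / 2) ^ 2) * l := by
      calc (B.card : ℝ) * ((Real.exp (δ / 2) - 1) * p)
          = (Real.exp (δ / 2) - 1) * (B.card * p) := by ring
        _ ≤ (Real.exp (δ / 2) - 1) * l := mul_le_mul_of_nonneg_left hl hθ0
        _ ≤ _ := mul_le_mul_of_nonneg_right hθ hl0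
    nlinarith

/-- Chernoff's bound for the lower tail of a sum of independent variables in `[0, 1]`. -/
theorem chernoff_lower {X : κ → (ι → ℝ) → ℝ} {D : κ → Set ι} (B : Finset κ)
    (hX : ∀ v ∈ B, Measurable (X v)) (h01 : ∀ v ∈ B, ∀ w, X v w ∈ Set.Icc (0 : ℝ) 1)
    (hD : ∀ v ∈ B, DependsOn (X v) (D v))
    (hdis : ∀ u ∈ B, ∀ v ∈ B, u ≠ v → Disjoint (D u) (D v)) {p l δ : ℝ}
    (hp : ∀ v ∈ B, p ≤ ∫ w, X v w ∂(Measure.pi fun _ : ι => μ)) (hl : l ≤ B.card * p)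
    (hl0 : 0 ≤ l) (hδ : 0 < δ) (hδ1 : δ ≤ 1) :
    (Measure.pi fun _ : ι => μ) {w | ∑ v ∈ B, X v w ≤ (1 - δ) * l} ≤
      ENNReal.ofReal (Real.exp (-(δ ^ 2 / 4 * l))) := by
  have hθ : Real.exp (-(δ / 2)) - 1 ≤ -(δ / 2) + (δ / 2) ^ 2 := by
    have := Real.abs_exp_sub_one_sub_id_le (x := -(δ / 2))
      (by rw [abs_neg, abs_of_pos] <;> linarith)
    linarith [abs_le.1 this]
  have hθ1 : -(δ / 2) + (δ / 2) ^ 2 ≤ 0 := by nlinarith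
  refine (measure_mono ?_).trans (measure_sum_ge_le_of_exp (μ := μ) B hX h01 hD hdis
    (θ := -(δ / 2)) (c := (Real.exp (-(δ / 2)) - 1) * p) (a := -(δ / 2) * ((1 - δ) * l))
    (fun v hv => mul_le_mul_of_nonpos_left (hp v hv) (hθ.trans hθ1)) ?_)
  · intro w hw
    have hw' : ∑ v ∈ B, X v w ≤ (1 - δ) * l := hw
    exact mul_le_mul_of_nonpos_left hw' (by linarith)
  · have : (B.card : ℝ) * ((Real.exp (-(δ / 2)) - 1) * p) ≤ (-(δ / 2) + (δ / 2) ^ 2) * l := by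
      calc (B.card : ℝ) * ((Real.exp (-(δ / 2)) - 1) * p)
          = (Real.exp (-(δ / 2)) - 1) * (B.card * p) := by ring
        _ ≤ (Real.exp (-(δ / 2)) - 1) * l := mul_le_mul_of_nonpos_left hl (hθ.trans hθ1)
        _ ≤ _ := mul_le_mul_of_nonneg_right hθ hl0
    nlinarith

end Product

/-! ### Consequences of density one at zero: truncated moments and minima of independent weights. -/

section Law

/-- Two-sided bounds, with relative error `δ`, for a law on the interval `(0, η]`. -/
structure NearZero (μ : Measure ℝ) (δ η : ℝ) : Prop where
  pos : 0 < η
  lower : ∀ y, 0 < y → y ≤ η → (1 - δ) * y ≤ μ.real (Set.Iio y)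
  upper : ∀ y, 0 < y → y ≤ η → μ.real (Set.Iio y) ≤ (1 + δ) * y
  tail_lower : ∀ y, 0 < y → y ≤ η → Real.exp (-((1 + δ) * y)) ≤ μ.real (Set.Ici y)
  tail_upper : ∀ y, 0 < y → y ≤ η → μ.real (Set.Ici y) ≤ Real.exp (-((1 - δ) * y))

variable {μ : Measure ℝ} [IsProbabilityMeasure μ]

lemma real_Ici_eq (y : ℝ) : μ.real (Set.Ici y) = 1 - μ.real (Set.Iio y) := by
  rw [← Set.compl_Iio, probReal_compl_eq_one_sub measurableSet_Iio]

lemma HasDensityOneAtZero.nearZero (hμ : HasDensityOneAtZero μ) {δ : ℝ} (hδ : 0 < δ)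
    (hδ1 : δ ≤ 1) : ∃ η, η ≤ 1 ∧ NearZero μ δ η := by
  have h := hμ.density.bound (show (0 : ℝ) < δ / 3 by positivity)
  rw [eventually_nhdsWithin_iff] at h
  obtain ⟨e, he, h⟩ := Metric.eventually_nhds_iff.1 h
  have key : ∀ y, 0 < y → y ≤ min (e / 2) (δ / 10) →
      (1 - δ / 3) * y ≤ μ.real (Set.Iio y) ∧ μ.real (Set.Iio y) ≤ (1 + δ / 3) * y := by
    intro y hy hye
    have h1 := h (y := y) (by
      rw [Real.dist_eq, sub_zero, abs_of_pos hy]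
      linarith [min_le_left (e / 2) (δ / 10)]) hy
    rw [Real.norm_eq_abs, Real.norm_eq_abs, abs_of_pos hy, abs_le] at h1
    constructor <;> linarith [h1.1, h1.2]
  refine ⟨min (e / 2) (δ / 10), (min_le_right _ _).trans (by linarith), by positivity,
    fun y hy hye => ?_, fun y hy hye => ?_, fun y hy hye => ?_, fun y hy hye => ?_⟩
  · nlinarith [(key y hy hye).1]
  · nlinarith [(key y hy hye).2]
  · rw [real_Ici_eq]
    have hk := (key y hy hye).2
    have hy10 : y ≤ δ / 10 := hye.trans (min_le_right _ _)
    set x := (1 + δ / 3) * y with hx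
    have hx0 : 0 < x := by positivity
    have hx1 : x ≤ 1 / 5 := by nlinarith
    -- This is the reciprocal of 1 + u ≤ e^u at u = x/(1-x). The bound y ≤ δ/10 gives x ≤ δ/5, so
    -- that the quadratic loss fits into the factor 1 + δ.
    have h1 : Real.exp (-(x / (1 - x))) ≤ 1 - x := by
      rw [Real.exp_neg]
      have h2 := Real.add_one_le_exp (x / (1 - x))
      have h3 : x / (1 - x) + 1 = (1 - x)⁻¹ := by
        have : 1 - x ≠ 0 := by linarith
        field_simp
        ring
      rw [h3] at h2
      exact inv_le_of_inv_le₀ (by linarith) h2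
    refine le_trans (Real.exp_le_exp.2 ?_) (h1.trans (by linarith))
    rw [neg_le_neg_iff, div_le_iff₀ (by linarith)]
    have : x ≤ δ / 5 := by nlinarith
    have h4 : (1 + δ / 3) ≤ (1 + δ) * (1 - x) := by nlinarith
    calc x = (1 + δ / 3) * y := rfl
      _ ≤ ((1 + δ) * (1 - x)) * y := mul_le_mul_of_nonneg_right h4 hy.le
      _ = _ := by ring
  · rw [real_Ici_eq]
    have hk := (key y hy hye).1
    have h2 := Real.add_one_le_exp (-((1 - δ) * y))
    nlinarith

lemma lintegral_Ioc_ofReal {f : ℝ → ℝ} {t : ℝ} (ht : 0 ≤ t) (hf : Continuous f)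
    (h0 : ∀ y, 0 < y → y ≤ t → 0 ≤ f y) :
    ∫⁻ y in Set.Ioc 0 t, ENNReal.ofReal (f y) = ENNReal.ofReal (∫ y in (0 : ℝ)..t, f y) := by
  rw [intervalIntegral.integral_of_le ht, ofReal_integral_eq_lintegral_ofReal]
  · exact (hf.intervalIntegrable 0 t).1
  · rw [EventuallyLE, ae_restrict_iff' measurableSet_Ioc]
    exact Eventually.of_forall fun y hy => h0 y hy.1 hy.2

/-- `(t - x)⁺ / t`, clamped to `[0, 1]` for negative `x`. -/
noncomputable def gap (t x : ℝ) : ℝ := max 0 (min (1 - x / t) 1)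

lemma gap_mem (t x : ℝ) : gap t x ∈ Set.Icc (0 : ℝ) 1 :=
  ⟨le_max_left _ _, max_le zero_le_one (min_le_right _ _)⟩

lemma measurable_gap (t : ℝ) : Measurable (gap t) := by
  unfold gap; fun_prop

lemma one_sub_le_gap {t x : ℝ} (ht : 0 < t) (hx : 0 ≤ x) : t - x ≤ t * gap t x := by
  have h : 1 - x / t ≤ gap t x := by
    refine le_trans ?_ (le_max_right _ _)
    refine le_min le_rfl ?_
    have : 0 ≤ x / t := by positivity
    linarith
  calc t - x = t * (1 - x / t) := by field_simp
    _ ≤ _ := mul_le_mul_of_nonneg_left h ht.le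

/-- Layer cake formula: for 0 < y < t, the clamped value of t - x exceeds y exactly when x < t - y.
With P(W < t - y) close to t - y the integral is about t²/2. -/
lemma lintegral_gap_eq {t : ℝ} (ht : 0 < t) :
    ∫⁻ x, ENNReal.ofReal (t * gap t x) ∂μ =
      ∫⁻ y in Set.Ioo 0 t, ENNReal.ofReal (μ.real (Set.Iio (t - y))) := by
  rw [lintegral_eq_lintegral_meas_lt μ
    (Eventually.of_forall fun x => mul_nonneg ht.le (gap_mem t x).1)
    ((measurable_gap t).const_mul t).aemeasurable]
  have e : Set.Ioi (0 : ℝ) = Set.Ioo 0 t ∪ Set.Ici t := (Set.Ioo_union_Ici_eq_Ioi ht).symm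
  rw [e, lintegral_union measurableSet_Ici
    (Set.disjoint_left.2 fun y hy hy' => not_le.2 hy.2 hy')]
  have z : ∫⁻ y in Set.Ici t, μ {a | y < t * gap t a} = 0 := by
    rw [setLIntegral_congr_fun (g := fun _ => 0) measurableSet_Ici]
    · simp
    · intro y hy
      have : {a | y < t * gap t a} = ∅ := by
        ext a
        simp only [Set.mem_ofPred_eq, Set.mem_empty_iff_false, iff_false, not_lt]
        have := (gap_mem t a).2
        have hy' : t ≤ y := hy
        nlinarith
      simp [this]
  rw [z, add_zero]
  refine setLIntegral_congr_fun measurableSet_Ioo fun y hy => ?_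
  have : {a | y < t * gap t a} = Set.Iio (t - y) := by
    ext a
    have h1 : t * (1 - a / t) = t - a := by field_simp
    have h2 : t * gap t a = max 0 (min (t - a) t) := by
      unfold gap
      rw [mul_max_of_nonneg _ _ ht.le, mul_min_of_nonneg _ _ ht.le, h1, mul_zero, mul_one]
    have hy1 := hy.1
    have hy2 := hy.2
    simp only [Set.mem_ofPred_eq, h2, Set.mem_Iio, lt_max_iff, lt_min_iff]
    constructor
    · rintro (h | h)
      · linarith
      · linarith [h.1]
    · intro h
      exact Or.inr ⟨by linarith, hy2⟩
  simp only [this]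
  rw [ofReal_measureReal]

lemma integrable_gap (t : ℝ) : Integrable (gap t) μ :=
  Integrable.of_mem_Icc 0 1 (measurable_gap t).aemeasurable (Eventually.of_forall (gap_mem t))

lemma ofReal_integral_gap {t : ℝ} (ht : 0 < t) :
    ENNReal.ofReal (t * ∫ x, gap t x ∂μ) = ∫⁻ x, ENNReal.ofReal (t * gap t x) ∂μ := by
  rw [← integral_const_mul, ofReal_integral_eq_lintegral_ofReal ((integrable_gap t).const_mul t)]
  exact Eventually.of_forall fun x => mul_nonneg ht.le (gap_mem t x).1

lemma integral_sub_self (c t : ℝ) : ∫ y in (0 : ℝ)..t, c * (t - y) = c * (t ^ 2 / 2) := by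
  rw [intervalIntegral.integral_const_mul, intervalIntegral.integral_sub (by simp) (by simp)]
  simp only [intervalIntegral.integral_const, integral_id, smul_eq_mul]
  ring

lemma NearZero.integral_gap_le {δ η t : ℝ} (h : NearZero μ δ η) (hδ : 0 < δ) (ht : 0 < t)
    (htη : t ≤ η) : ∫ x, gap t x ∂μ ≤ (1 + δ) * t / 2 := by
  have h1 : ENNReal.ofReal (t * ∫ x, gap t x ∂μ) ≤ ENNReal.ofReal ((1 + δ) * (t ^ 2 / 2)) := by
    rw [ofReal_integral_gap ht, lintegral_gap_eq ht, ← integral_sub_self,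
      ← lintegral_Ioc_ofReal ht.le (by fun_prop), setLIntegral_congr Ioo_ae_eq_Ioc.symm]
    · refine setLIntegral_mono' measurableSet_Ioo fun y hy => ENNReal.ofReal_le_ofReal ?_
      exact h.upper _ (by linarith [hy.2]) (by linarith [hy.1])
    · intro y _ hy
      have : 0 ≤ t - y := by linarith
      positivity
  rw [ENNReal.ofReal_le_ofReal_iff (by positivity)] at h1
  rw [← mul_le_mul_iff_right₀ ht]
  linarith

lemma NearZero.le_integral_gap {δ η t : ℝ} (h : NearZero μ δ η) (hδ1 : δ ≤ 1)
    (ht : 0 < t) (htη : t ≤ η) : (1 - δ) * t / 2 ≤ ∫ x, gap t x ∂μ := by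
  have h1 : ENNReal.ofReal ((1 - δ) * (t ^ 2 / 2)) ≤ ENNReal.ofReal (t * ∫ x, gap t x ∂μ) := by
    rw [ofReal_integral_gap ht, lintegral_gap_eq ht, ← integral_sub_self,
      ← lintegral_Ioc_ofReal ht.le (by fun_prop), setLIntegral_congr Ioo_ae_eq_Ioc.symm]
    · refine setLIntegral_mono' measurableSet_Ioo fun y hy => ENNReal.ofReal_le_ofReal ?_
      exact h.lower _ (by linarith [hy.2]) (by linarith [hy.1])
    · intro y _ hy
      have : 0 ≤ t - y := by linarith
      have : 0 ≤ 1 - δ := by linarith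
      positivity
  rw [ENNReal.ofReal_le_ofReal_iff
    (mul_nonneg ht.le (integral_nonneg fun x => (gap_mem t x).1))] at h1
  rw [← mul_le_mul_iff_right₀ ht]
  linarith

/-- `x / t` on `[0, t)`, and `0` elsewhere. -/
noncomputable def below (t x : ℝ) : ℝ := (Set.Ico 0 t).indicator (fun x => x / t) x

lemma below_mem {t : ℝ} (ht : 0 < t) (x : ℝ) : below t x ∈ Set.Icc (0 : ℝ) 1 := by
  unfold below
  by_cases hx : x ∈ Set.Ico 0 t
  · rw [Set.indicator_of_mem hx]
    exact ⟨div_nonneg hx.1 ht.le, (div_le_one ht).2 hx.2.le⟩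
  · rw [Set.indicator_of_notMem hx]
    simp

lemma measurable_below (t : ℝ) : Measurable (below t) :=
  (measurable_id.div_const t).indicator measurableSet_Ico

/-- For nonnegative x, `below t x` is the indicator of x < t minus `gap t x`; hence the mean is at
most (1 + δ)t - (1 - δ)t/2. -/
lemma NearZero.integral_below_le {δ η t : ℝ} (h : NearZero μ δ η) (hδ1 : δ ≤ 1)
    (h0 : ∀ᵐ x ∂μ, 0 ≤ x) (ht : 0 < t) (htη : t ≤ η) :
    ∫ x, below t x ∂μ ≤ (1 + 3 * δ) * t / 2 := by
  have e : ∫ x, below t x ∂μ = ∫ x, ((Set.Iio t).indicator 1 x - gap t x) ∂μ := by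
    refine integral_congr_ae ?_
    filter_upwards [h0] with x hx
    unfold below gap
    have hxt : 0 ≤ x / t := by positivity
    by_cases hxt' : x < t
    · rw [Set.indicator_of_mem (show x ∈ Set.Ico 0 t from ⟨hx, hxt'⟩),
        Set.indicator_of_mem (show x ∈ Set.Iio t from hxt')]
      have : x / t ≤ 1 := (div_le_one ht).2 hxt'.le
      rw [min_eq_left (by linarith), max_eq_right (by linarith)]
      simp
    · rw [Set.indicator_of_notMem (fun hh : x ∈ Set.Ico 0 t => hxt' hh.2),
        Set.indicator_of_notMem (fun hh : x ∈ Set.Iio t => hxt' hh)]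
      have : 1 ≤ x / t := (one_le_div ht).2 (not_lt.1 hxt')
      rw [min_eq_left (by linarith), max_eq_left (by linarith)]
      simp
  have hi : Integrable ((Set.Iio t).indicator (1 : ℝ → ℝ)) μ :=
    (integrable_const (1 : ℝ)).indicator measurableSet_Iio
  rw [e, integral_sub hi (integrable_gap t), integral_indicator_one measurableSet_Iio]
  have h1 := h.upper t ht htη
  have h2 := h.le_integral_gap hδ1 ht htη
  linarith

variable {ι : Type*}

/-- The minimum of `t` and the entries `w e`, `e ∈ A`, or `0` if this is negative. -/
noncomputable def truncMin (A : Finset ι) (t : ℝ) (w : ι → ℝ) : ℝ := max 0 (A.fold min t w)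

lemma truncMin_mem (A : Finset ι) {t : ℝ} (ht : 0 ≤ t) (w : ι → ℝ) :
    truncMin A t w ∈ Set.Icc 0 t :=
  ⟨le_max_left _ _, max_le ht (Finset.fold_min_le t |>.2 (Or.inl le_rfl))⟩

lemma measurable_truncMin (A : Finset ι) (t : ℝ) : Measurable (truncMin A t) := by
  classical
  refine measurable_const.max ?_
  induction A using Finset.induction_on with
  | empty => simp
  | insert a A ha ih =>
    simp only [Finset.fold_insert ha]
    exact (measurable_pi_apply a).min ih

lemma dependsOn_truncMin (A : Finset ι) (t : ℝ) : DependsOn (truncMin A t) (A : Set ι) := by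
  intro x y hxy
  unfold truncMin
  rw [Finset.fold_congr (g := y) fun e he => hxy e he]

lemma le_truncMin_iff {A : Finset ι} {t y : ℝ} (hy : 0 < y) (w : ι → ℝ) :
    y ≤ truncMin A t w ↔ y ≤ t ∧ ∀ e ∈ A, y ≤ w e := by
  unfold truncMin
  rw [le_max_iff, Finset.le_fold_min]
  exact ⟨fun h => h.resolve_left (not_le.2 hy), Or.inr⟩

lemma truncMin_le {A : Finset ι} {t : ℝ} {w : ι → ℝ} {e : ι} (he : e ∈ A) (h0 : 0 ≤ w e) :
    truncMin A t w ≤ w e :=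
  max_le h0 (Finset.fold_min_le _ |>.2 (Or.inr ⟨e, he, le_rfl⟩))

lemma truncMin_anti {A A' : Finset ι} (h : A ⊆ A') {t : ℝ} (w : ι → ℝ) :
    truncMin A' t w ≤ truncMin A t w := by
  refine max_le_max le_rfl ?_
  rw [Finset.le_fold_min]
  exact ⟨Finset.fold_min_le _ |>.2 (Or.inl le_rfl),
    fun e he => Finset.fold_min_le _ |>.2 (Or.inr ⟨e, h he, le_rfl⟩)⟩

lemma exists_eq_truncMin {A : Finset ι} {t : ℝ} {w : ι → ℝ} (h0 : ∀ e ∈ A, 0 ≤ w e)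
    (hlt : ∃ e ∈ A, w e < t) : ∃ e ∈ A, w e = truncMin A t w := by
  obtain ⟨e0, he0, hlt⟩ := hlt
  obtain ⟨e, he, hmin⟩ := A.exists_min_image w ⟨e0, he0⟩
  refine ⟨e, he, le_antisymm ?_ (truncMin_le he (h0 e he))⟩
  unfold truncMin
  refine le_max_of_le_right ?_
  rw [Finset.le_fold_min]
  exact ⟨(hmin e0 he0).trans hlt.le, hmin⟩

variable [Fintype ι]

lemma pi_forall_le (A : Finset ι) (y : ℝ) :
    (Measure.pi fun _ : ι => μ) {w | ∀ e ∈ A, y ≤ w e} = μ (Set.Ici y) ^ A.card := by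
  classical
  have : {w : ι → ℝ | ∀ e ∈ A, y ≤ w e} =
      Set.univ.pi fun e => if e ∈ A then Set.Ici y else Set.univ := by
    ext w
    simp only [Set.mem_ofPred_eq, Set.mem_pi, Set.mem_univ, true_imp_iff]
    refine forall_congr' fun e => ?_
    by_cases he : e ∈ A <;> simp [he]
  rw [this, Measure.pi_pi]
  simp only [apply_ite μ, measure_univ]
  rw [Finset.prod_ite, Finset.prod_const_one, mul_one, Finset.prod_const]
  simp

/-- Layer cake again: a minimum of independent weights is at least y when all of them are. -/
lemma lintegral_truncMin (A : Finset ι) {t : ℝ} (ht : 0 ≤ t) :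
    ∫⁻ w, ENNReal.ofReal (truncMin A t w) ∂(Measure.pi fun _ : ι => μ) =
      ∫⁻ y in Set.Ioc 0 t, ENNReal.ofReal (μ.real (Set.Ici y) ^ A.card) := by
  rw [lintegral_eq_lintegral_meas_le _ (Eventually.of_forall fun w => (truncMin_mem A ht w).1)
    (measurable_truncMin A t).aemeasurable, ← Set.Ioc_union_Ioi_eq_Ioi ht,
    lintegral_union measurableSet_Ioi
      (Set.disjoint_left.2 fun y hy hy' => not_lt.2 hy.2 hy')]
  have z : ∫⁻ y in Set.Ioi t, (Measure.pi fun _ : ι => μ) {a | y ≤ truncMin A t a} = 0 := by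
    rw [setLIntegral_congr_fun (g := fun _ => 0) measurableSet_Ioi]
    · simp
    · intro y hy
      have : {a | y ≤ truncMin A t a} = ∅ := by
        ext a
        simp only [Set.mem_ofPred_eq, Set.mem_empty_iff_false, iff_false, not_le]
        exact (truncMin_mem A ht a).2.trans_lt hy
      simp [this]
  rw [z, add_zero]
  refine setLIntegral_congr_fun measurableSet_Ioc fun y hy => ?_
  have : {a | y ≤ truncMin A t a} = {w : ι → ℝ | ∀ e ∈ A, y ≤ w e} := by
    ext a
    simp only [Set.mem_ofPred_eq, le_truncMin_iff hy.1, hy.2, true_and]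
  simp only [this]
  rw [pi_forall_le, ENNReal.ofReal_pow measureReal_nonneg, ofReal_measureReal]

lemma integral_exp_neg_mul {c : ℝ} (hc : 0 < c) (t : ℝ) :
    ∫ y in (0 : ℝ)..t, Real.exp (-(c * y)) = (1 - Real.exp (-(c * t))) / c := by
  have h : ∀ y ∈ Set.uIcc 0 t, HasDerivAt (fun y => -Real.exp (-(c * y)) / c)
      (Real.exp (-(c * y))) y := by
    intro y _
    have h1 : HasDerivAt (fun y : ℝ => -(c * y)) (-(c * 1)) y :=
      ((hasDerivAt_id y).const_mul c).neg
    have h2 : HasDerivAt (fun y : ℝ => -Real.exp (-(c * y)) / c)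
        (-(Real.exp (-(c * y)) * -(c * 1)) / c) y := (h1.exp.neg).div_const c
    have h3 : -(Real.exp (-(c * y)) * -(c * 1)) / c = Real.exp (-(c * y)) := by
      field_simp
    rwa [h3] at h2
  rw [intervalIntegral.integral_eq_sub_of_hasDerivAt h
    (Continuous.intervalIntegrable (by fun_prop) _ _)]
  simp
  ring

lemma le_lintegral_truncMin {A : Finset ι} (hA : A.Nonempty) {t c : ℝ} (ht : 0 ≤ t) (hc : 0 < c)
    (h : ∀ y, 0 < y → y ≤ t → Real.exp (-(c * y)) ≤ μ.real (Set.Ici y)) :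
    ENNReal.ofReal ((1 - Real.exp (-(c * A.card * t))) / (c * A.card)) ≤
      ∫⁻ w, ENNReal.ofReal (truncMin A t w) ∂(Measure.pi fun _ : ι => μ) := by
  have hA' : (0 : ℝ) < A.card := by exact_mod_cast hA.card_pos
  rw [lintegral_truncMin A ht, ← integral_exp_neg_mul (by positivity),
    ← lintegral_Ioc_ofReal ht (by fun_prop) (fun _ _ _ => (Real.exp_pos _).le)]
  refine setLIntegral_mono' measurableSet_Ioc fun y hy => ENNReal.ofReal_le_ofReal ?_
  refine le_trans (le_of_eq ?_) (pow_le_pow_left₀ (Real.exp_pos _).le (h y hy.1 hy.2) _)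
  rw [← Real.exp_nat_mul]
  ring_nf

lemma le_integral_truncMin {A : Finset ι} (hA : A.Nonempty) {t c : ℝ} (ht : 0 ≤ t) (hc : 0 < c)
    (h : ∀ y, 0 < y → y ≤ t → Real.exp (-(c * y)) ≤ μ.real (Set.Ici y)) :
    (1 - Real.exp (-(c * A.card * t))) / (c * A.card) ≤
      ∫ w, truncMin A t w ∂(Measure.pi fun _ : ι => μ) := by
  have h1 := le_lintegral_truncMin hA ht hc h
  rw [← ofReal_integral_eq_lintegral_ofReal
    (Integrable.of_mem_Icc 0 t (measurable_truncMin A t).aemeasurable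
      (Eventually.of_forall (truncMin_mem A ht)))
    (Eventually.of_forall fun w => (truncMin_mem A ht w).1),
    ENNReal.ofReal_le_ofReal_iff (integral_nonneg fun w => (truncMin_mem A ht w).1)] at h1
  exact h1

lemma lintegral_truncMin_le {A : Finset ι} (hA : A.Nonempty) {t c : ℝ} (ht : 0 ≤ t) (hc : 0 < c)
    (h : ∀ y, 0 < y → y ≤ t → μ.real (Set.Ici y) ≤ Real.exp (-(c * y))) :
    ∫⁻ w, ENNReal.ofReal (truncMin A t w) ∂(Measure.pi fun _ : ι => μ) ≤
      ENNReal.ofReal (1 / (c * A.card)) := by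
  have hA' : (0 : ℝ) < A.card := by exact_mod_cast hA.card_pos
  calc _ ≤ ∫⁻ y in Set.Ioc 0 t, ENNReal.ofReal (Real.exp (-(c * A.card * y))) := by
        rw [lintegral_truncMin A ht]
        refine setLIntegral_mono' measurableSet_Ioc fun y hy => ENNReal.ofReal_le_ofReal ?_
        refine le_trans (pow_le_pow_left₀ measureReal_nonneg (h y hy.1 hy.2) _) (le_of_eq ?_)
        rw [← Real.exp_nat_mul]
        ring_nf
    _ = ENNReal.ofReal ((1 - Real.exp (-(c * A.card * t))) / (c * A.card)) := by
        rw [lintegral_Ioc_ofReal ht (by fun_prop) (fun _ _ _ => (Real.exp_pos _).le),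
          integral_exp_neg_mul (by positivity)]
    _ ≤ _ := by
        refine ENNReal.ofReal_le_ofReal (div_le_div_of_nonneg_right ?_ (by positivity))
        linarith [Real.exp_pos (-(c * A.card * t))]

/-- The infimum is at most the value at one fixed entry, which is independent of the event that the
others are at least η; hence the exponent |A| - 1. This controls terminals without a light edge. -/
lemma lintegral_iInf_le {A : Finset ι} (hA : A.Nonempty) {h : ℝ → ENNReal} (hh : Measurable h)
    (η : ℝ) :
    ∫⁻ w, {w : ι → ℝ | ∀ e ∈ A, η ≤ w e}.indicator (fun w => ⨅ e ∈ A, h (w e)) w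
      ∂(Measure.pi fun _ : ι => μ) ≤ (∫⁻ x, h x ∂μ) * μ (Set.Ici η) ^ (A.card - 1) := by
  classical
  obtain ⟨a, ha⟩ := hA
  have hm : MeasurableSet {w : ι → ℝ | ∀ e ∈ A.erase a, η ≤ w e} := by
    have : {w : ι → ℝ | ∀ e ∈ A.erase a, η ≤ w e} = ⋂ e ∈ A.erase a, {w | η ≤ w e} := by
      ext; simp
    rw [this]
    exact Finset.measurableSet_biInter _ fun e _ =>
      measurableSet_le measurable_const (measurable_pi_apply e)
  calc _ ≤ ∫⁻ w, h (w a) * {w : ι → ℝ | ∀ e ∈ A.erase a, η ≤ w e}.indicator 1 w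
        ∂(Measure.pi fun _ : ι => μ) := by
        refine lintegral_mono fun w => ?_
        by_cases hw : ∀ e ∈ A, η ≤ w e
        · rw [Set.indicator_of_mem (show w ∈ {w : ι → ℝ | ∀ e ∈ A, η ≤ w e} from hw),
            Set.indicator_of_mem (show w ∈ {w : ι → ℝ | ∀ e ∈ A.erase a, η ≤ w e} from
              fun e he => hw e (Finset.mem_of_mem_erase he)), Pi.one_apply, mul_one]
          exact iInf₂_le a ha
        · rw [Set.indicator_of_notMem (show w ∉ {w : ι → ℝ | ∀ e ∈ A, η ≤ w e} from hw)]
          exact zero_le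
    _ = (∫⁻ w, h (w a) ∂(Measure.pi fun _ : ι => μ)) * μ (Set.Ici η) ^ (A.card - 1) := by
        rw [lintegral_mul_of_dependsOn_disjoint (f := fun w => h (w a)) (S := {a})
          (T := (A.erase a : Finset ι)) (hh.comp (measurable_pi_apply a)) (measurable_one.indicator hm),
          lintegral_indicator_one hm, pi_forall_le, Finset.card_erase_of_mem ha]
        · intro x y hxy
          simp only
          rw [hxy a rfl]
        · intro x y hxy
          simp only [Set.indicator]
          congr 1
          refine propext (forall₂_congr fun e he => ?_)
          rw [hxy e he]
        · simp
    _ = _ := by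
        rw [← (measurePreserving_eval (fun _ : ι => μ) a).lintegral_comp hh]

end Law

/-! ### Centres of finite trees. -/

section Trees

variable {α : Type*} {G : SimpleGraph α}

lemma exists_adj_dist_add_one (hG : G.Connected) {c x : α} (h : G.dist c x ≠ 0) :
    ∃ u, G.Adj u x ∧ G.dist c u + 1 = G.dist c x := by
  obtain ⟨p, hp⟩ := hG.exists_walk_length_eq_dist x c
  cases p with
  | nil => simp at h
  | @cons _ u _ hadj q =>
    refine ⟨u, hadj.symm, le_antisymm ?_ ?_⟩
    · rw [SimpleGraph.dist_comm (u := c) (v := x), ← hp, SimpleGraph.Walk.length_cons,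
        SimpleGraph.dist_comm]
      exact Nat.succ_le_succ (SimpleGraph.dist_le q)
    · have h1 := hG.dist_triangle (u := c) (v := u) (w := x)
      have h2 : G.dist u x = 1 := SimpleGraph.dist_eq_one_iff_adj.2 hadj.symm
      omega

lemma dist_eq_length_of_isPath (hG : G.IsTree) {x y : α} {p : G.Walk x y} (hp : p.IsPath) :
    G.dist x y = p.length := by
  obtain ⟨q, hq, hql⟩ := hG.connected.exists_path_of_dist x y
  have h := (hG.isAcyclic.subsingleton_path x y).elim ⟨p, hp⟩ ⟨q, hq⟩
  have h' : p = q := congrArg Subtype.val h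
  rw [h', hql]

/-- In a tree, distances between the two sides of an edge are additive. -/
lemma dist_eq_of_sides (hG : G.IsTree) {c c' x z : α} (hcc : G.Adj c c')
    (hx : G.dist x c = G.dist x c' + 1) (hz : G.dist c' z = G.dist c z + 1) :
    G.dist x z = G.dist x c + G.dist c z := by
  classical
  obtain ⟨p, hp, hpl⟩ := hG.connected.exists_path_of_dist x c'
  obtain ⟨q, hq, hql⟩ := hG.connected.exists_path_of_dist c z
  have hc : c ∉ p.support := by
    intro hc
    have h1 := (SimpleGraph.dist_le (p.takeUntil c hc)).trans (p.length_takeUntil_le_length hc)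
    omega
  have hc' : c' ∉ q.support := by
    intro hc'
    have h1 := (SimpleGraph.dist_le (q.dropUntil c' hc')).trans
      (q.length_dropUntil_le_length hc')
    omega
  -- In an acyclic graph a walk is a path as soon as consecutive edges differ, so only the two
  -- junctions with the edge between c and c' need care.
  have hpath : (p.append (SimpleGraph.Walk.cons hcc.symm q)).IsPath := by
    rw [hG.isAcyclic.isPath_iff_isChain, SimpleGraph.Walk.edges_append,
      SimpleGraph.Walk.edges_cons, List.isChain_append, List.isChain_cons]
    refine ⟨(hG.isAcyclic.isPath_iff_isChain p).1 hp, ⟨?_,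
      (hG.isAcyclic.isPath_iff_isChain q).1 hq⟩, ?_⟩
    · rintro e he rfl
      exact hc' (q.fst_mem_support_of_mem_edges (List.mem_of_mem_head? he))
    · rintro e he e' he' rfl
      simp only [List.head?_cons, Option.mem_def, Option.some.injEq] at he'
      subst he'
      exact hc (p.snd_mem_support_of_mem_edges (List.mem_of_mem_getLast? he))
  rw [dist_eq_length_of_isPath hG hpath, SimpleGraph.Walk.length_append,
    SimpleGraph.Walk.length_cons]
  omega

/-- Take c of least eccentricity and x farthest from c. -/
lemma exists_center [Finite α] [Nonempty α] (G : SimpleGraph α) :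
    ∃ (c x : α), (∀ y, G.dist c y ≤ G.dist c x) ∧ ∀ c', ∃ y, G.dist c x ≤ G.dist c' y := by
  have h1 : ∀ c : α, ∃ x, ∀ y, G.dist c y ≤ G.dist c x := fun c => Finite.exists_max _
  choose f hf using h1
  obtain ⟨c, hc⟩ := Finite.exists_min fun c => G.dist c (f c)
  exact ⟨c, f c, hf c, fun c' => ⟨f c', hc c'⟩⟩

/-- A step from the centre towards x, to c', does not decrease the eccentricity, so some y is at
distance at least d(c, x) from c'. Such a y is not on the side of c', where the step brings vertices
closer. By `dist_eq_of_sides` the diameter is then at least 2 d(c, x) - 1. -/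
lemma exists_far_side (hG : G.IsTree) {c x : α} (hx : ∀ y, G.dist c y ≤ G.dist c x)
    (hc : ∀ c', ∃ y, G.dist c x ≤ G.dist c' y) (h0 : G.dist c x ≠ 0) :
    ∃ c', G.Adj c c' ∧ G.dist x c = G.dist x c' + 1 ∧
      ∃ y, G.dist c x ≤ G.dist c y + 1 ∧ G.dist c' y = G.dist c y + 1 := by
  obtain ⟨c', hadj, hd⟩ := exists_adj_dist_add_one hG.connected (c := x) (x := c)
    (by rwa [SimpleGraph.dist_comm])
  obtain ⟨y, hy⟩ := hc c'
  refine ⟨c', hadj.symm, hd.symm, y, ?_⟩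
  rcases hG.dist_eq_dist_add_one_of_adj y hadj with h | h
  · rw [SimpleGraph.dist_comm (v := c'), SimpleGraph.dist_comm (v := c)] at h
    omega
  · rw [SimpleGraph.dist_comm (v := c'), SimpleGraph.dist_comm (v := c)] at h
    have := hx y
    omega

/-- A tree of even diameter `≤ 2k` has a centre. -/
lemma exists_root_of_dist_le_even [Finite α] (hG : G.IsTree) {k : ℕ}
    (h : ∀ u v, G.dist u v ≤ 2 * k) : ∃ c, ∀ y, G.dist c y ≤ k := by
  have : Nonempty α := hG.connected.nonempty
  obtain ⟨c, x, hx, hc⟩ := exists_center G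
  refine ⟨c, fun y => (hx y).trans ?_⟩
  by_contra! hk
  obtain ⟨c', hadj, hxc, z, hz1, hz2⟩ := exists_far_side hG hx hc (by omega)
  have h1 := dist_eq_of_sides hG hadj hxc hz2
  have h2 := h x z
  rw [SimpleGraph.dist_comm (u := x) (v := c)] at h1
  omega

/-- A tree of diameter `≤ 2k + 1` has a central vertex or a central edge. -/
lemma exists_roots_of_dist_le_odd [Finite α] (hG : G.IsTree) {k : ℕ}
    (h : ∀ u v, G.dist u v ≤ 2 * k + 1) : ∃ c c', ∀ y, G.dist c y ≤ k ∨ G.dist c' y ≤ k := by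
  have : Nonempty α := hG.connected.nonempty
  obtain ⟨c, x, hx, hc⟩ := exists_center G
  by_cases hk : G.dist c x ≤ k
  · exact ⟨c, c, fun y => Or.inl ((hx y).trans hk)⟩
  obtain ⟨c', hadj, hxc, z, hz1, hz2⟩ := exists_far_side hG hx hc (by omega)
  have h1 := dist_eq_of_sides hG hadj hxc hz2
  have h2 := h x z
  rw [SimpleGraph.dist_comm (u := x) (v := c)] at h1
  -- Here d(c, x) = k + 1. Vertices on the side of c' get closer by the step to c'; those on the
  -- side of c are within k of c, because x lies on the other side.
  refine ⟨c, c', fun y => ?_⟩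
  rcases hG.dist_eq_dist_add_one_of_adj y hadj with h3 | h3
  · right
    rw [SimpleGraph.dist_comm (v := c'), SimpleGraph.dist_comm (v := c)] at h3
    have := hx y
    omega
  · left
    rw [SimpleGraph.dist_comm (v := c'), SimpleGraph.dist_comm (v := c)] at h3
    have h4 := dist_eq_of_sides hG hadj hxc h3
    have h5 := h x y
    rw [SimpleGraph.dist_comm (u := x) (v := c)] at h4
    omega

/-- Distance to a nonempty finite set of roots, as a function with parents. -/
lemma exists_lev_par (hG : G.Connected) (R : Finset α) (hR : R.Nonempty) :
    ∃ (lev : α → ℕ) (par : α → α), (∀ v, lev v = 0 ↔ v ∈ R) ∧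
      (∀ v, lev v ≠ 0 → G.Adj (par v) v ∧ lev (par v) + 1 = lev v) ∧
      ∀ v, ∀ c ∈ R, lev v ≤ G.dist c v := by
  classical
  let lev : α → ℕ := fun v => R.inf' hR fun c => G.dist c v
  have hle : ∀ v, ∀ c ∈ R, lev v ≤ G.dist c v := fun v c hc =>
    Finset.inf'_le (fun c => G.dist c v) hc
  have hex : ∀ v, ∃ c ∈ R, lev v = G.dist c v := fun v =>
    Finset.exists_mem_eq_inf' hR fun c => G.dist c v
  have hpar : ∀ v, ∃ u, lev v ≠ 0 → G.Adj u v ∧ lev u + 1 = lev v := by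
    intro v
    by_cases hv : lev v = 0
    · exact ⟨v, fun h => absurd hv h⟩
    obtain ⟨c, hc, hcv⟩ := hex v
    obtain ⟨u, hu, hd⟩ := exists_adj_dist_add_one hG (c := c) (x := v) (by omega)
    refine ⟨u, fun _ => ⟨hu, le_antisymm ?_ ?_⟩⟩
    · have := hle u c hc
      omega
    · obtain ⟨c', hc', hcu⟩ := hex u
      have h1 := hle v c' hc'
      have h2 := hG.dist_triangle (u := c') (v := u) (w := v)
      have h3 : G.dist u v = 1 := SimpleGraph.dist_eq_one_iff_adj.2 hu
      omega
  choose par hpar using hpar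
  refine ⟨lev, par, fun v => ⟨fun h => ?_, fun h => ?_⟩, hpar, hle⟩
  · obtain ⟨c, hc, hcv⟩ := hex v
    have : c = v := (hG c v).dist_eq_zero_iff.1 (by omega)
    exact this ▸ hc
  · have := hle v v h
    simpa using this

end Trees

/-! ### Elementary facts on weights of subgraphs. -/

section Weight

variable {V : Type*} [Fintype (⊤ : SimpleGraph V).edgeSet]

lemma weight_eq_sum_filter (w : (⊤ : SimpleGraph V).edgeSet → ℝ)
    (H : (⊤ : SimpleGraph V).Subgraph) [DecidablePred fun e : (⊤ : SimpleGraph V).edgeSet =>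
      (e : Sym2 V) ∈ H.edgeSet] :
    weight w H = ∑ e ∈ Finset.univ.filter fun e : (⊤ : SimpleGraph V).edgeSet => (e : Sym2 V) ∈ H.edgeSet,
      w e := by
  unfold weight
  rw [Finset.sum_filter]
  refine Finset.sum_congr rfl fun e _ => ?_
  simp only [Set.indicator, Set.mem_ofPred_eq]
  congr

lemma weight_nonneg {w : (⊤ : SimpleGraph V).edgeSet → ℝ} (hw : ∀ e, 0 ≤ w e)
    (H : (⊤ : SimpleGraph V).Subgraph) : 0 ≤ weight w H :=
  Finset.sum_nonneg fun e _ => Set.indicator_nonneg (fun e _ => hw e) e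

lemma abs_weight_le (w : (⊤ : SimpleGraph V).edgeSet → ℝ) (H : (⊤ : SimpleGraph V).Subgraph) :
    |weight w H| ≤ ∑ e, |w e| := by
  refine (Finset.abs_sum_le_sum_abs _ _).trans (Finset.sum_le_sum fun e _ => ?_)
  unfold Set.indicator
  split_ifs <;> simp

lemma dist_le_of_hasDiamLE {V : Type*} {H : (⊤ : SimpleGraph V).Subgraph} {d : ℕ} (hH : H.coe.IsTree) (hd : HasDiamLE d H) (u v : H.verts) :
    H.coe.dist u v ≤ d := by
  have h := SimpleGraph.ediam_le_iff.1 hd u v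
  rw [← (hH.connected u v).coe_dist_eq_edist] at h
  exact_mod_cast h

end Weight

/-! ### Translation between Steiner trees and forests given by levels and parents. -/

section Forest

variable {V : Type*} [DecidableEq V]

/-- The edge between two distinct vertices of the complete graph. -/
def mkEdge {u v : V} (h : u ≠ v) : (⊤ : SimpleGraph V).edgeSet := ⟨s(u, v), h⟩

omit [DecidableEq V] in
lemma mkEdge_eq_iff {u v u' v' : V} (h : u ≠ v) (h' : u' ≠ v') :
    mkEdge h = mkEdge h' ↔ (u = u' ∧ v = v') ∨ (u = v' ∧ v = u') := by
  rw [mkEdge, mkEdge, Subtype.ext_iff, Sym2.eq_iff]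

/-- The weight of the edge between `u` and `v` (zero if `u = v`). -/
def edgeWt (w : (⊤ : SimpleGraph V).edgeSet → ℝ) (u v : V) : ℝ :=
  if h : u ≠ v then w (mkEdge h) else 0

/-- A forest on the vertex set `A` with roots `R` and depth at most `k` covering `T`, given by
levels and parents. -/
structure IsForest (R : Finset V) (k : ℕ) (T A : Finset V) (lev : V → ℕ) (par : V → V) :
    Prop where
  lev_eq_zero : ∀ v ∈ A, (lev v = 0 ↔ v ∈ R)
  root_mem : R ⊆ A
  par_mem : ∀ v ∈ A, v ∉ R → par v ∈ A
  lev_par : ∀ v ∈ A, v ∉ R → lev (par v) + 1 = lev v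
  lev_le : ∀ v ∈ A, lev v ≤ k
  terminal_mem : T ⊆ A

/-- The total weight of the edges from vertices to their parents. -/
def forestCost (w : (⊤ : SimpleGraph V).edgeSet → ℝ) (R A : Finset V) (par : V → V) : ℝ :=
  ∑ v ∈ A \ R, edgeWt w (par v) v

lemma edgeWt_of_ne (w : (⊤ : SimpleGraph V).edgeSet → ℝ) {u v : V} (h : u ≠ v) :
    edgeWt w u v = w (mkEdge h) := dif_pos h

lemma edgeWt_nonneg {w : (⊤ : SimpleGraph V).edgeSet → ℝ} (hw : ∀ e, 0 ≤ w e) (u v : V) :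
    0 ≤ edgeWt w u v := by
  unfold edgeWt
  split_ifs
  · exact hw _
  · exact le_rfl

lemma edgeWt_comm (w : (⊤ : SimpleGraph V).edgeSet → ℝ) (u v : V) :
    edgeWt w u v = edgeWt w v u := by
  by_cases h : u = v
  · rw [h]
  · rw [edgeWt_of_ne w h, edgeWt_of_ne w (Ne.symm h)]
    exact congrArg w (Subtype.ext Sym2.eq_swap)

variable [Fintype (⊤ : SimpleGraph V).edgeSet]

/-- The edges to the parents are distinct if levels decrease, so their total weight is at most
the weight of any subgraph containing them. -/
lemma sum_edgeWt_le_weight {w : (⊤ : SimpleGraph V).edgeSet → ℝ} (hw : ∀ e, 0 ≤ w e)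
    (H : (⊤ : SimpleGraph V).Subgraph) (B : Finset V) {lev : V → ℕ} {par : V → V}
    (h : ∀ v ∈ B, H.Adj (par v) v ∧ lev (par v) + 1 = lev v) :
    ∑ v ∈ B, edgeWt w (par v) v ≤ weight w H := by
  classical
  rw [weight_eq_sum_filter]
  have hne : ∀ v ∈ B, par v ≠ v := fun v hv => (h v hv).1.adj_sub
  calc ∑ v ∈ B, edgeWt w (par v) v
      = ∑ v ∈ B.attach, w (mkEdge (hne v.1 v.2)) := by
        rw [← Finset.sum_attach]
        exact Finset.sum_congr rfl fun v _ => edgeWt_of_ne w (hne v.1 v.2)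
    _ = ∑ e ∈ B.attach.image fun v => mkEdge (hne v.1 v.2), w e := by
        rw [Finset.sum_image]
        rintro ⟨u, hu⟩ _ ⟨v, hv⟩ _ huv
        rw [mkEdge_eq_iff] at huv
        rcases huv with huv | huv
        · exact Subtype.ext huv.2
        -- Two vertices cannot be each other's parents, as each level would exceed the other.
        · have h1 := (h u hu).2
          have h2 := (h v hv).2
          rw [huv.1] at h1
          rw [← huv.2] at h2
          simp only at h1 h2
          omega
    _ ≤ _ := by
        refine Finset.sum_le_sum_of_subset_of_nonneg ?_ fun e _ _ => hw e
        intro e he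
        obtain ⟨v, -, rfl⟩ := Finset.mem_image.1 he
        simp only [Finset.mem_filter, Finset.mem_univ, true_and]
        exact (h v.1 v.2).1

variable [Fintype V] {k : ℕ} {T : Finset V} {H : (⊤ : SimpleGraph V).Subgraph}

/-- The level of a vertex is its distance in H to the nearest root, and its parent is a neighbour
one step closer. -/
lemma exists_forest_of_roots {w : (⊤ : SimpleGraph V).edgeSet → ℝ} (hw : ∀ e, 0 ≤ w e)
    (hH : IsSteinerTree T H) (R : Finset H.verts) (hR : R.Nonempty)
    (hk : ∀ v, ∃ c ∈ R, H.coe.dist c v ≤ k) :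
    ∃ (A : Finset V) (lev : V → ℕ) (par : V → V),
      IsForest (R.map (Function.Embedding.subtype _)) k T A lev par ∧
      forestCost w (R.map (Function.Embedding.subtype _)) A par ≤ weight w H := by
  classical
  obtain ⟨lev, par, h0, hpar, hle⟩ := exists_lev_par hH.isTree.connected R hR
  let lev' : V → ℕ := fun v => if h : v ∈ H.verts then lev ⟨v, h⟩ else 0
  let par' : V → V := fun v => if h : v ∈ H.verts then par ⟨v, h⟩ else v
  have hlev : ∀ v : H.verts, lev' v = lev v := fun v => dif_pos v.2
  have hpar' : ∀ v : H.verts, par' v = par v := fun v => dif_pos v.2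
  have hmem : ∀ v : H.verts, (v : V) ∈ R.map (Function.Embedding.subtype _) ↔ v ∈ R := by
    intro v
    simp
  refine ⟨H.verts.toFinset, lev', par', ⟨?_, ?_, ?_, ?_, ?_, ?_⟩, ?_⟩
  · intro v hv
    lift v to H.verts using by simpa using hv
    rw [hlev, hmem, h0]
  · intro v hv
    obtain ⟨u, -, rfl⟩ := Finset.mem_map.1 hv
    simp
  · intro v hv _
    lift v to H.verts using by simpa using hv
    rw [hpar']
    simp
  · intro v hv hvR
    lift v to H.verts using by simpa using hv
    rw [hmem, ← h0] at hvR
    rw [hpar', hlev, hlev]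
    exact (hpar v hvR).2
  · intro v hv
    lift v to H.verts using by simpa using hv
    obtain ⟨c, hc, hcv⟩ := hk v
    rw [hlev]
    exact (hle v c hc).trans hcv
  · intro v hv
    simpa using hH.terminal_mem v hv
  · refine sum_edgeWt_le_weight hw H _ (lev := lev') fun v hv => ?_
    rw [Finset.mem_sdiff] at hv
    obtain ⟨hv, hvR⟩ := hv
    lift v to H.verts using by simpa using hv
    rw [hmem, ← h0] at hvR
    rw [hpar', hlev, hlev]
    exact ⟨(hpar v hvR).1, (hpar v hvR).2⟩

/-- A Steiner tree of diameter at most `2k` is a forest of depth at most `k` from one root. -/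
theorem exists_forest_of_hasDiamLE_even {w : (⊤ : SimpleGraph V).edgeSet → ℝ}
    (hw : ∀ e, 0 ≤ w e) (hH : IsSteinerTree T H) (hd : HasDiamLE (2 * k) H) :
    ∃ (R A : Finset V) (lev : V → ℕ) (par : V → V), R.card ≤ 1 ∧ IsForest R k T A lev par ∧
      forestCost w R A par ≤ weight w H := by
  classical
  obtain ⟨c, hc⟩ := exists_root_of_dist_le_even hH.isTree (dist_le_of_hasDiamLE hH.isTree hd)
  obtain ⟨A, lev, par, h1, h2⟩ := exists_forest_of_roots hw hH {c} (by simp)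
    (k := k) fun v => ⟨c, by simp, hc v⟩
  exact ⟨_, A, lev, par, by simp, h1, h2⟩

/-- A Steiner tree of diameter at most `2k + 1` is a forest of depth at most `k` from at most
two roots, and possibly one more edge. -/
theorem exists_forest_of_hasDiamLE_odd {w : (⊤ : SimpleGraph V).edgeSet → ℝ}
    (hw : ∀ e, 0 ≤ w e) (hH : IsSteinerTree T H) (hd : HasDiamLE (2 * k + 1) H) :
    ∃ (R A : Finset V) (lev : V → ℕ) (par : V → V), R.card ≤ 2 ∧ IsForest R k T A lev par ∧
      forestCost w R A par ≤ weight w H := by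
  classical
  obtain ⟨c, c', hc⟩ := exists_roots_of_dist_le_odd hH.isTree
    (dist_le_of_hasDiamLE hH.isTree hd)
  obtain ⟨A, lev, par, h1, h2⟩ := exists_forest_of_roots hw hH {c, c'} (by simp)
    (k := k) fun v => by
      rcases hc v with h | h
      · exact ⟨c, by simp, h⟩
      · exact ⟨c', by simp, h⟩
  exact ⟨_, A, lev, par, by simpa using Finset.card_le_two, h1, h2⟩

/-- A parent function which decreases some rank defines a tree. -/
lemma exists_tree_of_parents {w : (⊤ : SimpleGraph V).edgeSet → ℝ} (hw : ∀ e, 0 ≤ w e)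
    {A : Finset V} {r : V} (hr : r ∈ A) {rk : V → ℕ} {par : V → V}
    (h : ∀ v ∈ A, v ≠ r → par v ∈ A ∧ rk (par v) < rk v) :
    ∃ H : (⊤ : SimpleGraph V).Subgraph, H.verts = A ∧ H.coe.IsTree ∧
      (∀ v ∈ A, v ≠ r → H.Adj (par v) v) ∧
      weight w H ≤ ∑ v ∈ A.erase r, edgeWt w (par v) v := by
  classical
  have hne : ∀ v ∈ A, v ≠ r → par v ≠ v := by
    intro v hv hvr he
    have := (h v hv hvr).2
    rw [he] at this
    exact lt_irrefl _ this
  let H : (⊤ : SimpleGraph V).Subgraph :=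
    { verts := A
      Adj := fun u v => (v ∈ A ∧ v ≠ r ∧ par v = u) ∨ (u ∈ A ∧ u ≠ r ∧ par u = v)
      adj_sub := by
        rintro u v (⟨hv, hvr, rfl⟩ | ⟨hu, hur, rfl⟩)
        · exact hne v hv hvr
        · exact (hne u hu hur).symm
      edge_vert := by
        rintro u v (⟨hv, hvr, rfl⟩ | ⟨hu, hur, rfl⟩)
        · exact (h v hv hvr).1
        · exact hu
      symm := ⟨fun u v huv => huv.symm⟩ }
  have hadj : ∀ v ∈ A, v ≠ r → H.Adj (par v) v := fun v hv hvr => Or.inl ⟨hv, hvr, rfl⟩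
  have hverts : ∀ v : H.verts, (v : V) ∈ A := fun v => v.2
  have hreach : ∀ (d : ℕ) (v : H.verts), rk v = d → H.coe.Reachable v ⟨r, hr⟩ := by
    intro d
    induction d using Nat.strong_induction_on with
    | _ d ih =>
      intro v hv
      by_cases hvr : (v : V) = r
      · have : v = ⟨r, hr⟩ := Subtype.ext hvr
        rw [this]
      · have hp := h v (hverts v) hvr
        have h1 := ih (rk (par v)) (hv ▸ hp.2) ⟨par v, hp.1⟩ rfl
        have h2 : H.coe.Adj ⟨par v, hp.1⟩ v := hadj v (hverts v) hvr
        exact h2.symm.reachable.trans h1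
  have hconn : H.coe.Connected :=
    { preconnected := fun u v => (hreach _ u rfl).trans (hreach _ v rfl).symm
      nonempty := ⟨⟨r, hr⟩⟩ }
  refine ⟨H, rfl, ?_, hadj, ?_⟩
  -- Every edge joins a vertex other than r to its parent, so there are at most |A| - 1 edges; a
  -- connected graph with so few edges is a tree.
  · rw [SimpleGraph.isTree_iff_connected_and_card]
    refine ⟨hconn, le_antisymm ?_ hconn.card_vert_le_card_edgeSet_add_one⟩
    have hcard : Nat.card H.verts = A.card := by
      rw [Nat.card_eq_fintype_card]
      exact Fintype.card_of_subtype A fun x => Iff.rfl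
    have hpos : 0 < A.card := Finset.card_pos.2 ⟨r, hr⟩
    suffices Nat.card H.coe.edgeSet ≤ (A.erase r).card by
      rw [Finset.card_erase_of_mem hr] at this
      omega
    let f : A.erase r → H.coe.edgeSet := fun v =>
      ⟨s(⟨par v, (h v (Finset.mem_of_mem_erase v.2) (Finset.ne_of_mem_erase v.2)).1⟩,
        ⟨v, Finset.mem_of_mem_erase v.2⟩),
        hadj v (Finset.mem_of_mem_erase v.2) (Finset.ne_of_mem_erase v.2)⟩
    have hf : Function.Surjective f := by
      rintro ⟨e, he⟩
      induction e using Sym2.ind with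
      | _ x y =>
        rcases he with ⟨hy, hyr, hxy⟩ | ⟨hx, hxr, hxy⟩
        · exact ⟨⟨y, Finset.mem_erase.2 ⟨hyr, hy⟩⟩, by simp [f, hxy]⟩
        · refine ⟨⟨x, Finset.mem_erase.2 ⟨hxr, hx⟩⟩, ?_⟩
          refine Subtype.ext ?_
          simp only [f, hxy]
          exact Sym2.eq_swap
    have := Nat.card_le_card_of_surjective f hf
    rwa [Nat.card_eq_fintype_card (α := A.erase r), Fintype.card_coe] at this
  · rw [weight_eq_sum_filter]
    have himg : (Finset.univ.filter fun e : (⊤ : SimpleGraph V).edgeSet =>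
        (e : Sym2 V) ∈ H.edgeSet) ⊆ (A.erase r).attach.image fun v =>
          mkEdge (hne v.1 (Finset.mem_of_mem_erase v.2) (Finset.ne_of_mem_erase v.2)) := by
      rintro ⟨e, he'⟩ he
      simp only [Finset.mem_filter, Finset.mem_univ, true_and] at he
      induction e using Sym2.ind with
      | _ x y =>
        rcases he with ⟨hy, hyr, hxy⟩ | ⟨hx, hxr, hxy⟩
        · refine Finset.mem_image.2 ⟨⟨y, Finset.mem_erase.2 ⟨hyr, hy⟩⟩, Finset.mem_attach _ _, ?_⟩
          simp [mkEdge, hxy]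
        · refine Finset.mem_image.2 ⟨⟨x, Finset.mem_erase.2 ⟨hxr, hx⟩⟩, Finset.mem_attach _ _, ?_⟩
          simp only [mkEdge, hxy, Subtype.mk.injEq]
          exact Sym2.eq_swap
    refine (Finset.sum_le_sum_of_subset_of_nonneg himg fun e _ _ => hw e).trans ?_
    refine (Finset.sum_image_le_of_nonneg ?_).trans (le_of_eq ?_)
    · exact fun _ _ => hw _
    · rw [← Finset.sum_attach (A.erase r)]
      refine Finset.sum_congr rfl fun v _ => ?_
      rw [edgeWt_of_ne]

end Forest

/-! ### Minimum weights: measurability and comparison with forest costs. -/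

section MinWeight

variable {V : Type*} [Fintype V] [Fintype (⊤ : SimpleGraph V).edgeSet]

lemma measurable_weight (H : (⊤ : SimpleGraph V).Subgraph) :
    Measurable fun w : (⊤ : SimpleGraph V).edgeSet → ℝ => weight w H := by
  unfold weight
  refine Finset.measurable_sum _ fun e _ => ?_
  unfold Set.indicator
  split_ifs
  · exact measurable_pi_apply e
  · exact measurable_const

lemma measurable_sInf_weight (S : Set (⊤ : SimpleGraph V).Subgraph) :
    Measurable fun w : (⊤ : SimpleGraph V).edgeSet → ℝ => sInf (weight w '' S) := by
  have : Finite (⊤ : SimpleGraph V).Subgraph := inferInstance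
  simp_rw [sInf_image']
  exact Measurable.iInf fun H => measurable_weight _

lemma abs_sInf_weight_le (w : (⊤ : SimpleGraph V).edgeSet → ℝ)
    (S : Set (⊤ : SimpleGraph V).Subgraph) : |sInf (weight w '' S)| ≤ ∑ e, |w e| := by
  have : Finite (⊤ : SimpleGraph V).Subgraph := inferInstance
  rcases S.eq_empty_or_nonempty with rfl | hS
  · simpa using Finset.sum_nonneg fun e _ => abs_nonneg (w e)
  · obtain ⟨H, -, h⟩ := (hS.image (weight w)).csInf_mem (S.toFinite.image (weight w))
    rw [← h]
    exact abs_weight_le w H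

lemma sInf_weight_nonneg {w : (⊤ : SimpleGraph V).edgeSet → ℝ} (hw : ∀ e, 0 ≤ w e)
    (S : Set (⊤ : SimpleGraph V).Subgraph) : 0 ≤ sInf (weight w '' S) := by
  refine Real.sInf_nonneg ?_
  rintro _ ⟨H, -, rfl⟩
  exact weight_nonneg hw H

lemma sInf_weight_le {w : (⊤ : SimpleGraph V).edgeSet → ℝ} (hw : ∀ e, 0 ≤ w e)
    {S : Set (⊤ : SimpleGraph V).Subgraph} {H : (⊤ : SimpleGraph V).Subgraph} (hH : H ∈ S) :
    sInf (weight w '' S) ≤ weight w H := by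
  refine csInf_le ⟨0, ?_⟩ ⟨H, hH, rfl⟩
  rintro _ ⟨H, -, rfl⟩
  exact weight_nonneg hw H

variable [DecidableEq V] {w : (⊤ : SimpleGraph V).edgeSet → ℝ} {T A : Finset V} {k : ℕ}
  {lev : V → ℕ} {par : V → V}

lemma exists_edist_le_lev {R : Finset V} (hF : IsForest R k T A lev par)
    {H : (⊤ : SimpleGraph V).Subgraph} (hA : H.verts = A)
    (hadj : ∀ v ∈ A, v ∉ R → H.Adj (par v) v) (v : H.verts) :
    ∃ c : H.verts, (c : V) ∈ R ∧ H.coe.edist c v ≤ (lev v : ℕ∞) := by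
  have hmem : ∀ x, x ∈ H.verts ↔ x ∈ A := fun x => by rw [hA, Finset.mem_coe]
  have hverts : ∀ v : H.verts, (v : V) ∈ A := fun v => (hmem _).1 v.2
  suffices ∀ (d : ℕ) (v : H.verts), lev v = d →
      ∃ c : H.verts, (c : V) ∈ R ∧ H.coe.edist c v ≤ (d : ℕ∞) from this _ v rfl
  intro d
  induction d with
  | zero =>
    intro v hv
    exact ⟨v, (hF.lev_eq_zero _ (hverts v)).1 hv, by simp⟩
  | succ d ih =>
    intro v hv
    have hvR : (v : V) ∉ R := fun h => by
      have := (hF.lev_eq_zero _ (hverts v)).2 h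
      omega
    have h1 := hF.lev_par _ (hverts v) hvR
    have hp : par v ∈ H.verts := (hmem _).2 (hF.par_mem _ (hverts v) hvR)
    obtain ⟨c, hc, hd⟩ := ih ⟨par v, hp⟩ (by simp only; omega)
    refine ⟨c, hc, (SimpleGraph.edist_triangle (v := ⟨par v, hp⟩)).trans ?_⟩
    have h2 : H.coe.Adj ⟨par v, hp⟩ v := hadj _ (hverts v) hvR
    push_cast
    exact add_le_add hd (SimpleGraph.edist_eq_one_iff_adj.2 h2).le

lemma exists_steinerTree_of_forest (hw : ∀ e, 0 ≤ w e) {r : V}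
    (hF : IsForest {r} k T A lev par) :
    ∃ H : (⊤ : SimpleGraph V).Subgraph, IsSteinerTree T H ∧ HasDepthLE r k H ∧
      weight w H ≤ forestCost w {r} A par := by
  have hr : r ∈ A := hF.root_mem (Finset.mem_singleton_self r)
  have hR : ∀ v, v ≠ r → v ∉ ({r} : Finset V) := fun v hv => by simpa using hv
  obtain ⟨H, hA, htree, hadj, hwt⟩ := exists_tree_of_parents hw hr (rk := lev) (par := par)
    fun v hv hvr => ⟨hF.par_mem v hv (hR v hvr), by have := hF.lev_par v hv (hR v hvr); omega⟩
  have hmem : ∀ x, x ∈ H.verts ↔ x ∈ A := fun x => by rw [hA, Finset.mem_coe]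
  refine ⟨H, ⟨htree, fun v hv => (hmem v).2 (hF.terminal_mem hv)⟩, ⟨(hmem r).2 hr, ?_⟩,
    hwt.trans ?_⟩
  · rw [SimpleGraph.eccent_le_iff]
    intro v
    obtain ⟨c, hc, hd⟩ := exists_edist_le_lev hF hA
      (fun v hv hvr => hadj v hv (by simpa using hvr)) v
    have : c = ⟨r, (hmem r).2 hr⟩ := Subtype.ext (by simpa using hc)
    rw [← this]
    refine hd.trans ?_
    exact_mod_cast hF.lev_le _ ((hmem _).1 v.2)
  · rw [forestCost, Finset.sdiff_singleton_eq_erase]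

theorem minDepthWeight_le_forestCost (hw : ∀ e, 0 ≤ w e) {r : V}
    (hF : IsForest {r} k T A lev par) :
    minDepthWeight w T r k ≤ forestCost w {r} A par := by
  obtain ⟨H, h1, h2, h3⟩ := exists_steinerTree_of_forest hw hF
  exact (sInf_weight_le hw (S := {H | IsSteinerTree T H ∧ HasDepthLE r k H}) ⟨h1, h2⟩).trans h3

/-- An edge between the two roots turns the forest into a tree in which any two vertices are within
k + 1 + k of each other. -/
theorem minDiamWeight_le_forestCost_add (hw : ∀ e, 0 ≤ w e) {r₁ r₂ : V} (hne : r₁ ≠ r₂)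
    (hF : IsForest {r₁, r₂} k T A lev par) :
    minDiamWeight w T (2 * k + 1) ≤ forestCost w {r₁, r₂} A par + edgeWt w r₁ r₂ := by
  have hr₁ : r₁ ∈ A := hF.root_mem (by simp)
  have hr₂ : r₂ ∈ A := hF.root_mem (by simp)
  have hR : ∀ v, v ≠ r₁ → v ≠ r₂ → v ∉ ({r₁, r₂} : Finset V) := fun v h1 h2 => by simp [h1, h2]
  let par' : V → V := fun v => if v = r₂ then r₁ else par v
  -- All levels except that of r₁ are shifted by one, so that r₂ may have r₁ as its parent.
  let rk : V → ℕ := fun v => if v = r₁ then 0 else lev v + 1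
  obtain ⟨H, hA, htree, hadj, hwt⟩ := exists_tree_of_parents hw hr₁ (rk := rk) (par := par') (by
    intro v hv hvr
    by_cases hv2 : v = r₂
    · simp [par', rk, hv2, hr₁, hne.symm]
    · have h1 := hF.par_mem v hv (hR v hvr hv2)
      have h2 := hF.lev_par v hv (hR v hvr hv2)
      simp only [par', rk, hv2, hvr, if_false, h1, true_and]
      split_ifs <;> omega)
  have hmem : ∀ x, x ∈ H.verts ↔ x ∈ A := fun x => by rw [hA, Finset.mem_coe]
  have hsteiner : IsSteinerTree T H := ⟨htree, fun v hv => (hmem v).2 (hF.terminal_mem hv)⟩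
  have hadjF : ∀ v ∈ A, v ∉ ({r₁, r₂} : Finset V) → H.Adj (par v) v := by
    intro v hv hvR
    simp only [Finset.mem_insert, Finset.mem_singleton, not_or] at hvR
    have := hadj v hv hvR.1
    simpa [par', hvR.2] using this
  have hroots : ∀ c c' : H.verts, (c : V) ∈ ({r₁, r₂} : Finset V) →
      (c' : V) ∈ ({r₁, r₂} : Finset V) → H.coe.edist c c' ≤ 1 := by
    intro c c' hc hc'
    have h12 : H.Adj r₁ r₂ := by simpa [par'] using hadj r₂ hr₂ hne.symm
    rw [SimpleGraph.edist_le_one_iff_adj_or_eq]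
    simp only [Finset.mem_insert, Finset.mem_singleton] at hc hc'
    have e1 : H.coe.Adj c c' ↔ H.Adj c c' := Iff.rfl
    rw [e1, Subtype.ext_iff]
    rcases hc with hc | hc <;> rcases hc' with hc' | hc' <;> rw [hc, hc']
    · exact Or.inr rfl
    · exact Or.inl h12
    · exact Or.inl h12.symm
    · exact Or.inr rfl
  have hlev : ∀ v : H.verts, (lev v : ℕ∞) ≤ k := fun v => by
    exact_mod_cast hF.lev_le _ ((hmem _).1 v.2)
  have hdiam : HasDiamLE (2 * k + 1) H := by
    refine SimpleGraph.ediam_le_of_edist_le fun u v => ?_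
    obtain ⟨c, hc, hcu⟩ := exists_edist_le_lev hF hA hadjF u
    obtain ⟨c', hc', hcv⟩ := exists_edist_le_lev hF hA hadjF v
    calc H.coe.edist u v ≤ H.coe.edist u c + H.coe.edist c v := SimpleGraph.edist_triangle
      _ ≤ H.coe.edist u c + (H.coe.edist c c' + H.coe.edist c' v) := by
        gcongr
        exact SimpleGraph.edist_triangle
      _ ≤ k + (1 + k) := by
        rw [SimpleGraph.edist_comm (u := u)]
        exact add_le_add (hcu.trans (hlev u))
          (add_le_add (hroots c c' hc hc') (hcv.trans (hlev v)))
      _ = ((2 * k + 1 : ℕ) : ℕ∞) := by push_cast; ring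
  refine (sInf_weight_le hw
    (S := {H | IsSteinerTree T H ∧ HasDiamLE (2 * k + 1) H}) ⟨hsteiner, hdiam⟩).trans (hwt.trans (le_of_eq ?_))
  have e : A \ {r₁, r₂} = (A.erase r₁).erase r₂ := by
    ext v
    simp only [Finset.mem_sdiff, Finset.mem_insert, Finset.mem_singleton, Finset.mem_erase]
    tauto
  rw [forestCost, e, ← Finset.sum_erase_add (A.erase r₁) _
    (Finset.mem_erase.2 ⟨hne.symm, hr₂⟩)]
  congr 1
  · refine Finset.sum_congr rfl fun v hv => ?_
    simp [par', Finset.ne_of_mem_erase hv]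
  · simp [par']

/-- Used with a single root to show that admissible trees exist, so that `sInf` is a true minimum
and not the default value 0 of the empty set. -/
lemma isForest_star (hk : 1 ≤ k) (R : Finset V) {r : V} (hr : r ∈ R) (T : Finset V) :
    IsForest R k T Finset.univ (fun v => if v ∈ R then 0 else 1) (fun _ => r) where
  lev_eq_zero v _ := by simp
  root_mem := Finset.subset_univ _
  par_mem _ _ _ := Finset.mem_univ _
  lev_par v _ hv := by simp [hv, hr]
  lev_le v _ := by split_ifs <;> omega
  terminal_mem := Finset.subset_univ _

lemma HasDepthLE.hasDiamLE {r : V} {H : (⊤ : SimpleGraph V).Subgraph} (h : HasDepthLE r k H) :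
    HasDiamLE (2 * k) H := by
  obtain ⟨hr, h⟩ := h
  refine (SimpleGraph.ediam_le_two_mul_eccent ⟨r, hr⟩).trans ?_
  push_cast
  gcongr

lemma exists_steinerTree (hk : 1 ≤ k) (r : V) (T : Finset V) :
    ∃ H : (⊤ : SimpleGraph V).Subgraph, IsSteinerTree T H ∧ HasDepthLE r k H := by
  obtain ⟨H, h1, h2, -⟩ := exists_steinerTree_of_forest
    (w := fun _ : (⊤ : SimpleGraph V).edgeSet => (0 : ℝ)) (fun _ => le_rfl)
    (isForest_star hk {r} (Finset.mem_singleton_self r) T)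
  exact ⟨H, h1, h2⟩

theorem minDiamWeight_le_minDepthWeight (hw : ∀ e, 0 ≤ w e) (hk : 1 ≤ k) (r : V) :
    minDiamWeight w T (2 * k) ≤ minDepthWeight w T r k := by
  obtain ⟨H, hH⟩ := exists_steinerTree hk r T
  refine le_csInf ⟨_, H, hH, rfl⟩ ?_
  rintro _ ⟨H', hH', rfl⟩
  exact sInf_weight_le hw (S := {H | IsSteinerTree T H ∧ HasDiamLE (2 * k) H})
    ⟨hH'.1, hH'.2.hasDiamLE⟩

theorem le_minDiamWeight_even (hw : ∀ e, 0 ≤ w e) (hk : 1 ≤ k) (r : V) {c : ℝ}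
    (h : ∀ R A lev par, R.card ≤ 1 → IsForest R k T A lev par → c ≤ forestCost w R A par) :
    c ≤ minDiamWeight w T (2 * k) := by
  obtain ⟨H, hH⟩ := exists_steinerTree hk r T
  refine le_csInf ⟨_, H, ⟨hH.1, hH.2.hasDiamLE⟩, rfl⟩ ?_
  rintro _ ⟨H', hH', rfl⟩
  obtain ⟨R, A, lev, par, hR, hF, hc⟩ := exists_forest_of_hasDiamLE_even hw hH'.1 hH'.2
  exact (h R A lev par hR hF).trans hc

theorem le_minDiamWeight_odd (hw : ∀ e, 0 ≤ w e) (hk : 1 ≤ k) (r : V) {c : ℝ}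
    (h : ∀ R A lev par, R.card ≤ 2 → IsForest R k T A lev par → c ≤ forestCost w R A par) :
    c ≤ minDiamWeight w T (2 * k + 1) := by
  obtain ⟨H, hH⟩ := exists_steinerTree hk r T
  have hd : HasDiamLE (2 * k + 1) H :=
    le_trans (α := ℕ∞) hH.2.hasDiamLE (by exact_mod_cast Nat.le_succ _)
  refine le_csInf ⟨_, H, ⟨hH.1, hd⟩, rfl⟩ ?_
  rintro _ ⟨H', hH', rfl⟩
  obtain ⟨R, A, lev, par, hR, hF, hc⟩ := exists_forest_of_hasDiamLE_odd hw hH'.1 hH'.2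
  exact (h R A lev par hR hF).trans hc

end MinWeight

/-! ### Edge sets around vertex sets, and the dual lower bound for forests. -/

section EdgeSets

variable {V : Type*} [Fintype V] [DecidableEq V] [Fintype (⊤ : SimpleGraph V).edgeSet]

/-- The edges with an endpoint in `S`. -/
noncomputable def touch (S : Finset V) : Finset (⊤ : SimpleGraph V).edgeSet :=
  open Classical in Finset.univ.filter fun e => ∃ u ∈ S, u ∈ (e : Sym2 V)

/-- The edges between `v` and `S`. -/
noncomputable def edgesTo (S : Finset V) (v : V) : Finset (⊤ : SimpleGraph V).edgeSet :=
  open Classical in Finset.univ.filter fun e => v ∈ (e : Sym2 V) ∧ ∃ u ∈ S, u ∈ (e : Sym2 V)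

lemma mem_touch {S : Finset V} {e : (⊤ : SimpleGraph V).edgeSet} :
    e ∈ touch S ↔ ∃ u ∈ S, u ∈ (e : Sym2 V) := by
  simp [touch]

lemma mem_edgesTo {S : Finset V} {v : V} {e : (⊤ : SimpleGraph V).edgeSet} :
    e ∈ edgesTo S v ↔ v ∈ (e : Sym2 V) ∧ ∃ u ∈ S, u ∈ (e : Sym2 V) := by
  simp [edgesTo]

lemma mkEdge_mem_touch {S : Finset V} {u v : V} (h : u ≠ v) (hu : u ∈ S) :
    mkEdge h ∈ touch S :=
  mem_touch.2 ⟨u, hu, Sym2.mem_mk_left _ _⟩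

lemma mkEdge_mem_edgesTo {S : Finset V} {u v : V} (h : u ≠ v) (hu : u ∈ S) :
    mkEdge h ∈ edgesTo S v :=
  mem_edgesTo.2 ⟨Sym2.mem_mk_right _ _, u, hu, Sym2.mem_mk_left _ _⟩

lemma exists_of_mem_edgesTo {S : Finset V} {v : V} (hv : v ∉ S)
    {e : (⊤ : SimpleGraph V).edgeSet} (he : e ∈ edgesTo S v) :
    ∃ (u : V) (h : u ≠ v), u ∈ S ∧ e = mkEdge h := by
  obtain ⟨hve, u, hu, hue⟩ := mem_edgesTo.1 he
  have huv : u ≠ v := fun h => hv (h ▸ hu)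
  exact ⟨u, huv, hu, Subtype.ext ((Sym2.mem_and_mem_iff huv).1 ⟨hue, hve⟩)⟩

lemma edgesTo_mono {S S' : Finset V} (h : S ⊆ S') (v : V) : edgesTo S v ⊆ edgesTo S' v := by
  intro e he
  obtain ⟨h1, u, hu, hue⟩ := mem_edgesTo.1 he
  exact mem_edgesTo.2 ⟨h1, u, h hu, hue⟩

lemma touch_mono {S S' : Finset V} (h : S ⊆ S') : touch S ⊆ touch S' := by
  intro e he
  obtain ⟨u, hu, hue⟩ := mem_touch.1 he
  exact mem_touch.2 ⟨u, h hu, hue⟩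

lemma touch_union (S S' : Finset V) : touch (S ∪ S') = touch S ∪ touch S' := by
  ext e
  simp only [mem_touch, Finset.mem_union]
  grind

lemma touch_empty : touch (∅ : Finset V) = ∅ := by
  ext e
  simp [mem_touch]

lemma card_edgesTo {S : Finset V} {v : V} (hv : v ∉ S) : (edgesTo S v).card = S.card := by
  have hne : ∀ u ∈ S, u ≠ v := fun u hu h => hv (h ▸ hu)
  have : edgesTo S v = S.attach.image fun u => mkEdge (hne u.1 u.2) := by
    ext e
    constructor
    · intro he
      obtain ⟨u, h, hu, rfl⟩ := exists_of_mem_edgesTo hv he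
      exact Finset.mem_image.2 ⟨⟨u, hu⟩, Finset.mem_attach _ _, rfl⟩
    · intro he
      obtain ⟨u, -, rfl⟩ := Finset.mem_image.1 he
      exact mkEdge_mem_edgesTo _ u.2
  rw [this, Finset.card_image_of_injective, Finset.card_attach]
  intro u u' h
  rcases (mkEdge_eq_iff _ _).1 h with h | h
  · exact Subtype.ext h.1
  · exact absurd h.1 (hne u.1 u.2)

lemma card_touch_le (S : Finset V) : (touch S).card ≤ S.card * Fintype.card V := by
  induction S using Finset.induction_on with
  | empty => simp [touch_empty]
  | insert u S hu ih =>
    have h1 : touch {u} ⊆ edgesTo (Finset.univ.erase u) u := by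
      intro e he
      obtain ⟨u', hu', hue⟩ := mem_touch.1 he
      rw [Finset.mem_singleton] at hu'
      subst hu'
      obtain ⟨⟨x, y⟩, hxy⟩ := e
      have hne : x ≠ y := hxy
      rcases Sym2.mem_iff.1 hue with rfl | rfl
      · exact mem_edgesTo.2 ⟨hue, y, by simp [hne.symm], Sym2.mem_mk_right _ _⟩
      · exact mem_edgesTo.2 ⟨hue, x, by simp [hne], Sym2.mem_mk_left _ _⟩
    have h2 : (touch {u}).card ≤ Fintype.card V := by
      refine (Finset.card_le_card h1).trans ?_
      rw [card_edgesTo (by simp)]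
      exact Finset.card_le_univ _
    rw [Finset.insert_eq, touch_union]
    refine (Finset.card_union_le _ _).trans ?_
    rw [← Finset.insert_eq, Finset.card_insert_of_notMem hu]
    linarith

lemma disjoint_edgesTo {S : Finset V} {v v' : V} (hv : v ∉ S) (hv' : v' ∉ S) (h : v ≠ v') :
    Disjoint (edgesTo S v : Set (⊤ : SimpleGraph V).edgeSet) (edgesTo S v') := by
  rw [Finset.disjoint_coe, Finset.disjoint_left]
  intro e he he'
  obtain ⟨u, hu, huS, rfl⟩ := exists_of_mem_edgesTo hv he
  obtain ⟨u', hu', huS', heq⟩ := exists_of_mem_edgesTo hv' he'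
  rcases (mkEdge_eq_iff _ _).1 heq with h1 | h1
  · exact h h1.2
  · exact hv' (h1.1 ▸ huS)

/-- Subadditivity: a bound for sets of one size gives a bound for all sets. -/
lemma sum_touch_le_of_card {f : (⊤ : SimpleGraph V).edgeSet → ℝ} (hf : ∀ e, 0 ≤ f e) {a : ℕ}
    (ha : 1 ≤ a) (haV : a ≤ Fintype.card V) {B : ℝ}
    (h : ∀ S : Finset V, S.card = a → ∑ e ∈ touch S, f e ≤ B) (S : Finset V) :
    a * ∑ e ∈ touch S, f e ≤ B * (S.card + (a - 1)) := by
  have ha' : (1 : ℝ) ≤ a := by exact_mod_cast ha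
  have hB : 0 ≤ B := by
    obtain ⟨S, -, hS⟩ := Finset.exists_subset_card_eq (s := (Finset.univ : Finset V)) haV
    exact (Finset.sum_nonneg fun e _ => hf e).trans (h S hS)
  induction hN : S.card using Nat.strong_induction_on generalizing S with
  | _ N ih =>
    subst hN
    by_cases h0 : S = ∅
    · subst h0
      rw [touch_empty]
      simp only [Finset.sum_empty, mul_zero, Finset.card_empty, Nat.cast_zero, zero_add]
      exact mul_nonneg hB (by linarith)
    have hc1 : 1 ≤ S.card := Finset.card_pos.2 (Finset.nonempty_iff_ne_empty.2 h0)
    have hc1' : (1 : ℝ) ≤ S.card := by exact_mod_cast hc1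
    rcases le_total S.card a with hle | hle
    · obtain ⟨S', hSS', hS'⟩ := Finset.exists_superset_card_eq hle haV
      have h1 : ∑ e ∈ touch S, f e ≤ B :=
        (Finset.sum_le_sum_of_subset_of_nonneg (touch_mono hSS') fun e _ _ => hf e).trans
          (h S' hS')
      nlinarith
    -- Blocks of a vertices are split off one by one; their number is at most (|S| + a - 1)/a, which
    -- explains the term a - 1.
    · obtain ⟨S', hSS', hS'⟩ := Finset.exists_subset_card_eq hle
      have h1 := h S' hS'
      have hcard : (S \ S').card = S.card - a := by
        rw [Finset.card_sdiff_of_subset hSS', hS']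
      have h2 := ih (S \ S').card (by omega) (S \ S') rfl
      have h3 : ∑ e ∈ touch S, f e ≤ ∑ e ∈ touch S', f e + ∑ e ∈ touch (S \ S'), f e := by
        have : touch S = touch S' ∪ touch (S \ S') := by
          rw [← touch_union, Finset.union_sdiff_of_subset hSS']
        rw [this]
        have h4 := Finset.sum_union_inter (s₁ := touch S') (s₂ := touch (S \ S')) (f := f)
        have h5 : 0 ≤ ∑ e ∈ touch S' ∩ touch (S \ S'), f e :=
          Finset.sum_nonneg fun e _ => hf e
        linarith
      have h6 : ((S \ S').card : ℝ) = S.card - a := by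
        rw [hcard, Nat.cast_sub hle]
      rw [h6] at h2
      nlinarith

/-- The cost of attaching the terminals outside `S` to `S`, each truncated at `τ`. -/
noncomputable def attachCost (w : (⊤ : SimpleGraph V).edgeSet → ℝ) (T S : Finset V) (τ : ℝ) : ℝ :=
  ∑ v ∈ T \ S, truncMin (edgesTo S v) τ w

lemma attachCost_anti (w : (⊤ : SimpleGraph V).edgeSet → ℝ) (T : Finset V) {S S' : Finset V}
    (h : S ⊆ S') {τ : ℝ} (hτ : 0 ≤ τ) : attachCost w T S' τ ≤ attachCost w T S τ := by
  unfold attachCost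
  calc _ ≤ ∑ v ∈ T \ S', truncMin (edgesTo S v) τ w :=
        Finset.sum_le_sum fun v _ => truncMin_anti (edgesTo_mono h v) w
    _ ≤ _ := Finset.sum_le_sum_of_subset_of_nonneg (Finset.sdiff_subset_sdiff le_rfl h)
        fun v _ _ => (truncMin_mem _ hτ w).1

variable {w : (⊤ : SimpleGraph V).edgeSet → ℝ} {R T A : Finset V} {k : ℕ}
  {lev : V → ℕ} {par : V → V}

lemma IsForest.par_ne (hF : IsForest R k T A lev par) {v : V} (hv : v ∈ A) (hvR : v ∉ R) :
    par v ≠ v := by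
  intro h
  have := hF.lev_par v hv hvR
  rw [h] at this
  omega

/-- The cost of one level of a forest. -/
lemma le_sum_level (hw : ∀ e, 0 ≤ w e) (hF : IsForest R k T A lev par) {t : ℝ} (ht : 0 < t)
    (i : ℕ) :
    t * (A.filter (lev · = i + 1)).card -
      t * ∑ e ∈ touch (A.filter (lev · = i)), gap t (w e) ≤
      ∑ v ∈ A.filter (lev · = i + 1), edgeWt w (par v) v := by
  have hmem : ∀ v ∈ A.filter (lev · = i + 1), v ∈ A ∧ v ∉ R ∧ lev v = i + 1 := by
    intro v hv
    obtain ⟨hv, hl⟩ := Finset.mem_filter.1 hv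
    refine ⟨hv, fun h => ?_, hl⟩
    have := (hF.lev_eq_zero v hv).2 h
    omega
  have hne : ∀ v ∈ A.filter (lev · = i + 1), par v ≠ v := fun v hv =>
    hF.par_ne (hmem v hv).1 (hmem v hv).2.1
  -- Each parent edge costs at least t minus its gain t · `gap`. The parent edges are distinct and
  -- touch level i, so their gains sum to at most the gain of all edges there.
  have h1 : ∑ v ∈ (A.filter (lev · = i + 1)).attach, gap t (w (mkEdge (hne v.1 v.2))) ≤
      ∑ e ∈ touch (A.filter (lev · = i)), gap t (w e) := by
    rw [← Finset.sum_image (f := fun e => gap t (w e))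
      (g := fun v : {x // x ∈ A.filter (lev · = i + 1)} => mkEdge (hne v.1 v.2))]
    · refine Finset.sum_le_sum_of_subset_of_nonneg ?_ fun e _ _ => (gap_mem t _).1
      intro e he
      obtain ⟨v, -, rfl⟩ := Finset.mem_image.1 he
      obtain ⟨h1, h2, h3⟩ := hmem v.1 v.2
      have h4 := hF.lev_par _ h1 h2
      exact mkEdge_mem_touch _ (Finset.mem_filter.2 ⟨hF.par_mem _ h1 h2, by omega⟩)
    · intro u _ v _ huv
      rcases (mkEdge_eq_iff _ _).1 huv with h | h
      · exact Subtype.ext h.2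
      · have h1 := hmem u.1 u.2
        have h2 := hmem v.1 v.2
        have h3 := hF.lev_par _ h1.1 h1.2.1
        rw [h.1] at h3
        omega
  have h2 : ∑ v ∈ A.filter (lev · = i + 1), edgeWt w (par v) v =
      ∑ v ∈ (A.filter (lev · = i + 1)).attach, w (mkEdge (hne v.1 v.2)) := by
    rw [← Finset.sum_attach]
    exact Finset.sum_congr rfl fun v _ => edgeWt_of_ne w (hne v.1 v.2)
  have h3 : ∑ v ∈ (A.filter (lev · = i + 1)).attach,
      (t - t * gap t (w (mkEdge (hne v.1 v.2)))) ≤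
      ∑ v ∈ (A.filter (lev · = i + 1)).attach, w (mkEdge (hne v.1 v.2)) :=
    Finset.sum_le_sum fun v _ => by
      have := one_sub_le_gap ht (hw (mkEdge (hne v.1 v.2)))
      linarith
  rw [Finset.sum_sub_distrib, Finset.sum_const, Finset.card_attach, nsmul_eq_mul,
    ← Finset.mul_sum] at h3
  rw [h2]
  have := mul_le_mul_of_nonneg_left h1 ht.le
  linarith

/-- A lower bound for the cost of all forests, by linear duality. -/
lemma le_forestCost (hw : ∀ e, 0 ≤ w e) {K : ℕ} (hF : IsForest R (K + 1) T A lev par)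
    {t κ σ : ℕ → ℝ} {g l : ℝ} (ht : ∀ i, 0 < t i)
    (hlevel : ∀ i < K, ∀ S : Finset V,
      t (i + 1) * ∑ e ∈ touch S, gap (t (i + 1)) (w e) ≤ κ (i + 1) * (S.card + σ (i + 1)))
    (hattach : ∀ S : Finset V, ∃ τ, g - l * S.card ≤ attachCost w T S τ)
    (ht1 : ∀ i < K, κ (i + 1) + l ≤ t i) (ht2 : l ≤ t K) :
    g - t 0 * R.card - ∑ i ∈ Finset.range K, κ (i + 1) * σ (i + 1) ≤ forestCost w R A par := by
  set L : ℕ → Finset V := fun i => A.filter (lev · = i) with hL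
  have hL0 : L 0 = R := by
    ext v
    simp only [hL, Finset.mem_filter]
    exact ⟨fun h => (hF.lev_eq_zero v h.1).1 h.2,
      fun h => ⟨hF.root_mem h, (hF.lev_eq_zero v (hF.root_mem h)).2 h⟩⟩
  have hdisj : ∀ N : ℕ, Set.PairwiseDisjoint (Finset.range N : Set ℕ) L := by
    intro N i _ j _ hij
    refine Finset.disjoint_left.2 fun v hi hj => hij ?_
    rw [← (Finset.mem_filter.1 hi).2, (Finset.mem_filter.1 hj).2]
  -- S consists of all levels but the deepest one. A terminal outside S lies on level K + 1 and is
  -- attached to S. As all of S is charged the slope l, the term l occurs in the constraint of every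
  -- level.
  set S : Finset V := (Finset.range (K + 1)).biUnion L with hS
  have hScard : (S.card : ℝ) = ∑ i ∈ Finset.range (K + 1), ((L i).card : ℝ) := by
    rw [hS, Finset.card_biUnion (fun i hi j hj hij => hdisj (K + 1) hi hj hij)]
    push_cast
    rfl
  obtain ⟨τ, hτ⟩ := hattach S
  have hTS : ∀ v ∈ T \ S, v ∈ A ∧ v ∉ R ∧ lev v = K + 1 := by
    intro v hv
    obtain ⟨hvT, hvS⟩ := Finset.mem_sdiff.1 hv
    have hvA := hF.terminal_mem hvT
    have h1 : ∀ i < K + 1, lev v ≠ i := fun i hi h =>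
      hvS (Finset.mem_biUnion.2 ⟨i, Finset.mem_range.2 hi, Finset.mem_filter.2 ⟨hvA, h⟩⟩)
    have h2 : lev v = K + 1 := by
      have := hF.lev_le v hvA
      by_contra hne
      exact h1 (lev v) (by omega) rfl
    refine ⟨hvA, fun h => ?_, h2⟩
    have := (hF.lev_eq_zero v hvA).2 h
    omega
  have hlast : attachCost w T S τ ≤ ∑ v ∈ T \ S, edgeWt w (par v) v := by
    refine Finset.sum_le_sum fun v hv => ?_
    obtain ⟨h1, h2, h3⟩ := hTS v hv
    have h4 := hF.par_ne h1 h2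
    rw [edgeWt_of_ne w h4]
    refine truncMin_le (mkEdge_mem_edgesTo h4 ?_) (hw _)
    have h5 := hF.lev_par v h1 h2
    exact Finset.mem_biUnion.2 ⟨K, by simp, Finset.mem_filter.2 ⟨hF.par_mem v h1 h2, by omega⟩⟩
  have hsplit : ∑ i ∈ Finset.range K, ∑ v ∈ L (i + 1), edgeWt w (par v) v +
      ∑ v ∈ T \ S, edgeWt w (par v) v ≤ forestCost w R A par := by
    have hdisj' : Set.PairwiseDisjoint (Finset.range K : Set ℕ) fun i => L (i + 1) := by
      intro i _ j _ hij
      refine Finset.disjoint_left.2 fun v hi hj => hij ?_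
      have h1 := (Finset.mem_filter.1 hi).2
      have h2 := (Finset.mem_filter.1 hj).2
      omega
    rw [← Finset.sum_biUnion hdisj', ← Finset.sum_union]
    · refine Finset.sum_le_sum_of_subset_of_nonneg ?_ fun v _ _ => edgeWt_nonneg hw _ _
      intro v hv
      rw [Finset.mem_sdiff]
      rcases Finset.mem_union.1 hv with hv | hv
      · obtain ⟨i, hi, hvi⟩ := Finset.mem_biUnion.1 hv
        obtain ⟨h1, h2⟩ := Finset.mem_filter.1 hvi
        refine ⟨h1, fun h => ?_⟩
        have := (hF.lev_eq_zero v h1).2 h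
        omega
      · exact ⟨(hTS v hv).1, (hTS v hv).2.1⟩
    · refine Finset.disjoint_left.2 fun v hv hv' => ?_
      obtain ⟨i, hi, hvi⟩ := Finset.mem_biUnion.1 hv
      have h1 := (Finset.mem_filter.1 hvi).2
      have h2 := (hTS v hv').2.2
      have := Finset.mem_range.1 hi
      omega
  have hlev : ∀ i ∈ Finset.range K, t (i + 1) * (L (i + 1)).card -
      κ (i + 1) * ((L i).card + σ (i + 1)) ≤ ∑ v ∈ L (i + 1), edgeWt w (par v) v := by
    intro i hi
    have h1 := le_sum_level hw hF (ht (i + 1)) i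
    have h2 := hlevel i (Finset.mem_range.1 hi) (L i)
    simp only [hL] at h2 ⊢
    linarith
  have hsum := Finset.sum_le_sum hlev
  -- Summation by parts: a vertex of level i ≥ 1 earns t i, and every vertex of level i is charged κ
  -- (i + 1) + l at most, or l on level K. Only the roots earn nothing, which leaves - t 0 · |R|.
  have habel : ∑ i ∈ Finset.range K, (κ (i + 1) + l) * ((L i).card : ℝ) + l * (L K).card ≤
      ∑ i ∈ Finset.range (K + 1), t i * ((L i).card : ℝ) := by
    rw [Finset.sum_range_succ]
    refine add_le_add (Finset.sum_le_sum fun i hi => ?_) ?_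
    · exact mul_le_mul_of_nonneg_right (ht1 i (Finset.mem_range.1 hi)) (Nat.cast_nonneg _)
    · exact mul_le_mul_of_nonneg_right ht2 (Nat.cast_nonneg _)
  rw [Finset.sum_range_succ', hL0] at habel
  rw [hScard, Finset.sum_range_succ, mul_add, Finset.mul_sum] at hτ
  simp only [mul_add, add_mul, Finset.sum_sub_distrib, Finset.sum_add_distrib] at hsum habel hτ
  linarith

end EdgeSets

/-! ### Union bound over vertex sets of a given size. -/

section Union

variable {V : Type*} [Fintype V] {Ω : Type*} [MeasurableSpace Ω]

/-- From n^a/a! = (n/a)^a · a^a/a!, where a^a/a! is one term of the series of e^a. -/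
lemma choose_le_exp {n a : ℕ} (ha : 1 ≤ a) (hn : a ≤ n) :
    (n.choose a : ℝ) ≤ Real.exp (a * Real.log (Real.exp 1 * n / a)) := by
  have ha' : (0 : ℝ) < a := by exact_mod_cast ha
  have hn' : (0 : ℝ) < n := lt_of_lt_of_le ha' (by exact_mod_cast hn)
  rw [mul_comm, Real.exp_mul, Real.exp_log (by positivity), Real.rpow_natCast]
  calc (n.choose a : ℝ) ≤ (n : ℝ) ^ a / a.factorial := Nat.choose_le_pow_div a n
    _ = (n / a : ℝ) ^ a * ((a : ℝ) ^ a / a.factorial) := by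
        rw [div_pow]
        field_simp
    _ ≤ (n / a : ℝ) ^ a * Real.exp a := by
        gcongr
        exact Real.pow_div_factorial_le_exp _ ha'.le _
    _ = _ := by
        rw [← Real.exp_one_pow, ← mul_pow]
        ring_nf

/-- The union bound over all sets of a given size. -/
lemma measure_exists_card_eq_le (P : Measure Ω) {a : ℕ} (ha : 1 ≤ a)
    (haV : a ≤ Fintype.card V) (p : Finset V → Ω → Prop) {q : ℝ}
    (h : ∀ S : Finset V, S.card = a → P {ω | p S ω} ≤ ENNReal.ofReal (Real.exp (-q))) :
    P {ω | ∃ S : Finset V, S.card = a ∧ p S ω} ≤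
      ENNReal.ofReal (Real.exp (a * Real.log (Real.exp 1 * Fintype.card V / a) - q)) := by
  have : {ω | ∃ S : Finset V, S.card = a ∧ p S ω} =
      ⋃ S ∈ Finset.powersetCard a (Finset.univ : Finset V), {ω | p S ω} := by
    ext ω
    simp [Finset.mem_powersetCard]
  rw [this]
  calc _ ≤ ∑ S ∈ Finset.powersetCard a (Finset.univ : Finset V), P {ω | p S ω} :=
        measure_biUnion_finset_le _ _
    _ ≤ ∑ S ∈ Finset.powersetCard a (Finset.univ : Finset V), ENNReal.ofReal (Real.exp (-q)) :=
        Finset.sum_le_sum fun S hS => h S (Finset.mem_powersetCard.1 hS).2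
    _ = ENNReal.ofReal ((Fintype.card V).choose a * Real.exp (-q)) := by
        rw [Finset.sum_const, Finset.card_powersetCard, nsmul_eq_mul, ENNReal.ofReal_mul
          (Nat.cast_nonneg _), ENNReal.ofReal_natCast, Finset.card_univ]
    _ ≤ _ := by
        refine ENNReal.ofReal_le_ofReal ?_
        rw [sub_eq_add_neg, Real.exp_add]
        exact mul_le_mul_of_nonneg_right (choose_le_exp ha haV) (Real.exp_pos _).le

end Union

/-! ### Sizes of the levels and of the weight unit in an optimal tree. -/

section Parameters

/-- The parameters: `n` vertices, `m` terminals, depth `k`, `ρ` roots; `z` is the power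
`(√(2mn) / (ρ 2^k))^(1/(2^k-1))` which determines the optimal sizes of the levels. -/
structure Params (n m k ρ : ℕ) (z : ℝ) : Prop where
  one_le_k : 1 ≤ k
  one_le_m : 1 ≤ m
  m_le_n : m ≤ n
  one_le_rho : 1 ≤ ρ
  rho_le_two : ρ ≤ 2
  two_le_z : 2 ≤ z
  eq : ρ * 2 ^ k * z ^ 2 ^ k = √(2 * m * n) * z
  ratio_le : ((n : ℝ) / m) ^ 4 ≤ z

/-- The order of magnitude of the weight of an optimal tree. -/
noncomputable def unit (n m : ℕ) (z : ℝ) : ℝ := √(8 * (m : ℝ) / n) * z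

/-- The size of level `i` in an optimal tree. -/
noncomputable def levelSize (k ρ : ℕ) (z : ℝ) (i : ℕ) : ℝ := ρ * 2 ^ i * z ^ (2 ^ k - 2 ^ (k - i))

variable {n m k ρ : ℕ} {z : ℝ}

namespace Params

lemma z_pos (h : Params n m k ρ z) : 0 < z := by linarith [h.two_le_z]

lemma m_pos (h : Params n m k ρ z) : (0 : ℝ) < m := by exact_mod_cast h.one_le_m

lemma n_pos (h : Params n m k ρ z) : (0 : ℝ) < n := by exact_mod_cast h.one_le_m.trans h.m_le_n

lemma rho_pos (h : Params n m k ρ z) : (0 : ℝ) < ρ := by exact_mod_cast h.one_le_rho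

lemma unit_pos (h : Params n m k ρ z) : 0 < unit n m z := by
  have := h.z_pos
  have := h.m_pos
  have := h.n_pos
  unfold unit
  positivity

lemma unit_sq (h : Params n m k ρ z) : unit n m z ^ 2 * n = 8 * m * z ^ 2 := by
  have h1 := h.m_pos
  have h2 := h.n_pos
  unfold unit
  rw [mul_pow, Real.sq_sqrt (by positivity)]
  field_simp

/-- The weight unit in terms of the first level. -/
lemma unit_mul_n (h : Params n m k ρ z) :
    unit n m z * n = ρ * z ^ 2 ^ k * 2 ^ (k + 1) := by
  have h1 := h.m_pos
  have h2 := h.n_pos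
  have h3 : √(8 * (m : ℝ) / n) * n = 2 * √(2 * m * n) := by
    have e : (8 * (m : ℝ) / n) = (2 / n) ^ 2 * (2 * m * n) := by field_simp; ring
    rw [e, Real.sqrt_mul (by positivity), Real.sqrt_sq (by positivity)]
    field_simp
  calc unit n m z * n = (√(8 * (m : ℝ) / n) * n) * z := by unfold unit; ring
    _ = 2 * (√(2 * m * n) * z) := by rw [h3]; ring
    _ = 2 * (ρ * 2 ^ k * z ^ 2 ^ k) := by rw [h.eq]
    _ = _ := by ring

lemma one_le_ratio (h : Params n m k ρ z) : 1 ≤ (n : ℝ) / m := by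
  rw [one_le_div h.m_pos]
  exact_mod_cast h.m_le_n

lemma ratio_le_z (h : Params n m k ρ z) : (n : ℝ) / m ≤ z :=
  (le_self_pow₀ h.one_le_ratio (by norm_num)).trans h.ratio_le

/-- The square of the unit is 8(m/n)z², and n/m ≤ z. Hence the unit tends to infinity with z. -/
lemma z_le_unit_sq (h : Params n m k ρ z) : 8 * z ≤ unit n m z ^ 2 := by
  have h1 := h.m_pos
  have h2 := h.n_pos
  have h3 := h.z_pos
  have h4 := h.ratio_le_z
  rw [div_le_iff₀ h1] at h4
  have h5 := h.unit_sq
  have h6 : 8 * z * n ≤ unit n m z ^ 2 * n := by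
    rw [h5]
    nlinarith
  exact le_of_mul_le_mul_right h6 h2

lemma sqrt_le_unit (h : Params n m k ρ z) : √z ≤ unit n m z := by
  refine Real.sqrt_le_left h.unit_pos.le |>.2 ?_ |>.trans le_rfl
  linarith [h.z_le_unit_sq, h.z_pos]

lemma levelSize_mul (k ρ : ℕ) (z : ℝ) (i : ℕ) :
    levelSize k ρ z i * z ^ 2 ^ (k - i) = ρ * 2 ^ i * z ^ 2 ^ k := by
  unfold levelSize
  rw [mul_assoc, ← pow_add, Nat.sub_add_cancel]
  exact Nat.pow_le_pow_right (by norm_num) (Nat.sub_le k i)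

lemma levelSize_pos (h : Params n m k ρ z) (i : ℕ) : 0 < levelSize k ρ z i := by
  have := h.z_pos
  have := h.rho_pos
  unfold levelSize
  positivity

lemma levelSize_zero : levelSize k ρ z 0 = ρ := by simp [levelSize]

/-- The factor 2 z^(2^(k-(i+1))) is n times the optimal threshold: the number of children of a
vertex on level i. -/
lemma levelSize_succ (h : Params n m k ρ z) {i : ℕ} (hi : i < k) :
    levelSize k ρ z (i + 1) = levelSize k ρ z i * (2 * z ^ 2 ^ (k - (i + 1))) := by
  have hz := h.z_pos
  have h1 := levelSize_mul k ρ z i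
  have h2 := levelSize_mul k ρ z (i + 1)
  have e : 2 ^ (k - i) = 2 ^ (k - (i + 1)) + 2 ^ (k - (i + 1)) := by
    rw [← two_mul, ← pow_succ']
    congr 1
    omega
  rw [e, pow_add] at h1
  have h3 : 0 < z ^ 2 ^ (k - (i + 1)) := by positivity
  apply mul_right_cancel₀ h3.ne'
  rw [h2, pow_succ]
  linear_combination (-2 : ℝ) * h1

lemma levelSize_mono (h : Params n m k ρ z) {i j : ℕ} (hij : i ≤ j) :
    levelSize k ρ z i ≤ levelSize k ρ z j := by
  have hz := h.two_le_z
  have hρ := h.rho_pos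
  unfold levelSize
  gcongr
  · norm_num
  · linarith
  · norm_num

/-- Equivalently, m divided by the size of level k - 1 is half the unit: attaching the terminals
makes up half of the scale. -/
lemma levelSize_last_mul (h : Params n m k ρ z) :
    levelSize k ρ z (k - 1) * unit n m z = 2 * m := by
  have hk := h.one_le_k
  have h1 := levelSize_mul k ρ z (k - 1)
  have h2 := h.unit_mul_n
  have h3 := h.unit_sq
  have hz := h.z_pos
  have hn := h.n_pos
  have e : k - (k - 1) = 1 := by omega
  rw [e, pow_one] at h1
  obtain ⟨j, rfl⟩ : ∃ j, k = j + 1 := ⟨k - 1, by omega⟩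
  simp only [Nat.add_sub_cancel] at h1 ⊢
  have h4 : levelSize (j + 1) ρ z j * z ^ 2 * 4 = unit n m z * n := by
    rw [h1, h2]
    ring
  have h5 : 0 < z ^ 2 * 4 := by positivity
  apply mul_right_cancel₀ h5.ne'
  calc levelSize (j + 1) ρ z j * unit n m z * (z ^ 2 * 4)
      = (levelSize (j + 1) ρ z j * z ^ 2 * 4) * unit n m z := by ring
    _ = unit n m z ^ 2 * n := by rw [h4]; ring
    _ = _ := by rw [h3]; ring

/-- The size of the first level, up to a constant. -/
lemma pow_le_levelSize (h : Params n m k ρ z) {i : ℕ} (hi : 1 ≤ i) :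
    2 * z ^ 2 ^ (k - 1) ≤ levelSize k ρ z i := by
  have hz := h.two_le_z
  have hρ : (1 : ℝ) ≤ ρ := by exact_mod_cast h.one_le_rho
  have hk := h.one_le_k
  refine le_trans ?_ (h.levelSize_mono hi)
  unfold levelSize
  have e : 2 ^ k - 2 ^ (k - 1) = 2 ^ (k - 1) := by
    obtain ⟨j, rfl⟩ : ∃ j, k = j + 1 := ⟨k - 1, by omega⟩
    simp only [Nat.add_sub_cancel, pow_succ]
    omega
  rw [e, pow_one]
  have : 0 < z ^ 2 ^ (k - 1) := by positivity
  nlinarith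

lemma z_le_pow (h : Params n m k ρ z) : z ≤ z ^ 2 ^ (k - 1) :=
  le_self_pow₀ (by linarith [h.two_le_z]) (by positivity)

lemma k_le_pow (h : Params n m k ρ z) : (k : ℝ) ≤ z ^ 2 ^ (k - 1) := by
  have hz := h.two_le_z
  have h1 : k ≤ 2 ^ (k - 1) := by
    have := Nat.lt_two_pow_self (n := k - 1)
    omega
  calc (k : ℝ) ≤ (2 : ℝ) ^ (k - 1) := by exact_mod_cast h1
    _ ≤ 2 ^ 2 ^ (k - 1) := pow_le_pow_right₀ (by norm_num) Nat.lt_two_pow_self.le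
    _ ≤ _ := pow_le_pow_left₀ (by norm_num) hz _

/-- Bounds n and m by a polynomial in Q = z^(2^(k-1)), which failure probabilities exp(-cQ) then
beat. -/
lemma n_mul_unit_le (h : Params n m k ρ z) :
    n * unit n m z ≤ 8 * (z ^ 2 ^ (k - 1)) ^ 3 := by
  have hz := h.two_le_z
  have hz0 := h.z_pos
  have hk := h.one_le_k
  have hρ : (ρ : ℝ) ≤ 2 := by exact_mod_cast h.rho_le_two
  have h1 : (2 : ℝ) ^ (k - 1) ≤ z ^ 2 ^ (k - 1) :=
    (pow_le_pow_right₀ (by norm_num) Nat.lt_two_pow_self.le).trans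
      (pow_le_pow_left₀ (by norm_num) hz _)
  obtain ⟨j, rfl⟩ : ∃ j, k = j + 1 := ⟨k - 1, by omega⟩
  simp only [Nat.add_sub_cancel] at h1 ⊢
  rw [mul_comm, h.unit_mul_n]
  set Q := z ^ 2 ^ j with hQ
  have e : z ^ 2 ^ (j + 1) = Q ^ 2 := by rw [hQ, ← pow_mul, pow_succ]
  rw [e]
  have hQ0 : 0 < Q := by positivity
  calc (ρ : ℝ) * Q ^ 2 * 2 ^ (j + 1 + 1) = (ρ * 4) * (Q ^ 2 * 2 ^ j) := by ring
    _ ≤ (2 * 4) * (Q ^ 2 * Q) := by gcongr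
    _ = _ := by ring

/-- The unit is at most 3z because m ≤ n, while n times the unit is at least 4z². -/
lemma z_le_n (h : Params n m k ρ z) : z ≤ n := by
  have hm := h.m_pos
  have hn := h.n_pos
  have hz := h.z_pos
  have h1 := h.z_le_unit_sq
  have h2 := h.unit_sq
  have h3 := h.unit_mul_n
  have hz2 := h.two_le_z
  have hmn : (m : ℝ) ≤ n := by exact_mod_cast h.m_le_n
  have hρ : (1 : ℝ) ≤ ρ := by exact_mod_cast h.one_le_rho
  have e1 : z ^ 2 ≤ z ^ 2 ^ k :=
    pow_le_pow_right₀ (by linarith) (Nat.le_self_pow (by have := h.one_le_k; omega) 2)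
  have e2 : (4 : ℝ) ≤ 2 ^ (k + 1) := by
    have : (2 : ℝ) ^ 2 ≤ 2 ^ (k + 1) :=
      pow_le_pow_right₀ (by norm_num) (by have := h.one_le_k; omega)
    linarith
  have h4 : 4 * z ^ 2 ≤ unit n m z * n := by
    rw [h3]
    calc 4 * z ^ 2 = 1 * z ^ 2 * 4 := by ring
      _ ≤ ρ * z ^ 2 ^ k * 2 ^ (k + 1) := by gcongr
  have h5 : unit n m z ≤ 3 * z := by
    have hu := h.unit_pos
    by_contra! h6
    have : (3 * z) ^ 2 < unit n m z ^ 2 := pow_lt_pow_left₀ h6 (by positivity) (by norm_num)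
    nlinarith
  by_contra! h7
  nlinarith

/-- From (n/m)^4 ≤ z ≤ n one gets n³ ≤ m⁴ ≤ m⁶. It makes the bound n exp(-cm) for the attachment
costs useful. -/
lemma n_le_sq (h : Params n m k ρ z) : (n : ℝ) ≤ m ^ 2 := by
  have hm := h.m_pos
  have hn := h.n_pos
  have hm1 : (1 : ℝ) ≤ m := by exact_mod_cast h.one_le_m
  have h5 := h.ratio_le.trans h.z_le_n
  rw [div_pow, div_le_iff₀ (by positivity)] at h5
  have h6 : (n : ℝ) ^ 3 ≤ m ^ 4 := by
    have : (n : ℝ) * n ^ 3 ≤ n * m ^ 4 := by nlinarith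
    exact le_of_mul_le_mul_left this hn
  by_contra! h7
  have h8 : ((m : ℝ) ^ 2) ^ 3 < n ^ 3 := pow_lt_pow_left₀ h7 (by positivity) (by norm_num)
  have h9 : (m : ℝ) ^ 4 ≤ m ^ 6 := pow_le_pow_right₀ hm1 (by norm_num)
  rw [← pow_mul] at h8
  norm_num at h8
  linarith

lemma z_le_m_sq (h : Params n m k ρ z) : z ≤ m ^ 2 := h.z_le_n.trans h.n_le_sq

lemma levelSize_last_le (h : Params n m k ρ z) {i : ℕ} (hi : i ≤ k - 1) :
    levelSize k ρ z i ≤ n * (2 / unit n m z) := by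
  have hu := h.unit_pos
  have h1 := h.levelSize_last_mul
  have hmn : (m : ℝ) ≤ n := by exact_mod_cast h.m_le_n
  refine (h.levelSize_mono hi).trans ?_
  rw [mul_div_assoc', le_div_iff₀ hu, h1]
  linarith

/-- So log(n/ℓ_i) is of order 2^j log z at most, up to a constant, for j = k - (i+1): little
compared with z^(2^j). -/
lemma n_div_levelSize (h : Params n m k ρ z) {i : ℕ} (hi : i < k) :
    n / levelSize k ρ z i =
      4 * 2 ^ (k - (i + 1)) * (z ^ 2 ^ (k - (i + 1))) ^ 2 / unit n m z := by
  have hu := h.unit_pos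
  have hl := h.levelSize_pos i
  have h1 := levelSize_mul k ρ z i
  have h2 := h.unit_mul_n
  have e : z ^ 2 ^ (k - i) = (z ^ 2 ^ (k - (i + 1))) ^ 2 := by
    rw [← pow_mul, ← pow_succ]
    congr 2
    omega
  rw [e] at h1
  rw [div_eq_div_iff hl.ne' hu.ne', mul_comm, h2]
  have e2 : (2 : ℝ) ^ (k + 1) = 4 * 2 ^ (k - (i + 1)) * 2 ^ i := by
    rw [show (4 : ℝ) = 2 ^ 2 by norm_num, ← pow_add, ← pow_add]
    congr 1
    omega
  rw [e2]
  linear_combination (-4 : ℝ) * 2 ^ (k - (i + 1)) * h1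

end Params

end Parameters

/-! ### Entropy of vertex sets against large deviation exponents. -/

section Asymptotics

lemma exists_pow_mul_exp_le (j : ℕ) {c ε : ℝ} (hc : 0 < c) (hε : 0 < ε) :
    ∃ X : ℝ, 1 ≤ X ∧ ∀ x, X ≤ x → x ^ j * Real.exp (-(c * x)) ≤ ε := by
  have h1 := (Real.tendsto_pow_mul_exp_neg_atTop_nhds_zero j).comp
    (tendsto_id.const_mul_atTop hc)
  have h2 := h1.eventually (gt_mem_nhds (show (0 : ℝ) < ε * c ^ j by positivity))
  obtain ⟨X, hX⟩ := eventually_atTop.1 h2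
  refine ⟨max X 1, le_max_right _ _, fun x hx => ?_⟩
  have h3 := hX x ((le_max_left _ _).trans hx)
  simp only [Function.comp, id, mul_pow] at h3
  have h4 : 0 < c ^ j := by positivity
  have h5 : c ^ j * (x ^ j * Real.exp (-(c * x))) ≤ c ^ j * ε := by linarith
  exact le_of_mul_le_mul_left h5 h4

lemma exists_log_le {c : ℝ} (hc : 0 < c) : ∃ X : ℝ, 1 ≤ X ∧ ∀ x, X ≤ x → Real.log x ≤ c * x := by
  have h1 := Real.isLittleO_log_id_atTop.bound hc
  obtain ⟨X, hX⟩ := eventually_atTop.1 h1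
  refine ⟨max X 1, le_max_right _ _, fun x hx => ?_⟩
  have h2 := hX x ((le_max_left _ _).trans hx)
  have h3 : (0 : ℝ) ≤ x := by linarith [le_max_right X 1]
  simp only [Real.norm_eq_abs, id, abs_of_nonneg h3] at h2
  exact (le_abs_self _).trans h2

/-- The number of sets of the size of a level is negligible against the large deviation
probabilities on the next level. -/
lemma exists_log_levelSize_le {c C : ℝ} (hc : 0 < c) (hC : 0 < C) :
    ∃ Z : ℝ, ∀ (n m k ρ : ℕ) (z : ℝ), Params n m k ρ z → Z ≤ z → ∀ i, i + 1 < k →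
      Real.log (C * (n / levelSize k ρ z i)) ≤ c * z ^ 2 ^ (k - (i + 1)) := by
  obtain ⟨X, hX1, hX⟩ := exists_log_le (show 0 < c / 16 by positivity)
  refine ⟨max X (max (4 * (|Real.log (4 * C)| + 1) / c) 1), fun n m k ρ z h hz i hi => ?_⟩
  have hz2 := h.two_le_z
  have hz0 := h.z_pos
  have hX' := hX z ((le_max_left _ _).trans hz)
  have hz3 : 4 * (|Real.log (4 * C)| + 1) / c ≤ z :=
    (le_max_left _ _).trans ((le_max_right _ _).trans hz)
  rw [div_le_iff₀ hc] at hz3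
  have hu1 : 1 ≤ unit n m z := by
    refine le_trans ?_ h.sqrt_le_unit
    rw [Real.one_le_sqrt]
    linarith
  rw [h.n_div_levelSize (by omega)]
  obtain ⟨j, hj⟩ : ∃ j, k - (i + 1) = j + 1 := ⟨k - (i + 1) - 1, by omega⟩
  rw [hj]
  set q : ℕ := 2 ^ (j + 1) with hq
  have hq2 : 2 ≤ q := by
    rw [hq, pow_succ]
    have := Nat.one_le_two_pow (n := j)
    omega
  have hqr : ((2 : ℝ) ^ (j + 1)) = q := by rw [hq]; push_cast; rfl
  rw [hqr]
  have hq2' : (2 : ℝ) ≤ q := by exact_mod_cast hq2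
  have hlogq : Real.log q ≤ q := (Real.log_le_sub_one_of_pos (by linarith)).trans (by linarith)
  have hlogz : 0 ≤ Real.log z := Real.log_nonneg (by linarith)
  calc Real.log (C * (4 * q * (z ^ q) ^ 2 / unit n m z))
      ≤ Real.log (C * (4 * q * (z ^ q) ^ 2)) := by
        refine Real.log_le_log (by have := h.unit_pos; positivity) ?_
        gcongr
        exact div_le_self (by positivity) hu1
    _ = Real.log (4 * C) + Real.log q + 2 * (q * Real.log z) := by
        rw [show C * (4 * q * (z ^ q) ^ 2) = (4 * C) * q * (z ^ q) ^ 2 by ring,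
          Real.log_mul (by positivity) (by positivity), Real.log_mul (by positivity)
          (by positivity), Real.log_pow, Real.log_pow]
        push_cast
        ring
    _ ≤ q * ((|Real.log (4 * C)| + 1) + 2 * Real.log z) := by
        have : Real.log (4 * C) ≤ q * |Real.log (4 * C)| := by
          have := le_abs_self (Real.log (4 * C))
          have := abs_nonneg (Real.log (4 * C))
          nlinarith
        nlinarith
    _ ≤ q * (c / 4 * z + c / 8 * z) := by
        refine mul_le_mul_of_nonneg_left ?_ (by linarith)
        linarith
    _ ≤ c * ((q : ℝ) * z / 2) := by nlinarith [mul_pos hc (mul_pos (show (0 : ℝ) < q by linarith) hz0)]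
    -- The factor q/2 is absorbed by z^(q-1) ≥ 2^(q-1); this uses q ≥ 2, that is, i + 1 < k.
    _ ≤ c * z ^ q := by
        gcongr
        have h1 : (q : ℝ) / 2 ≤ z ^ (q - 1) := by
          obtain ⟨p, hp⟩ : ∃ p, q = p + 1 := ⟨q - 1, by omega⟩
          rw [hp, Nat.add_sub_cancel]
          calc ((p + 1 : ℕ) : ℝ) / 2 ≤ p := by
                have : (1 : ℝ) ≤ p := by
                  have : 1 ≤ p := by omega
                  exact_mod_cast this
                push_cast
                linarith
            _ ≤ 2 ^ p := by exact_mod_cast Nat.lt_two_pow_self.le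
            _ ≤ z ^ p := pow_le_pow_left₀ (by norm_num) hz2 p
        calc (q : ℝ) * z / 2 = q / 2 * z := by ring
          _ ≤ z ^ (q - 1) * z := by gcongr
          _ = z ^ q := by rw [← pow_succ, Nat.sub_add_cancel (by omega)]

/-- The number of sets of the size of the last level is negligible against `exp (c m)`. -/
lemma exists_mul_log_last_le {c : ℝ} (hc : 0 < c) :
    ∃ Z : ℝ, ∀ (n m k ρ : ℕ) (z : ℝ), Params n m k ρ z → Z ≤ z → ∀ a : ℕ, 1 ≤ a →
      levelSize k ρ z (k - 1) / 4 ≤ a → a ≤ 2 * levelSize k ρ z (k - 1) → (a : ℝ) ≤ n →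
      a * Real.log (Real.exp 1 * n / a) ≤ c * m := by
  obtain ⟨X, hX1, hX⟩ := exists_log_le (show 0 < c / 12 by positivity)
  refine ⟨X ^ 2, fun n m k ρ z h hz a ha ha1 ha2 han => ?_⟩
  have hu := h.unit_pos
  have hm := h.m_pos
  have hn := h.n_pos
  have ha' : (1 : ℝ) ≤ a := by exact_mod_cast ha
  have hM := h.levelSize_last_mul
  have hM0 := h.levelSize_pos (k - 1)
  set M := levelSize k ρ z (k - 1)
  set s := unit n m z
  have hs : X ≤ s := by
    refine le_trans ?_ h.sqrt_le_unit
    exact Real.le_sqrt_of_sq_le hz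
  have hXs := hX s hs
  have hs1 : 1 ≤ s := hX1.trans hs
  -- n/a is polynomial in s, because n ≤ zm ≤ s²m/8 and m = Ms/2 ≤ 2as. The entropy is therefore of
  -- order M log s, negligible against Ms = 2m.
  have hlog : Real.log (Real.exp 1 * n / a) ≤ 3 * Real.log s := by
    have e : 3 * Real.log s = Real.log (s ^ 3) := by rw [Real.log_pow]; norm_num
    rw [e]
    refine Real.log_le_log (by positivity) ?_
    rw [div_le_iff₀ (by linarith)]
    have h1 := h.ratio_le_z
    rw [div_le_iff₀ hm] at h1
    have h2 := h.z_le_unit_sq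
    have h3 : s ^ 2 * 2 * m ≤ s ^ 3 * (4 * a) := by
      calc s ^ 2 * 2 * m = s ^ 3 * M := by linear_combination (-s ^ 2) * hM
        _ ≤ s ^ 3 * (4 * a) := by gcongr; linarith
    have h4 : (8 : ℝ) * n ≤ s ^ 2 * m := by nlinarith
    have h5 : Real.exp 1 ≤ 3 := by linarith [Real.exp_one_lt_d9]
    nlinarith
  have hl0 : 0 ≤ Real.log s := Real.log_nonneg hs1
  calc (a : ℝ) * Real.log (Real.exp 1 * n / a) ≤ a * (3 * Real.log s) := by gcongr
    _ ≤ 2 * M * (3 * Real.log s) := by gcongr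
    _ ≤ 2 * M * (3 * (c / 12 * s)) := by gcongr
    _ = c / 2 * (M * s) := by ring
    _ = c * m := by rw [hM]; ring

end Asymptotics

/-! ### Concentration uniformly over vertex sets of one size. -/

section Concentration

variable {V : Type*} [Fintype V] [DecidableEq V] [Fintype (⊤ : SimpleGraph V).edgeSet]
  {μ : Measure ℝ} [IsProbabilityMeasure μ]

lemma integral_comp_eval {ι : Type*} [Fintype ι] {f : ℝ → ℝ} (hf : Measurable f) (e : ι) :
    ∫ w, f (w e) ∂(Measure.pi fun _ : ι => μ) = ∫ x, f x ∂μ := by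
  have h := measurePreserving_eval (fun _ : ι => μ) e
  conv_rhs => rw [← h.map_eq]
  rw [integral_map h.aemeasurable hf.aestronglyMeasurable]

/-- Uniform upper tail bound for sums over the edges near a set of vertices. -/
lemma measure_exists_edge_sum_ge {f : ℝ → ℝ} (hf : Measurable f)
    (h01 : ∀ x, f x ∈ Set.Icc (0 : ℝ) 1) {p δ : ℝ} (hp : ∫ x, f x ∂μ ≤ p) (hδ : 0 < δ)
    (hδ1 : δ ≤ 1) {a : ℕ} (ha : 1 ≤ a) (haV : a ≤ Fintype.card V)
    (B : Finset V → Finset (⊤ : SimpleGraph V).edgeSet)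
    (hB : ∀ S, (B S).card ≤ S.card * Fintype.card V) :
    (Measure.pi fun _ : (⊤ : SimpleGraph V).edgeSet => μ)
      {w | ∃ S : Finset V, S.card = a ∧
        (1 + δ) * (a * Fintype.card V * p) ≤ ∑ e ∈ B S, f (w e)} ≤
      ENNReal.ofReal (Real.exp (a * Real.log (Real.exp 1 * Fintype.card V / a) -
        δ ^ 2 / 4 * (a * Fintype.card V * p))) := by
  have hp0 : 0 ≤ p := (integral_nonneg fun x => (h01 x).1).trans hp
  refine measure_exists_card_eq_le _ ha haV _ fun S hS => ?_
  refine chernoff_upper (X := fun (e : (⊤ : SimpleGraph V).edgeSet)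
    (w : (⊤ : SimpleGraph V).edgeSet → ℝ) => f (w e)) (D := fun e => {e}) (B S)
    (fun e _ => hf.comp (measurable_pi_apply e)) (fun e _ w => h01 _) ?_ ?_ (p := p) ?_ ?_ ?_
    hδ hδ1
  · intro e _ x y hxy
    simp only
    rw [hxy e rfl]
  · intro e _ e' _ h
    simpa using h
  · intro e _
    rw [integral_comp_eval hf]
    exact hp
  · refine mul_le_mul_of_nonneg_right ?_ hp0
    have := hB S
    rw [hS] at this
    exact_mod_cast this
  · positivity

/-- Uniform lower tail bound for the cost of attaching the terminals to a set of vertices. -/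
lemma measure_exists_attachCost_le {T : Finset V} {c K δ : ℝ} (hc : 0 < c) (hK : 0 < K)
    (hδ : 0 < δ) (hδ1 : δ ≤ 1) {a : ℕ} (ha : 1 ≤ a) (haV : a ≤ Fintype.card V)
    (haT : (a : ℝ) ≤ δ * T.card)
    (h : ∀ y, 0 < y → y ≤ K / a → Real.exp (-(c * y)) ≤ μ.real (Set.Ici y)) :
    (Measure.pi fun _ : (⊤ : SimpleGraph V).edgeSet => μ)
      {w | ∃ S : Finset V, S.card = a ∧ attachCost w T S (K / a) ≤
        (1 - δ) * ((1 - δ) * T.card * ((1 - Real.exp (-(c * K))) / (c * K))) * (K / a)} ≤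
      ENNReal.ofReal (Real.exp (a * Real.log (Real.exp 1 * Fintype.card V / a) -
        δ ^ 2 / 4 * ((1 - δ) * T.card * ((1 - Real.exp (-(c * K))) / (c * K))))) := by
  have ha' : (0 : ℝ) < a := by exact_mod_cast ha
  have hτ : 0 < K / a := by positivity
  have hp0 : 0 ≤ (1 - Real.exp (-(c * K))) / (c * K) := by
    have : Real.exp (-(c * K)) ≤ 1 := Real.exp_le_one_iff.2 (by nlinarith [mul_pos hc hK])
    exact div_nonneg (by linarith) (by positivity)
  have hδ1' : 0 ≤ 1 - δ := by linarith
  refine measure_exists_card_eq_le _ ha haV _ fun S hS => ?_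
  have hvS : ∀ v ∈ T \ S, v ∉ S := fun v hv => (Finset.mem_sdiff.1 hv).2
  -- Divided by K/a the attachment costs lie in [0, 1], and different terminals use disjoint sets of
  -- edges to S.
  refine (measure_mono ?_).trans (chernoff_lower (μ := μ)
    (X := fun v (w : (⊤ : SimpleGraph V).edgeSet → ℝ) => truncMin (edgesTo S v) (K / a) w / (K / a))
    (D := fun v => (edgesTo S v : Set (⊤ : SimpleGraph V).edgeSet)) (T \ S)
    (fun v _ => (measurable_truncMin _ _).div_const _) (fun v _ w => ?_) ?_ ?_
    (p := (1 - Real.exp (-(c * K))) / (c * K)) ?_ ?_ ?_ hδ hδ1)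
  · intro w hw
    have hw' : attachCost w T S (K / a) ≤
      (1 - δ) * ((1 - δ) * T.card * ((1 - Real.exp (-(c * K))) / (c * K))) * (K / a) := hw
    rw [← div_le_iff₀ hτ, attachCost, Finset.sum_div] at hw'
    exact hw'
  · have := truncMin_mem (edgesTo S v) hτ.le w
    exact ⟨div_nonneg this.1 hτ.le, (div_le_one hτ).2 this.2⟩
  · intro v _ x y hxy
    simp only
    rw [dependsOn_truncMin _ _ hxy]
  · exact fun u hu v hv huv => disjoint_edgesTo (hvS u hu) (hvS v hv) huv
  · intro v hv
    have hcard := card_edgesTo (hvS v hv)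
    rw [hS] at hcard
    have hne : (edgesTo S v).Nonempty := by
      rw [← Finset.card_pos]
      omega
    have h1 := le_integral_truncMin (μ := μ) hne hτ.le hc h
    rw [hcard] at h1
    rw [integral_div, le_div_iff₀ hτ]
    refine le_trans (le_of_eq ?_) h1
    have e : c * a * (K / a) = c * K := by field_simp
    rw [e]
    field_simp
  -- At most a ≤ δ|T| terminals belong to S themselves.
  · refine mul_le_mul_of_nonneg_right ?_ hp0
    have h1 := Finset.le_card_sdiff S T
    rw [hS] at h1
    have h2 : (T.card : ℝ) ≤ (T \ S).card + a := by
      have : T.card ≤ (T \ S).card + a := by omega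
      exact_mod_cast this
    linarith
  · positivity

end Concentration

lemma expMeasure_real_Ici {y : ℝ} (hy : 0 ≤ y) :
    (expMeasure 1).real (Set.Ici y) = Real.exp (-y) := by
  have : IsProbabilityMeasure (expMeasure 1) := isProbabilityMeasure_expMeasure one_pos
  have h := cdf_expMeasure_eq (r := 1) one_pos y
  rw [if_pos hy, cdf_eq_real] at h
  have ha : (expMeasure 1) {y} = 0 := by
    unfold expMeasure gammaMeasure
    exact withDensity_absolutelyContinuous _ _ Real.volume_singleton
  have h2 : (expMeasure 1).real (Set.Iio y) = (expMeasure 1).real (Set.Iic y) := by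
    refine measureReal_congr ?_
    exact Iio_ae_eq_Iic' ha
  rw [real_Ici_eq, h2, h]
  simp

/-! ### Uniform lower bounds for the cost of a level and of attaching the terminals. -/

section Lower

variable {μ : Measure ℝ} [IsProbabilityMeasure μ]

lemma Params.one_le_levelSize {n m k ρ : ℕ} {z : ℝ} (h : Params n m k ρ z) (i : ℕ) :
    1 ≤ levelSize k ρ z i := by
  refine le_trans ?_ (h.levelSize_mono (Nat.zero_le i))
  rw [Params.levelSize_zero]
  exact_mod_cast h.one_le_rho

/-- The slope of a level is small. -/
lemma Params.slope_le {n m k ρ : ℕ} {z : ℝ} (h : Params n m k ρ z) {i : ℕ} (hi : i + 1 < k) :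
    2 * z ^ 2 ^ (k - (i + 1)) / n ≤ 2 / √z := by
  have hz := h.z_pos
  have hn := h.n_pos
  have h1 := h.levelSize_succ (show i < k by omega)
  have h2 := h.levelSize_last_le (show i + 1 ≤ k - 1 by omega)
  have h3 := h.one_le_levelSize i
  have h4 : 0 < 2 * z ^ 2 ^ (k - (i + 1)) := by positivity
  calc 2 * z ^ 2 ^ (k - (i + 1)) / n ≤ levelSize k ρ z (i + 1) / n := by
        gcongr
        rw [h1]
        nlinarith
    _ ≤ 2 / unit n m z := by rwa [div_le_iff₀' hn]
    _ ≤ 2 / √z := by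
        have := h.sqrt_le_unit
        have : 0 < √z := Real.sqrt_pos.2 hz
        gcongr

/-- Uniformly over all sets `S` of vertices, the edges at `S` do not provide a large gain on
a given level. -/
lemma exists_measure_level_le {δ η β : ℝ} (h : NearZero μ δ η) (hδ : 0 < δ) (hδ1 : δ ≤ 1)
    (hβ : 0 < β) (hβ1 : β ≤ 1) :
    ∃ Z c : ℝ, 0 < c ∧ ∀ (n m k ρ : ℕ) (z : ℝ), Params n m k ρ z → Z ≤ z → ∀ i, i + 1 < k →
      ∀ t : ℝ, t = 2 * β * z ^ 2 ^ (k - (i + 1)) / n →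
      (Measure.pi fun _ : (⊤ : SimpleGraph (Fin n)).edgeSet => μ)
        {w | ∃ S : Finset (Fin n), (1 + δ) ^ 2 * (n / 2) * t ^ 2 *
          (S.card + δ * levelSize k ρ z i) < t * ∑ e ∈ touch S, gap t (w e)} ≤
      ENNReal.ofReal (Real.exp (-(c * z ^ 2 ^ (k - 1)))) := by
  obtain ⟨Z, hZ⟩ := exists_log_levelSize_le (show 0 < δ ^ 2 * β / 8 by positivity)
    (show 0 < Real.exp 1 / δ by positivity)
  have hη := h.pos
  refine ⟨max Z ((2 / η) ^ 2), δ ^ 3 * β / 8, by positivity,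
    fun n m k ρ z hP hz i hi t ht => ?_⟩
  have hlog := hZ n m k ρ z hP ((le_max_left _ _).trans hz) i hi
  have hz0 := hP.z_pos
  have hn := hP.n_pos
  have hsq : 2 / η ≤ √z := Real.le_sqrt_of_sq_le ((le_max_right _ _).trans hz)
  have hsq0 : 0 < √z := Real.sqrt_pos.2 hz0
  have hslope := hP.slope_le hi
  have hsucc := hP.levelSize_succ (show i < k by omega)
  have hpow := hP.pow_le_levelSize (show 1 ≤ i + 1 by omega)
  have hl1 := hP.one_le_levelSize i
  have hln : levelSize k ρ z i ≤ n := by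
    refine (hP.levelSize_last_le (show i ≤ k - 1 by omega)).trans ?_
    have h2 : 2 / unit n m z ≤ 1 := by
      rw [div_le_one hP.unit_pos]
      have := hP.z_le_unit_sq
      have := hP.two_le_z
      have := hP.unit_pos
      nlinarith
    exact mul_le_of_le_one_right hn.le h2
  set ℓ := levelSize k ρ z i
  set Q := z ^ 2 ^ (k - 1)
  set y := z ^ 2 ^ (k - (i + 1)) with hy
  have hy0 : 0 < y := by positivity
  have ht0 : 0 < t := by rw [ht]; positivity
  have htη : t ≤ η := by
    calc t = β * (2 * y / n) := by rw [ht]; ring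
      _ ≤ 2 * y / n := mul_le_of_le_one_left (by positivity) hβ1
      _ ≤ 2 / √z := hslope
      _ ≤ η := by
        rw [div_le_iff₀ hη] at hsq
        rw [div_le_iff₀ hsq0]
        linarith
  have hnt : n * t = 2 * β * y := by rw [ht]; field_simp
  -- Sets of size about δℓ are large enough that the exponent a·n·t exceeds their entropy, and small
  -- enough that the error a - 1 in `sum_touch_le_of_card` is only δℓ.
  set a := ⌈δ * ℓ⌉₊ with ha
  have haδ : δ * ℓ ≤ a := Nat.le_ceil _
  have ha1 : 1 ≤ a := Nat.one_le_ceil_iff.2 (by positivity)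
  have haV : a ≤ Fintype.card (Fin n) := by
    rw [Fintype.card_fin]
    refine Nat.ceil_le.2 ?_
    nlinarith
  have ha0 : (0 : ℝ) < a := by exact_mod_cast ha1
  have ha2 : (a : ℝ) - 1 ≤ δ * ℓ := by
    have := Nat.ceil_lt_add_one (show 0 ≤ δ * ℓ by positivity)
    linarith
  have key := measure_exists_edge_sum_ge (V := Fin n) (μ := μ) (measurable_gap t) (gap_mem t)
    (h.integral_gap_le hδ ht0 htη) hδ hδ1 ha1 haV touch card_touch_le
  rw [Fintype.card_fin] at key haV
  refine (measure_mono ?_).trans (key.trans (ENNReal.ofReal_le_ofReal (Real.exp_le_exp.2 ?_)))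
  · intro w hw
    by_contra hcon
    have hcon' : ∀ S : Finset (Fin n), S.card = a → ∑ e ∈ touch S, gap t (w e) ≤
        (1 + δ) * (a * n * ((1 + δ) * t / 2)) := by
      intro S hS
      by_contra hlt
      exact hcon ⟨S, hS, (not_le.1 hlt).le⟩
    obtain ⟨S, hS⟩ := hw
    have h1 := sum_touch_le_of_card (fun e => (gap_mem t (w e)).1) ha1
      (by rwa [Fintype.card_fin]) hcon' S
    have h2 : ∑ e ∈ touch S, gap t (w e) ≤
        (1 + δ) * (n * ((1 + δ) * t / 2)) * (S.card + (a - 1)) := by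
      refine le_of_mul_le_mul_left ?_ ha0
      linarith
    have h3 : ∑ e ∈ touch S, gap t (w e) ≤
        (1 + δ) * (n * ((1 + δ) * t / 2)) * (S.card + δ * ℓ) := by
      refine h2.trans ?_
      gcongr
    have h4 := mul_le_mul_of_nonneg_left h3 ht0.le
    refine absurd hS (not_lt.2 (h4.trans (le_of_eq ?_)))
    ring
  · have hlog' : Real.log (Real.exp 1 * n / a) ≤ δ ^ 2 * β / 8 * y := by
      refine le_trans (Real.log_le_log (by positivity) ?_) hlog
      have hl0 : 0 < δ * ℓ := by positivity
      calc Real.exp 1 * n / a ≤ Real.exp 1 * n / (δ * ℓ) := by gcongr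
        _ = Real.exp 1 / δ * (n / ℓ) := by field_simp
    have h1 : a * Real.log (Real.exp 1 * n / a) ≤ a * (δ ^ 2 * β / 8 * y) := by gcongr
    have h2 : a * (β * y) ≤ a * n * ((1 + δ) * t / 2) := by
      have : a * n * ((1 + δ) * t / 2) = (1 + δ) * (a * (n * t) / 2) := by ring
      rw [this, hnt]
      nlinarith [mul_pos ha0 (mul_pos hβ hy0)]
    -- The entropy takes at most half of the Chernoff exponent; the other half is at least of order
    -- ay ≥ δℓy ≥ δQ.
    have h3 : Q ≤ ℓ * y := by linarith
    have h4 : δ * Q ≤ a * y := by nlinarith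
    have h5 : δ ^ 2 / 4 * (a * (β * y)) ≤ δ ^ 2 / 4 * (a * n * ((1 + δ) * t / 2)) := by gcongr
    have h6 : δ ^ 2 * β / 8 * (δ * Q) ≤ δ ^ 2 * β / 8 * (a * y) := by gcongr
    nlinarith

lemma attachCost_nonneg {V : Type*} [Fintype V] [DecidableEq V]
    [Fintype (⊤ : SimpleGraph V).edgeSet] (w : (⊤ : SimpleGraph V).edgeSet → ℝ) (T S : Finset V)
    {τ : ℝ} (hτ : 0 ≤ τ) : 0 ≤ attachCost w T S τ :=
  Finset.sum_nonneg fun _ _ => (truncMin_mem _ hτ w).1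

lemma attachCost_empty {V : Type*} [Fintype V] [DecidableEq V]
    [Fintype (⊤ : SimpleGraph V).edgeSet] (w : (⊤ : SimpleGraph V).edgeSet → ℝ) (T : Finset V)
    {τ : ℝ} (hτ : 0 ≤ τ) : attachCost w T ∅ τ = T.card * τ := by
  have h : ∀ v : V, edgesTo ∅ v = ∅ := by
    intro v
    ext e
    simp [mem_edgesTo]
  simp [attachCost, h, truncMin, hτ]

/-- If sets of intermediate sizes are expensive to attach to, then so are all sets. -/
lemma exists_le_attachCost {V : Type*} [Fintype V] [DecidableEq V]
    [Fintype (⊤ : SimpleGraph V).edgeSet] {w : (⊤ : SimpleGraph V).edgeSet → ℝ} {T : Finset V}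
    {M K g l γ : ℝ} (hK : 0 < K) (hl : 0 < l) (hM0 : 0 < M) (hγ : 0 ≤ γ)
    (hg : 0 ≤ g) (hT : 1 ≤ T.card)
    (hMV : 2 * M ≤ Fintype.card V) (hgM : g ≤ l * (2 * M)) (hgl : g ^ 2 ≤ 4 * l * γ)
    (hgγ : g * M ≤ 2 * γ)
    (h : ∀ S : Finset V, 1 ≤ S.card → M / 4 ≤ S.card → (S.card : ℝ) ≤ 2 * M →
      γ / S.card ≤ attachCost w T S (K / S.card)) (S : Finset V) :
    ∃ τ, g - l * S.card ≤ attachCost w T S τ := by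
  rcases S.eq_empty_or_nonempty with rfl | hS
  · refine ⟨g, ?_⟩
    rw [attachCost_empty w T hg]
    have : (1 : ℝ) ≤ T.card := by exact_mod_cast hT
    simp only [Finset.card_empty, Nat.cast_zero, mul_zero, sub_zero]
    nlinarith
  have hS1 : 1 ≤ S.card := hS.card_pos
  have hS0 : (0 : ℝ) < S.card := by exact_mod_cast hS1
  by_cases hS2 : (S.card : ℝ) ≤ 2 * M
  · by_cases hS3 : M / 4 ≤ S.card
    · refine ⟨_, le_trans ?_ (h S hS1 hS3 hS2)⟩
      rw [le_div_iff₀ hS0]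
      -- When g² ≤ 4lγ, the line g - lx stays below the hyperbola γ/x.
      have h1 : 0 ≤ (2 * l * S.card - g) ^ 2 := sq_nonneg _
      have h2 : 4 * l * ((g - l * S.card) * S.card) ≤ 4 * l * γ := by nlinarith
      exact le_of_mul_le_mul_left h2 (by positivity)
    -- A small set is enlarged to size a = ⌈M/4⌉, which makes attaching cheaper. Since 1 ≤ |S| <
    -- M/4, a is less than M/2, and gM ≤ 2γ gives γ/a ≥ g.
    · rw [not_le] at hS3
      have hS1' : (1 : ℝ) ≤ S.card := by exact_mod_cast hS1
      set a := ⌈M / 4⌉₊ with ha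
      have ha1 : M / 4 ≤ a := Nat.le_ceil _
      have ha2 : (a : ℝ) < M / 4 + 1 := Nat.ceil_lt_add_one (by positivity)
      have haV : a ≤ Fintype.card V := by
        have : (a : ℝ) ≤ Fintype.card V := by linarith
        exact_mod_cast this
      have hSa : S.card ≤ a := by
        have : (S.card : ℝ) ≤ a := by linarith
        exact_mod_cast this
      obtain ⟨S', hSS', hS'⟩ := Finset.exists_superset_card_eq hSa haV
      have h1 := h S' (by omega) (by rw [hS']; exact ha1) (by rw [hS']; linarith)
      have hτ : 0 ≤ K / S'.card := by positivity
      refine ⟨_, le_trans ?_ (h1.trans (attachCost_anti w T hSS' hτ))⟩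
      rw [hS', le_div_iff₀ (by linarith)]
      have h3 : (g - l * S.card) * a ≤ g * a := by
        have : 0 ≤ l * S.card := by positivity
        nlinarith
      nlinarith
  -- For |S| > 2M the line g - l|S| is not positive.
  · refine ⟨0, le_trans ?_ (attachCost_nonneg w T S le_rfl)⟩
    rw [not_le] at hS2
    nlinarith

set_option maxHeartbeats 800000 in
/-- Uniformly over all sets `S` of vertices, attaching the terminals to `S` is expensive. -/
lemma exists_measure_attach_le {δ η : ℝ} (h : NearZero μ δ η) (hδ : 0 < δ) (hδ1 : δ ≤ 1 / 2) :
    ∃ Z c : ℝ, 0 < c ∧ ∀ (n m k ρ : ℕ) (z : ℝ), Params n m k ρ z → Z ≤ z →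
      (2 ≤ k ∨ μ = expMeasure 1) → ∀ T : Finset (Fin n), T.card = m →
      (Measure.pi fun _ : (⊤ : SimpleGraph (Fin n)).edgeSet => μ)
        {w | ¬ ∀ S : Finset (Fin n), ∃ τ, (1 - δ) ^ 4 * unit n m z -
          2 * (1 - δ) ^ 3 * z ^ 2 / n * S.card ≤ attachCost w T S τ} ≤
      ENNReal.ofReal (n * Real.exp (-(c * m))) := by
  -- Truncating attachment costs at K times their typical size 1/a loses only a factor 1 -
  -- e^(-(1+δ)K) ≥ 1 - δ.
  obtain ⟨K, hK0, hK⟩ : ∃ K : ℝ, 0 < K ∧ Real.exp (-K) ≤ δ := by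
    obtain ⟨X, hX1, hX⟩ := exists_pow_mul_exp_le 0 one_pos hδ
    refine ⟨X, by linarith, ?_⟩
    simpa using hX X le_rfl
  -- Half of a lower bound for the Chernoff exponent per terminal; the other half pays for the
  -- number of sets S.
  set c : ℝ := δ ^ 2 / 8 * ((1 - δ) ^ 2 / ((1 + δ) * K)) with hc
  have h1δ : 0 < 1 - δ := by linarith
  have hc0 : 0 < c := by positivity
  obtain ⟨Z, hZ⟩ := exists_mul_log_last_le hc0
  have hη := h.pos
  refine ⟨max Z (max ((4 / δ) ^ 2) (2 * K / η)), c, hc0, fun n m k ρ z hP hz hk T hT => ?_⟩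
  have hZ' := hZ n m k ρ z hP ((le_max_left _ _).trans hz)
  have hz1 : (4 / δ) ^ 2 ≤ z := (le_max_left _ _).trans ((le_max_right _ _).trans hz)
  have hz2 : 2 * K / η ≤ z := (le_max_right _ _).trans ((le_max_right _ _).trans hz)
  have hs := hP.unit_pos
  have hn := hP.n_pos
  have hm := hP.m_pos
  have hz0 := hP.z_pos
  have hs4 : 4 / δ ≤ unit n m z := (Real.le_sqrt_of_sq_le hz1).trans hP.sqrt_le_unit
  have hMs := hP.levelSize_last_mul
  have hM1 := hP.one_le_levelSize (k - 1)
  have husq := hP.unit_sq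
  have hmn : (m : ℝ) ≤ n := by exact_mod_cast hP.m_le_n
  have hMη : 2 ≤ k → 4 * K / levelSize k ρ z (k - 1) ≤ η := by
    intro hk
    have h1 := hP.pow_le_levelSize (show 1 ≤ k - 1 by omega)
    have h2 := hP.z_le_pow
    rw [div_le_iff₀ (by linarith)]
    rw [div_le_iff₀ hη] at hz2
    nlinarith
  set M := levelSize k ρ z (k - 1)
  set s := unit n m z
  have hM0 : 0 < M := by linarith
  have hMδ : 2 * M ≤ δ * m := by
    rw [div_le_iff₀ hδ] at hs4
    have : 4 * M ≤ (s * δ) * M := by nlinarith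
    nlinarith
  have hMm : 2 * M ≤ m := by nlinarith
  set I := (Finset.Icc 1 n).filter fun a : ℕ => M / 4 ≤ a ∧ (a : ℝ) ≤ 2 * M with hI
  let E : ℕ → Set ((⊤ : SimpleGraph (Fin n)).edgeSet → ℝ) := fun a =>
    {w | ∃ S : Finset (Fin n), S.card = a ∧ attachCost w T S (K / a) ≤
        (1 - δ) * ((1 - δ) * T.card * ((1 - Real.exp (-((1 + δ) * K))) / ((1 + δ) * K))) * (K / a)}
  have hexp : Real.exp (-((1 + δ) * K)) ≤ δ := by
    refine le_trans (Real.exp_le_exp.2 ?_) hK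
    nlinarith
  have hsub : {w : (⊤ : SimpleGraph (Fin n)).edgeSet → ℝ | ¬ ∀ S : Finset (Fin n), ∃ τ,
      (1 - δ) ^ 4 * s - 2 * (1 - δ) ^ 3 * z ^ 2 / n * S.card ≤ attachCost w T S τ} ⊆
      ⋃ a ∈ I, E a := by
    intro w hw
    by_contra hcon
    refine hw ?_
    simp only [Set.mem_iUnion, not_exists] at hcon
    refine exists_le_attachCost (M := M) (K := K) (γ := (1 - δ) ^ 4 * m) hK0 (by positivity) hM0
      (by positivity) (by positivity) (by rw [hT]; exact hP.one_le_m) ?_ ?_ ?_ ?_ ?_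
    · rw [Fintype.card_fin]
      linarith
    · have e : 2 * (1 - δ) ^ 3 * z ^ 2 / n * (2 * M) = (1 - δ) ^ 3 * s := by
        rw [div_mul_eq_mul_div, div_eq_iff hn.ne']
        have : M = 2 * m / s := by rw [eq_div_iff hs.ne']; exact hMs
        rw [this]
        field_simp
        linear_combination -husq
      rw [e, show (1 - δ) ^ 4 * s = (1 - δ) * ((1 - δ) ^ 3 * s) by ring]
      exact mul_le_of_le_one_left (by positivity) (by linarith)
    · have e : 4 * (2 * (1 - δ) ^ 3 * z ^ 2 / n) * ((1 - δ) ^ 4 * m) = (1 - δ) ^ 7 * s ^ 2 := by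
        have hu : s ^ 2 = 8 * m * z ^ 2 / n := by rw [eq_div_iff hn.ne']; exact husq
        rw [hu]
        ring
      rw [e, show ((1 - δ) ^ 4 * s) ^ 2 = (1 - δ) * ((1 - δ) ^ 7 * s ^ 2) by ring]
      exact mul_le_of_le_one_left (by positivity) (by linarith)
    · refine le_of_eq ?_
      linear_combination (1 - δ) ^ 4 * hMs
    · intro S hS1 hS2 hS3
      have hmem : S.card ∈ I := by
        refine Finset.mem_filter.2 ⟨Finset.mem_Icc.2 ⟨hS1, ?_⟩, hS2, hS3⟩
        have := S.card_le_univ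
        rwa [Fintype.card_fin] at this
      have hS0 : (0 : ℝ) < S.card := by exact_mod_cast hS1
      have h1 : ¬ attachCost w T S (K / S.card) ≤
        (1 - δ) * ((1 - δ) * T.card * ((1 - Real.exp (-((1 + δ) * K))) / ((1 + δ) * K))) *
          (K / S.card) := fun h => hcon S.card hmem ⟨S, rfl, h⟩
      refine le_trans ?_ (not_le.1 h1).le
      rw [hT]
      have e : (1 - δ) * ((1 - δ) * m * ((1 - Real.exp (-((1 + δ) * K))) / ((1 + δ) * K))) *
          (K / S.card) =
          (1 - δ) ^ 2 * ((1 - Real.exp (-((1 + δ) * K))) / (1 + δ)) * (m / S.card) := by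
        field_simp
      rw [e]
      have h2 : (1 - δ) * (1 - δ) ≤ (1 - Real.exp (-((1 + δ) * K))) / (1 + δ) := by
        rw [le_div_iff₀ (by linarith)]
        nlinarith
      calc (1 - δ) ^ 4 * m / S.card = (1 - δ) ^ 2 * ((1 - δ) * (1 - δ)) * (m / S.card) := by ring
        _ ≤ _ := by gcongr
  refine (measure_mono hsub).trans ((measure_biUnion_finset_le _ _).trans ?_)
  have hE : ∀ a ∈ I, (Measure.pi fun _ : (⊤ : SimpleGraph (Fin n)).edgeSet => μ) (E a) ≤
      ENNReal.ofReal (Real.exp (-(c * m))) := by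
    intro a ha
    obtain ⟨ha1, ha2, ha3⟩ := Finset.mem_filter.1 ha
    obtain ⟨ha1, han⟩ := Finset.mem_Icc.1 ha1
    have ha0 : (0 : ℝ) < a := by exact_mod_cast ha1
    refine (measure_exists_attachCost_le (T := T) (show 0 < 1 + δ by linarith) hK0 hδ
      (by linarith) ha1 (by rwa [Fintype.card_fin]) (by rw [hT]; linarith) ?_).trans
      (ENNReal.ofReal_le_ofReal (Real.exp_le_exp.2 ?_))
    · intro y hy hya
      -- For k ≥ 2 the level size M is large, so K/a lies in the range where the law is controlled.
      -- For k = 1 it does not, and the exact exponential tail is used.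
      rcases hk with hk | hk
      · refine h.tail_lower y hy (hya.trans (le_trans ?_ (hMη hk)))
        rw [div_le_div_iff₀ ha0 hM0]
        linarith [mul_le_mul_of_nonneg_left (show M ≤ 4 * a by linarith) hK0.le]
      · rw [hk, expMeasure_real_Ici hy.le]
        refine Real.exp_le_exp.2 ?_
        linarith [mul_pos hδ hy]
    · rw [Fintype.card_fin, hT]
      have h1 := hZ' a ha1 ha2 ha3 (by exact_mod_cast han)
      have h2 : c * m * 2 ≤ δ ^ 2 / 4 *
          ((1 - δ) * m * ((1 - Real.exp (-((1 + δ) * K))) / ((1 + δ) * K))) := by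
        calc c * m * 2 = δ ^ 2 / 4 * ((1 - δ) * m * ((1 - δ) / ((1 + δ) * K))) := by
              rw [hc]; ring
          _ ≤ _ := by gcongr
      linarith
  calc ∑ a ∈ I, (Measure.pi fun _ : (⊤ : SimpleGraph (Fin n)).edgeSet => μ) (E a)
      ≤ ∑ a ∈ I, ENNReal.ofReal (Real.exp (-(c * m))) := Finset.sum_le_sum hE
    _ = I.card * ENNReal.ofReal (Real.exp (-(c * m))) := by rw [Finset.sum_const, nsmul_eq_mul]
    _ ≤ n * ENNReal.ofReal (Real.exp (-(c * m))) := by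
        gcongr
        exact (Finset.card_filter_le _ _).trans (by simp)
    _ = _ := by rw [ENNReal.ofReal_mul hn.le, ENNReal.ofReal_natCast]

end Lower

/-! ### The lower bound in probability for all forests. -/

section Lower

variable {μ : Measure ℝ} [IsProbabilityMeasure μ]

/-- The slopes `2 β z ^ 2 ^ (k - i) / n` satisfy the constraints of the dual problem, hence give
a lower bound for the cost of all forests. -/
lemma le_forestCost_of_level_of_attach {δ : ℝ} (hδ : 0 < δ) (hδ1 : δ ≤ 1 / 2) {n m k ρ : ℕ}
    {z : ℝ} (hP : Params n m k ρ z) (hz : 1 / δ ≤ z)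
    {w : (⊤ : SimpleGraph (Fin n)).edgeSet → ℝ} (hw : ∀ e, 0 ≤ w e) {T : Finset (Fin n)}
    {t : ℕ → ℝ} (ht : ∀ i, t i = 2 * (1 - δ) ^ 3 * z ^ 2 ^ (k - i) / n)
    (hlevel : ∀ i, i + 1 < k → ∀ S : Finset (Fin n),
      t (i + 1) * ∑ e ∈ touch S, gap (t (i + 1)) (w e) ≤
        (1 + δ) ^ 2 * (n / 2) * t (i + 1) ^ 2 * (S.card + δ * levelSize k ρ z i))
    (hattach : ∀ S : Finset (Fin n), ∃ τ, (1 - δ) ^ 4 * unit n m z -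
          2 * (1 - δ) ^ 3 * z ^ 2 / n * S.card ≤ attachCost w T S τ)
    {R A : Finset (Fin n)} {lev : Fin n → ℕ} {par : Fin n → Fin n} (hR : R.card ≤ ρ)
    (hF : IsForest R k T A lev par) :
    (1 - ((2 : ℝ) ^ k)⁻¹ - 5 * δ) * unit n m z ≤ forestCost w R A par := by
  have hn := hP.n_pos
  have hz0 := hP.z_pos
  have hz2 := hP.two_le_z
  have hs := hP.unit_pos
  have hun := hP.unit_mul_n
  have hk := hP.one_le_k
  have h1δ : 0 < 1 - δ := by linarith
  have hβ1 : (1 - δ) ^ 3 ≤ 1 := pow_le_one₀ h1δ.le (by linarith)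
  obtain ⟨K, rfl⟩ : ∃ K, k = K + 1 := ⟨k - 1, by omega⟩
  set s := unit n m z
  set β := (1 - δ) ^ 3 with hβ
  have hβ0 : 0 < β := by positivity
  -- The factor β = (1-δ)³ in the prices absorbs the errors (1+δ)² and leaves a share δ for the
  -- slope of the attachment cost.
  have hδβ : (1 + δ) ^ 2 * β ≤ 1 - δ := by
    have : (1 + δ) ^ 2 * β = (1 - δ ^ 2) ^ 2 * (1 - δ) := by rw [hβ]; ring
    rw [this]
    refine mul_le_of_le_one_left h1δ.le (pow_le_one₀ ?_ ?_) <;> nlinarith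
  have hδβ2 : ((1 + δ) ^ 2 * β) * β ≤ 1 := by nlinarith
  have hx : ∀ i < K, z ^ 2 ^ (K + 1 - i) = (z ^ 2 ^ (K + 1 - (i + 1))) ^ 2 := by
    intro i hi
    rw [← pow_mul, ← pow_succ]
    congr 2
    omega
  have key := le_forestCost hw hF (t := t) (κ := fun i => (1 + δ) ^ 2 * (n / 2) * t i ^ 2)
    (σ := fun i => δ * levelSize (K + 1) ρ z (i - 1)) (g := (1 - δ) ^ 4 * s)
    (l := 2 * β * z ^ 2 / n) (fun i => by rw [ht]; positivity) ?_ hattach ?_ ?_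
  · refine le_trans ?_ key
    -- The unpaid price of the roots is the term 2^{-k} of the result.
    have h0 : t 0 * R.card ≤ s * ((2 : ℝ) ^ (K + 1))⁻¹ := by
      have hR' : (R.card : ℝ) ≤ ρ := by exact_mod_cast hR
      have ht0 : 0 ≤ t 0 := by rw [ht]; positivity
      calc t 0 * R.card ≤ t 0 * ρ := by gcongr
        _ = β * (s * ((2 : ℝ) ^ (K + 1))⁻¹) := by
          rw [ht, Nat.sub_zero]
          have : s = ρ * z ^ 2 ^ (K + 1) * 2 ^ (K + 1 + 1) / n := by
            rw [eq_div_iff hn.ne']; exact hun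
          rw [this, pow_succ (2 : ℝ) (K + 1)]
          field_simp
        _ ≤ _ := mul_le_of_le_one_left (by positivity) hβ1
    -- The errors δ · `levelSize` cost geometrically increasing amounts whose sum is at most δs.
    have hterm : ∀ i ∈ Finset.range K, (1 + δ) ^ 2 * (n / 2) * t (i + 1) ^ 2 *
        (δ * levelSize (K + 1) ρ z (i + 1 - 1)) ≤ δ * s * ((2 : ℝ) ^ (K + 1))⁻¹ * 2 ^ i := by
      intro i hi
      have hi' := Finset.mem_range.1 hi
      rw [Nat.add_sub_cancel, ht]
      have h1 := Params.levelSize_mul (K + 1) ρ z i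
      rw [hx i hi'] at h1
      have : s = ρ * z ^ 2 ^ (K + 1) * 2 ^ (K + 1 + 1) / n := by
        rw [eq_div_iff hn.ne']; exact hun
      set y := z ^ 2 ^ (K + 1 - (i + 1))
      calc (1 + δ) ^ 2 * ((n : ℝ) / 2) * (2 * β * y / n) ^ 2 * (δ * levelSize (K + 1) ρ z i)
          = ((1 + δ) ^ 2 * β * β) * (δ * (levelSize (K + 1) ρ z i * y ^ 2) * 2 / n) := by
            field_simp
        _ = ((1 + δ) ^ 2 * β * β) * (δ * s * ((2 : ℝ) ^ (K + 1))⁻¹ * 2 ^ i) := by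
            rw [h1, this, pow_succ (2 : ℝ) (K + 1)]
            field_simp
        _ ≤ _ := mul_le_of_le_one_left (by positivity) hδβ2
    have hsum := Finset.sum_le_sum hterm
    rw [← Finset.mul_sum] at hsum
    have hgeom : ∑ i ∈ Finset.range K, (2 : ℝ) ^ i ≤ 2 ^ (K + 1) := by
      rw [geom_sum_eq (by norm_num), pow_succ]
      have : (0 : ℝ) < 2 ^ K := by positivity
      norm_num
      linarith
    have hsum2 : δ * s * ((2 : ℝ) ^ (K + 1))⁻¹ * ∑ i ∈ Finset.range K, (2 : ℝ) ^ i ≤ δ * s := by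
      calc _ ≤ δ * s * ((2 : ℝ) ^ (K + 1))⁻¹ * 2 ^ (K + 1) := by gcongr
        _ = δ * s := by field_simp
    have hg : 1 - 4 * δ ≤ (1 - δ) ^ 4 := by
      have := one_add_mul_le_pow (show (-2 : ℝ) ≤ -δ by linarith) 4
      push_cast at this
      have e : (1 + -δ) ^ 4 = (1 - δ) ^ 4 := by ring
      rw [e] at this
      linarith
    have hg' := mul_le_mul_of_nonneg_right hg hs.le
    nlinarith
  · intro i hi S
    have := hlevel i (by omega) S
    simpa using this
  · intro i hi
    rw [ht i, ht (i + 1), hx i hi]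
    set y := z ^ 2 ^ (K + 1 - (i + 1)) with hy
    have hy2 : z ^ 2 ≤ y := by
      rw [hy]
      refine pow_le_pow_right₀ (by linarith) ?_
      calc 2 = 2 ^ 1 := by norm_num
        _ ≤ 2 ^ (K + 1 - (i + 1)) := Nat.pow_le_pow_right (by norm_num) (by omega)
    -- The slope l is a negligible part of the price t i for i < k - 1, as y ≥ z² and δz² ≥ 1.
    have h1 : z ^ 2 ≤ δ * y ^ 2 := by
      rw [div_le_iff₀ hδ] at hz
      have : 1 ≤ δ * z ^ 2 := by nlinarith
      calc z ^ 2 ≤ (δ * z ^ 2) * z ^ 2 := by nlinarith [sq_nonneg z]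
        _ = δ * (z ^ 2) ^ 2 := by ring
        _ ≤ _ := by gcongr
    calc (1 + δ) ^ 2 * ((n : ℝ) / 2) * (2 * β * y / n) ^ 2 + 2 * β * z ^ 2 / n
        = ((1 + δ) ^ 2 * β * y ^ 2 + z ^ 2) * (2 * β / n) := by field_simp
      _ ≤ ((1 - δ) * y ^ 2 + δ * y ^ 2) * (2 * β / n) := by gcongr
      _ = 2 * β * y ^ 2 / n := by ring
  · rw [ht]
    simp

/-- With high probability, all forests are expensive. -/
theorem exists_measure_forestCost_lt_le (hμ : HasDensityOneAtZero μ) {ε : ℝ} (hε : 0 < ε) :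
    ∃ Z : ℝ, ∀ (n m k ρ : ℕ) (z : ℝ), Params n m k ρ z → Z ≤ z →
      (2 ≤ k ∨ μ = expMeasure 1) → ∀ T : Finset (Fin n), T.card = m →
      (Measure.pi fun _ : (⊤ : SimpleGraph (Fin n)).edgeSet => μ)
        {w | (∀ e, 0 ≤ w e) ∧ ∃ R A lev par, R.card ≤ ρ ∧ IsForest R k T A lev par ∧
          forestCost w R A par < (1 - ((2 : ℝ) ^ k)⁻¹ - ε) * unit n m z} ≤ ENNReal.ofReal ε := by
  set δ := min (ε / 8) (1 / 2) with hδ'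
  have hδ : 0 < δ := by positivity
  have hδ1 : δ ≤ 1 / 2 := min_le_right _ _
  have hδε : 5 * δ ≤ ε := by linarith [min_le_left (ε / 8) (1 / 2)]
  have h1δ : 0 < 1 - δ := by linarith
  obtain ⟨η, -, hη⟩ := hμ.nearZero hδ (by linarith)
  obtain ⟨Z₁, c₁, hc₁, h₁⟩ := exists_measure_level_le hη hδ (by linarith)
    (show 0 < (1 - δ) ^ 3 by positivity) (pow_le_one₀ h1δ.le (by linarith))
  obtain ⟨Z₂, c₂, hc₂, h₂⟩ := exists_measure_attach_le hη hδ hδ1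
  obtain ⟨X₁, hX₁1, hX₁⟩ := exists_pow_mul_exp_le 1 hc₁ (half_pos hε)
  obtain ⟨X₂, hX₂1, hX₂⟩ := exists_pow_mul_exp_le 2 hc₂ (half_pos hε)
  refine ⟨max (max Z₁ Z₂) (max (1 / δ) (max X₁ (X₂ ^ 2))), fun n m k ρ z hP hz hk T hT => ?_⟩
  simp only [max_le_iff] at hz
  obtain ⟨⟨hz1, hz2⟩, hz3, hz4, hz5⟩ := hz
  set t : ℕ → ℝ := fun i => 2 * (1 - δ) ^ 3 * z ^ 2 ^ (k - i) / n with ht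
  set ν := Measure.pi fun _ : (⊤ : SimpleGraph (Fin n)).edgeSet => μ
  let E : ℕ → Set ((⊤ : SimpleGraph (Fin n)).edgeSet → ℝ) := fun i =>
    {w | ∃ S : Finset (Fin n), (1 + δ) ^ 2 * (n / 2) * t (i + 1) ^ 2 *
          (S.card + δ * levelSize k ρ z i) < t (i + 1) * ∑ e ∈ touch S, gap (t (i + 1)) (w e)}
  let F : Set ((⊤ : SimpleGraph (Fin n)).edgeSet → ℝ) :=
    {w | ¬ ∀ S : Finset (Fin n), ∃ τ, (1 - δ) ^ 4 * unit n m z -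
          2 * (1 - δ) ^ 3 * z ^ 2 / n * S.card ≤ attachCost w T S τ}
  have hsub : {w : (⊤ : SimpleGraph (Fin n)).edgeSet → ℝ | (∀ e, 0 ≤ w e) ∧ ∃ R A lev par,
      R.card ≤ ρ ∧ IsForest R k T A lev par ∧
      forestCost w R A par < (1 - ((2 : ℝ) ^ k)⁻¹ - ε) * unit n m z} ⊆
      (⋃ i ∈ Finset.range (k - 1), E i) ∪ F := by
    rintro w ⟨hw, R, A, lev, par, hR, hF, hlt⟩
    by_contra hcon
    simp only [Set.mem_union, Set.mem_iUnion, not_or, not_exists, Finset.mem_range] at hcon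
    obtain ⟨hE, hF'⟩ := hcon
    refine absurd hlt (not_lt.2 (le_trans ?_ (le_forestCost_of_level_of_attach hδ hδ1 hP hz3 hw
      (fun i => rfl) (fun i hi S => ?_) (not_not.1 hF') hR hF)))
    · have := hP.unit_pos
      gcongr
    · by_contra hS
      exact hE i (by omega) ⟨S, not_le.1 hS⟩
  have hQ := hP.k_le_pow
  have hzQ := hP.z_le_pow
  have hm := hP.m_pos
  refine (measure_mono hsub).trans ((measure_union_le _ _).trans ?_)
  have hE : ν (⋃ i ∈ Finset.range (k - 1), E i) ≤ ENNReal.ofReal (ε / 2) := by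
    refine (measure_biUnion_finset_le _ _).trans ?_
    calc ∑ i ∈ Finset.range (k - 1), ν (E i)
        ≤ ∑ i ∈ Finset.range (k - 1), ENNReal.ofReal (Real.exp (-(c₁ * z ^ 2 ^ (k - 1)))) :=
          Finset.sum_le_sum fun i hi => h₁ n m k ρ z hP hz1 i
            (by have := Finset.mem_range.1 hi; omega) _ rfl
      _ = ENNReal.ofReal ((k - 1 : ℕ) * Real.exp (-(c₁ * z ^ 2 ^ (k - 1)))) := by
          rw [Finset.sum_const, nsmul_eq_mul, Finset.card_range,
            ENNReal.ofReal_mul (Nat.cast_nonneg _), ENNReal.ofReal_natCast]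
      _ ≤ _ := by
          refine ENNReal.ofReal_le_ofReal (le_trans ?_ (hX₁ _ (hz4.trans hzQ)))
          rw [pow_one]
          gcongr
          refine le_trans ?_ hQ
          exact_mod_cast Nat.sub_le k 1
  have hF : ν F ≤ ENNReal.ofReal (ε / 2) := by
    refine (h₂ n m k ρ z hP hz2 hk T hT).trans (ENNReal.ofReal_le_ofReal ?_)
    -- Since n ≤ m², the bound n exp(-c₂m) is at most m² exp(-c₂m), small because m² ≥ z is large.
    have hXm : X₂ ≤ m := by
      have := hz5.trans hP.z_le_m_sq
      exact (pow_le_pow_iff_left₀ (by linarith) hm.le (by norm_num)).1 this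
    refine le_trans ?_ (hX₂ m hXm)
    gcongr
    exact hP.n_le_sq
  calc _ ≤ ENNReal.ofReal (ε / 2) + ENNReal.ofReal (ε / 2) := add_le_add hE hF
    _ = ENNReal.ofReal ε := by
      rw [← ENNReal.ofReal_add (by positivity) (by positivity)]
      congr 1
      ring

end Lower

/-! ### Weights cut off at a level. -/

section Cap

/-- The nonnegative extended real number `x`, cut off at `B`. -/
noncomputable def cap (B : ENNReal) (x : ℝ) : ENNReal := min (ENNReal.ofReal x) B

lemma measurable_cap (B : ENNReal) : Measurable (cap B) :=
  ENNReal.measurable_ofReal.min measurable_const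

lemma cap_le (B : ENNReal) (x : ℝ) : cap B x ≤ ENNReal.ofReal x := min_le_left _ _

lemma min_add_le_add_min (a b B : ENNReal) : min (a + b) B ≤ min a B + min b B := by
  rcases le_total a B with ha | ha
  · rcases le_total b B with hb | hb
    · rw [min_eq_left ha, min_eq_left hb]
      exact min_le_left _ _
    · rw [min_eq_right hb]
      exact (min_le_right _ _).trans le_add_self
  · rw [min_eq_right ha]
    exact (min_le_right _ _).trans le_self_add

/-- Subadditivity allows the cut-off cost of a tree to be bounded edge by edge, whether B is finite
(no moment assumption) or ⊤ (expectations). -/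
lemma cap_add_le (B : ENNReal) (x y : ℝ) : cap B (x + y) ≤ cap B x + cap B y :=
  (min_le_min ENNReal.ofReal_add_le le_rfl).trans (min_add_le_add_min _ _ _)

lemma cap_sum_le {κ : Type*} (B : ENNReal) (s : Finset κ) (f : κ → ℝ) :
    cap B (∑ i ∈ s, f i) ≤ ∑ i ∈ s, cap B (f i) := by
  classical
  induction s using Finset.induction_on with
  | empty => simp [cap]
  | insert a s ha ih =>
    rw [Finset.sum_insert ha, Finset.sum_insert ha]
    exact (cap_add_le _ _ _).trans (add_le_add le_rfl ih)

end Cap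

/-! ### Growing forests level by level. -/

section Forest

variable {V : Type*} [Fintype V] [DecidableEq V] [Fintype (⊤ : SimpleGraph V).edgeSet]
  {R T A B : Finset V} {k : ℕ} {lev : V → ℕ} {par : V → V}

lemma isForest_root (R : Finset V) (par : V → V) : IsForest R 0 ∅ R (fun _ => 0) par where
  lev_eq_zero v hv := by simp [hv]
  root_mem := Finset.Subset.refl _
  par_mem v hv hvR := absurd hv hvR
  lev_par v hv hvR := absurd hv hvR
  lev_le _ _ := le_rfl
  terminal_mem := Finset.empty_subset _

lemma IsForest.mono {k' : ℕ} {T' : Finset V} (hF : IsForest R k T A lev par) (hk : k ≤ k')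
    (hT : T' ⊆ A) : IsForest R k' T' A lev par :=
  { hF with lev_le := fun v hv => (hF.lev_le v hv).trans hk, terminal_mem := hT }

/-- New leaves can be attached to the last level of a forest. -/
lemma IsForest.extend (hF : IsForest R k T A lev par) (hAB : Disjoint A B) {g : V → V}
    (hg : ∀ v ∈ B, g v ∈ A ∧ lev (g v) = k) :
    IsForest R (k + 1) (A ∪ B) (A ∪ B) (fun v => if v ∈ B then k + 1 else lev v)
      (fun v => if v ∈ B then g v else par v) where
  lev_eq_zero v hv := by
    by_cases hB : v ∈ B
    · have : v ∉ R := fun h => Finset.disjoint_left.1 hAB (hF.root_mem h) hB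
      simp [hB, this]
    · simp only [hB, if_false]
      exact hF.lev_eq_zero v ((Finset.mem_union.1 hv).resolve_right hB)
  root_mem := hF.root_mem.trans Finset.subset_union_left
  par_mem v hv hvR := by
    by_cases hB : v ∈ B
    · simp only [hB, if_true]
      exact Finset.mem_union_left _ (hg v hB).1
    · simp only [hB, if_false]
      exact Finset.mem_union_left _ (hF.par_mem v ((Finset.mem_union.1 hv).resolve_right hB) hvR)
  lev_par v hv hvR := by
    have hA : ∀ u ∈ A, u ∉ B := fun u hu => Finset.disjoint_left.1 hAB hu
    by_cases hB : v ∈ B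
    · simp only [hB, if_true]
      rw [if_neg (hA _ (hg v hB).1), (hg v hB).2]
    · have hvA := (Finset.mem_union.1 hv).resolve_right hB
      simp only [hB, if_false]
      rw [if_neg (hA _ (hF.par_mem v hvA hvR)), hF.lev_par v hvA hvR]
  lev_le v hv := by
    by_cases hB : v ∈ B
    · simp [hB]
    · simp only [hB, if_false]
      exact (hF.lev_le v ((Finset.mem_union.1 hv).resolve_right hB)).trans (Nat.le_succ _)
  terminal_mem := Finset.Subset.refl _

lemma forestCost_extend (w : (⊤ : SimpleGraph V).edgeSet → ℝ) (hRA : R ⊆ A) (hAB : Disjoint A B)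
    (g : V → V) :
    forestCost w R (A ∪ B) (fun v => if v ∈ B then g v else par v) =
      forestCost w R A par + ∑ v ∈ B, edgeWt w (g v) v := by
  unfold forestCost
  have e : (A ∪ B) \ R = (A \ R) ∪ B := by
    rw [Finset.union_sdiff_distrib, Finset.sdiff_eq_self_of_disjoint
      (Finset.disjoint_of_subset_right hRA hAB.symm)]
  rw [e, Finset.sum_union (Finset.disjoint_of_subset_left Finset.sdiff_subset hAB)]
  congr 1
  · refine Finset.sum_congr rfl fun v hv => ?_
    simp only [if_neg (Finset.disjoint_left.1 hAB (Finset.mem_sdiff.1 hv).1)]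
  · refine Finset.sum_congr rfl fun v hv => ?_
    simp only [if_pos hv]

lemma forestCost_root (w : (⊤ : SimpleGraph V).edgeSet → ℝ) (par : V → V) :
    forestCost w R R par = 0 := by
  simp [forestCost]

/-- All terminals can be attached to a single vertex `r'` off the root. -/
lemma exists_isForest_star (w : (⊤ : SimpleGraph V).edgeSet → ℝ) (hk : 2 ≤ k) {r r' : V}
    (hr : r ∈ R) (hr' : r' ∉ R) (T : Finset V) :
    ∃ A lev par, IsForest R k T A lev par ∧
      forestCost w R A par = edgeWt w r r' + ∑ v ∈ T \ (R ∪ {r'}), edgeWt w r' v := by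
  have h0 := isForest_root R id
  have hd0 : Disjoint R {r'} := by simpa using hr'
  have h1 := h0.extend hd0 (g := fun _ => r) fun v _ => ⟨hr, rfl⟩
  have hd1 : Disjoint (R ∪ {r'}) (T \ (R ∪ {r'})) := Finset.disjoint_sdiff
  have h2 := h1.extend hd1 (g := fun _ => r') fun v _ => ⟨by simp, by simp⟩
  refine ⟨_, _, _, h2.mono hk ?_, ?_⟩
  · rw [Finset.union_sdiff_self_eq_union]
    exact Finset.subset_union_right
  · rw [forestCost_extend w (Finset.subset_union_left) hd1,
      forestCost_extend w (Finset.Subset.refl _) hd0, forestCost_root]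
    simp

end Forest

/-! ### Exploration of the graph and its independence of the unexplored edges. -/

section Explore

variable {V : Type*} [Fintype V] [DecidableEq V] [Fintype (⊤ : SimpleGraph V).edgeSet]

/-- The vertices, other than `r`, which are joined to `A` by an edge of weight less than `t`. -/
noncomputable def hits (r : V) (A : Finset V) (t : ℝ) (w : (⊤ : SimpleGraph V).edgeSet → ℝ) :
    Finset V :=
  open Classical in
  Finset.univ.filter fun v => (v ≠ r ∧ v ∉ A) ∧ ∃ e ∈ edgesTo A v, w e < t

/-- A subset of `H` of size `N`, if there is one. -/
noncomputable def pick (N : ℕ) (H : Finset V) : Finset V :=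
  if h : N ≤ H.card then (Finset.exists_subset_card_eq h).choose else ∅

lemma pick_subset (N : ℕ) (H : Finset V) : pick N H ⊆ H := by
  unfold pick
  split_ifs with h
  · exact (Finset.exists_subset_card_eq h).choose_spec.1
  · exact Finset.empty_subset _

lemma card_pick {N : ℕ} {H : Finset V} (h : N ≤ H.card) : (pick N H).card = N := by
  unfold pick
  rw [dif_pos h]
  exact (Finset.exists_subset_card_eq h).choose_spec.2

/-- The exploration of the graph from `R`, avoiding `r`: the last level, and all levels. -/
noncomputable def explore (r : V) (R : Finset V) (N : ℕ → ℕ) (t : ℕ → ℝ)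
    (w : (⊤ : SimpleGraph V).edgeSet → ℝ) : ℕ → Finset V × Finset V
  | 0 => (R, R)
  | i + 1 =>
    (pick (N (i + 1)) (hits r (explore r R N t w i).1 (t (i + 1)) w \ (explore r R N t w i).2),
      (explore r R N t w i).2 ∪
        pick (N (i + 1)) (hits r (explore r R N t w i).1 (t (i + 1)) w \ (explore r R N t w i).2))

variable {r : V} {R T : Finset V} {N : ℕ → ℕ} {t : ℕ → ℝ}
  {w w' : (⊤ : SimpleGraph V).edgeSet → ℝ}

lemma mem_hits {A : Finset V} {t : ℝ} {v : V} :
    v ∈ hits r A t w ↔ (v ≠ r ∧ v ∉ A) ∧ ∃ e ∈ edgesTo A v, w e < t := by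
  simp [hits]

lemma edgesTo_subset_away {A : Finset V} (hA : r ∉ A) {v : V} (hvr : v ≠ r) (hv : v ∉ A) :
    edgesTo A v ⊆ touch A \ touch {r} := by
  intro e he
  obtain ⟨u, h, hu, rfl⟩ := exists_of_mem_edgesTo hv he
  refine Finset.mem_sdiff.2 ⟨mkEdge_mem_touch h hu, fun hr => ?_⟩
  obtain ⟨x, hx, hxe⟩ := mem_touch.1 hr
  rw [Finset.mem_singleton] at hx
  subst hx
  rcases Sym2.mem_iff.1 hxe with rfl | rfl
  · exact hA hu
  · exact hvr rfl

lemma hits_congr {A : Finset V} (hA : r ∉ A) (t : ℝ)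
    (h : ∀ e ∈ touch A \ touch {r}, w e = w' e) : hits r A t w = hits r A t w' := by
  ext v
  rw [mem_hits, mem_hits]
  refine and_congr_right fun hv => exists_congr fun e => and_congr_right fun he => ?_
  rw [h e (edgesTo_subset_away hA hv.1 hv.2 he)]

lemma explore_fst_subset (i : ℕ) : (explore r R N t w i).1 ⊆ (explore r R N t w i).2 := by
  cases i with
  | zero => exact Finset.Subset.refl _
  | succ i => exact Finset.subset_union_right

lemma notMem_explore (hr : r ∉ R) (i : ℕ) : r ∉ (explore r R N t w i).2 := by
  induction i with
  | zero => exact hr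
  | succ i ih =>
    intro h
    rcases Finset.mem_union.1 h with h | h
    · exact ih h
    · have := pick_subset _ _ h
      exact (mem_hits.1 (Finset.mem_sdiff.1 this).1).1.1 rfl

lemma disjoint_explore (i : ℕ) :
    Disjoint (explore r R N t w i).2 (explore r R N t w (i + 1)).1 :=
  Finset.disjoint_right.2 fun _ hv => (Finset.mem_sdiff.1 (pick_subset _ _ hv)).2

/-- The exploration reveals only edges at the previous levels. -/
lemma explore_congr (hr : r ∉ R) (i : ℕ)
    (h : ∀ e ∈ touch ((explore r R N t w i).2 \ (explore r R N t w i).1) \ touch {r},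
      w e = w' e) : explore r R N t w' i = explore r R N t w i := by
  induction i with
  | zero => rfl
  | succ i ih =>
    -- The edges examined in step i + 1 touch level i, and removing the new level leaves exactly
    -- what was explored after step i.
    have hU : (explore r R N t w (i + 1)).2 \ (explore r R N t w (i + 1)).1 =
        (explore r R N t w i).2 := by
      rw [show (explore r R N t w (i + 1)).2 = (explore r R N t w i).2 ∪
        (explore r R N t w (i + 1)).1 from rfl, Finset.union_sdiff_cancel_right
          (disjoint_explore i)]
    rw [hU] at h
    have h1 := ih fun e he => h e (Finset.sdiff_subset_sdiff (touch_mono Finset.sdiff_subset)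
      (Finset.Subset.refl _) he)
    have h2 : hits r (explore r R N t w i).1 (t (i + 1)) w' =
        hits r (explore r R N t w i).1 (t (i + 1)) w :=
      (hits_congr (fun hr' => notMem_explore hr i (explore_fst_subset i hr')) _ fun e he =>
        h e (Finset.sdiff_subset_sdiff (touch_mono (explore_fst_subset i))
          (Finset.Subset.refl _) he)).symm
    simp only [explore, h1, h2]

lemma measurableSet_hits (A H : Finset V) (t : ℝ) :
    MeasurableSet {w : (⊤ : SimpleGraph V).edgeSet → ℝ | hits r A t w = H} := by
  have : {w : (⊤ : SimpleGraph V).edgeSet → ℝ | hits r A t w = H} =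
      ⋂ v : V, {w | ((v ≠ r ∧ v ∉ A) ∧ ∃ e ∈ edgesTo A v, w e < t) ↔ v ∈ H} := by
    ext w
    simp [Finset.ext_iff, mem_hits]
  rw [this]
  refine MeasurableSet.iInter fun v => ?_
  have h1 : MeasurableSet {w : (⊤ : SimpleGraph V).edgeSet → ℝ |
      (v ≠ r ∧ v ∉ A) ∧ ∃ e ∈ edgesTo A v, w e < t} := by
    have : {w : (⊤ : SimpleGraph V).edgeSet → ℝ | ∃ e ∈ edgesTo A v, w e < t} =
        ⋃ e ∈ edgesTo A v, {w | w e < t} := by ext; simp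
    have h2 : MeasurableSet {w : (⊤ : SimpleGraph V).edgeSet → ℝ | ∃ e ∈ edgesTo A v, w e < t} := by
      rw [this]
      exact Finset.measurableSet_biUnion _ fun e _ =>
        measurableSet_lt (measurable_pi_apply e) measurable_const
    exact (MeasurableSet.const _).inter h2
  exact h1.iff (MeasurableSet.const _)

lemma measurableSet_explore (i : ℕ) (p : Finset V × Finset V) :
    MeasurableSet {w | explore r R N t w i = p} := by
  induction i generalizing p with
  | zero => exact MeasurableSet.const ((R, R) = p)
  | succ i ih =>
    -- Splitting over the finitely many outcomes of the previous step and of the new hits avoids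
    -- measurability questions about `pick`.
    have : {w | explore r R N t w (i + 1) = p} = ⋃ q : Finset V × Finset V, ⋃ H : Finset V,
        ({w | explore r R N t w i = q} ∩ {w | hits r q.1 (t (i + 1)) w = H}) ∩
          {_w | (pick (N (i + 1)) (H \ q.2), q.2 ∪ pick (N (i + 1)) (H \ q.2)) = p} := by
      ext w
      simp only [Set.mem_iUnion]
      constructor
      · intro h
        exact ⟨_, _, ⟨rfl, rfl⟩, h⟩
      · rintro ⟨q, H, ⟨h1, h2⟩, h3⟩
        have h1' : explore r R N t w i = q := h1
        have h2' : hits r q.1 (t (i + 1)) w = H := h2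
        subst h1'
        subst h2'
        exact h3
    rw [this]
    exact MeasurableSet.iUnion fun q => MeasurableSet.iUnion fun H =>
      ((ih q).inter (measurableSet_hits _ _ _)).inter (MeasurableSet.const _)

variable {μ : Measure ℝ} [IsProbabilityMeasure μ]

/-- The explored part of the graph is independent of the rest. -/
lemma lintegral_explore_le (hr : r ∉ R) (i : ℕ)
    {G : Finset V × Finset V → ((⊤ : SimpleGraph V).edgeSet → ℝ) → ENNReal}
    (hG : ∀ p, Measurable (G p)) {D : Finset V × Finset V → Set (⊤ : SimpleGraph V).edgeSet}
    (hGD : ∀ p, DependsOn (G p) (D p))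
    (hD : ∀ p, Disjoint (touch (p.2 \ p.1) \ touch {r} : Set (⊤ : SimpleGraph V).edgeSet) (D p))
    {c : ENNReal}
    (hc : ∀ p, ∫⁻ w, G p w ∂(Measure.pi fun _ : (⊤ : SimpleGraph V).edgeSet => μ) ≤ c) :
    ∫⁻ w, G (explore r R N t w i) w
      ∂(Measure.pi fun _ : (⊤ : SimpleGraph V).edgeSet => μ) ≤ c := by
  -- Split according to the outcome p: the event of this outcome is determined by edges away from D
  -- p, hence independent of G p, and the probabilities of the outcomes sum to 1.
  let I : Finset V × Finset V → ((⊤ : SimpleGraph V).edgeSet → ℝ) → ENNReal := fun p =>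
    {w | explore r R N t w i = p}.indicator 1
  have hI : ∀ p, Measurable (I p) := fun p => measurable_one.indicator (measurableSet_explore i p)
  have hsum : ∀ (H : Finset V × Finset V → ENNReal) w,
      ∑ p, I p w * H p = H (explore r R N t w i) := by
    intro H w
    rw [Finset.sum_eq_single (explore r R N t w i)]
    · simp [I]
    · intro p _ hp
      have : w ∉ {w | explore r R N t w i = p} := fun h => hp (Eq.symm h)
      simp only [I, Set.indicator_of_notMem this, zero_mul]
    · simp
  have hID : ∀ p, DependsOn (I p)
      (touch (p.2 \ p.1) \ touch {r} : Set (⊤ : SimpleGraph V).edgeSet) := by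
    intro p x y hxy
    simp only [I, Set.indicator]
    congr 1
    refine propext ⟨fun h => ?_, fun h => ?_⟩
    · have h' : explore r R N t x i = p := h
      have := explore_congr (w := x) (w' := y) hr i (N := N) (t := t) fun e he => by
        rw [h'] at he
        exact hxy e (by simpa using he)
      exact this.trans h'
    · have h' : explore r R N t y i = p := h
      have := explore_congr (w := y) (w' := x) hr i (N := N) (t := t) fun e he => by
        rw [h'] at he
        exact (hxy e (by simpa using he)).symm
      exact this.trans h'
  calc _ = ∫⁻ w, ∑ p, I p w * G p w
        ∂(Measure.pi fun _ : (⊤ : SimpleGraph V).edgeSet => μ) := by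
        refine lintegral_congr fun w => ?_
        rw [hsum (fun p => G p w)]
    _ = ∑ p, (∫⁻ w, I p w ∂(Measure.pi fun _ : (⊤ : SimpleGraph V).edgeSet => μ)) *
        ∫⁻ w, G p w ∂(Measure.pi fun _ : (⊤ : SimpleGraph V).edgeSet => μ) := by
        rw [lintegral_finsetSum _ (f := fun p w => I p w * G p w) fun p _ => (hI p).mul (hG p)]
        exact Finset.sum_congr rfl fun p _ =>
          lintegral_mul_of_dependsOn_disjoint (hI p) (hG p) (hID p) (hGD p) (hD p)
    _ ≤ ∑ p, (∫⁻ w, I p w ∂(Measure.pi fun _ : (⊤ : SimpleGraph V).edgeSet => μ)) * c := by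
        gcongr with p
        exact hc p
    _ = ∫⁻ w, ∑ p, I p w * c ∂(Measure.pi fun _ : (⊤ : SimpleGraph V).edgeSet => μ) := by
        rw [lintegral_finsetSum _ fun p _ => (hI p).mul_const c]
        exact Finset.sum_congr rfl fun p _ => (lintegral_mul_const c (hI p)).symm
    _ = c := by
        simp_rw [hsum (fun _ => c)]
        simp

/-- Distinct vertices outside `A` are joined to `A` by distinct edges. -/
lemma sum_edgeWt_le_sum_below (hw : ∀ e, 0 ≤ w e) {A B : Finset V} {t : ℝ} (hrA : r ∉ A)
    (hB : ∀ v ∈ B, v ≠ r ∧ v ∉ A) {g : V → V}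
    (hg : ∀ v ∈ B, g v ∈ A ∧ edgeWt w (g v) v < t) :
    ∑ v ∈ B, edgeWt w (g v) v ≤ t * ∑ e ∈ touch A \ touch {r}, below t (w e) := by
  have hne : ∀ v ∈ B, g v ≠ v := fun v hv h => (hB v hv).2 (h ▸ (hg v hv).1)
  rw [Finset.mul_sum]
  have hpos : ∀ e : (⊤ : SimpleGraph V).edgeSet, w e < t → t * below t (w e) = w e := by
    intro e he
    have ht : 0 < t := (hw e).trans_lt he
    unfold below
    rw [Set.indicator_of_mem (show w e ∈ Set.Ico 0 t from ⟨hw e, he⟩)]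
    field_simp
  calc ∑ v ∈ B, edgeWt w (g v) v
      = ∑ v ∈ B.attach, t * below t (w (mkEdge (hne v.1 v.2))) := by
        rw [← Finset.sum_attach]
        refine Finset.sum_congr rfl fun v _ => ?_
        have h2 := (hg v.1 v.2).2
        rw [edgeWt_of_ne w (hne v.1 v.2)] at h2 ⊢
        rw [hpos _ h2]
    _ = ∑ e ∈ B.attach.image fun v => mkEdge (hne v.1 v.2), t * below t (w e) := by
        rw [Finset.sum_image]
        intro u _ v _ huv
        have huv' : mkEdge (hne u.1 u.2) = mkEdge (hne v.1 v.2) := huv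
        rw [mkEdge_eq_iff] at huv'
        rcases huv' with h | h
        · exact Subtype.ext h.2
        · exact absurd (h.1 ▸ (hg u.1 u.2).1) (hB v.1 v.2).2
    _ ≤ _ := by
        refine Finset.sum_le_sum_of_subset_of_nonneg ?_ ?_
        · intro e he
          obtain ⟨v, -, rfl⟩ := Finset.mem_image.1 he
          exact edgesTo_subset_away hrA (hB v.1 v.2).1 (hB v.1 v.2).2
            (mkEdge_mem_edgesTo _ (hg v.1 v.2).1)
        · intro e _ _
          unfold below
          by_cases h : w e ∈ Set.Ico 0 t
          · rw [Set.indicator_of_mem h]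
            have : 0 < t := h.1.trans_lt h.2
            have := h.1
            positivity
          · rw [Set.indicator_of_notMem h, mul_zero]

lemma card_explore_fst {K : ℕ} (h0 : R.card = N 0)
    (hhits : ∀ i < K, (explore r R N t w i).1.card = N i →
      N (i + 1) ≤ (hits r (explore r R N t w i).1 (t (i + 1)) w \ (explore r R N t w i).2).card)
    {i : ℕ} (hi : i ≤ K) : (explore r R N t w i).1.card = N i := by
  induction i with
  | zero => exact h0
  | succ i ih => exact card_pick (hhits i (by omega) (ih (by omega)))

/-- A successful exploration yields a cheap forest. -/
lemma exists_isForest_explore (hw : ∀ e, 0 ≤ w e) (hr : r ∉ R) {K : ℕ} {C : ℕ → ℝ}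
    (hcost : ∀ i < K, t (i + 1) *
      ∑ e ∈ touch (explore r R N t w i).1 \ touch {r}, below (t (i + 1)) (w e) ≤ C i)
    {i : ℕ} (hi : i ≤ K) :
    ∃ lev par, IsForest R i ∅ (explore r R N t w i).2 lev par ∧
      (∀ v ∈ (explore r R N t w i).1, lev v = i) ∧
      forestCost w R (explore r R N t w i).2 par ≤ ∑ j ∈ Finset.range i, C j := by
  induction i with
  | zero =>
    refine ⟨_, id, isForest_root R id, fun _ _ => rfl, ?_⟩
    rw [show (explore r R N t w 0).2 = R from rfl, forestCost_root]
    simp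
  | succ i ih =>
    obtain ⟨lev, par, hF, hlev, hc⟩ := ih (by omega)
    set B := (explore r R N t w (i + 1)).1 with hB
    have hBmem : ∀ v ∈ B, v ∈ hits r (explore r R N t w i).1 (t (i + 1)) w := fun v hv =>
      (Finset.mem_sdiff.1 (pick_subset _ _ hv)).1
    have hg : ∀ v, ∃ u, v ∈ B → u ∈ (explore r R N t w i).1 ∧ edgeWt w u v < t (i + 1) := by
      intro v
      by_cases hv : v ∈ B
      · obtain ⟨h1, e, he, het⟩ := mem_hits.1 (hBmem v hv)
        obtain ⟨u, h, hu, rfl⟩ := exists_of_mem_edgesTo h1.2 he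
        exact ⟨u, fun _ => ⟨hu, by rwa [edgeWt_of_ne w h]⟩⟩
      · exact ⟨v, fun h => absurd h hv⟩
    choose g hg using hg
    have hd : Disjoint (explore r R N t w i).2 B := disjoint_explore i
    have hrA : r ∉ (explore r R N t w i).1 := fun h => notMem_explore hr i (explore_fst_subset i h)
    have hF' := hF.extend hd (g := g) fun v hv =>
      ⟨explore_fst_subset i (hg v hv).1, hlev _ (hg v hv).1⟩
    refine ⟨_, _, hF'.mono le_rfl (Finset.empty_subset _), fun v hv => by simp [hv], ?_⟩
    rw [show (explore r R N t w (i + 1)).2 = (explore r R N t w i).2 ∪ B from rfl,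
      forestCost_extend w hF.root_mem hd, Finset.sum_range_succ]
    refine add_le_add hc (le_trans ?_ (hcost i (by omega)))
    exact sum_edgeWt_le_sum_below hw hrA (fun v hv => (mem_hits.1 (hBmem v hv)).1) hg

/-- The cost of attaching the vertex `v` to `A`, in terms of cut off weights. -/
noncomputable def attachCap (B : ENNReal) (η : ℝ) (A : Finset V) (v : V)
    (w : (⊤ : SimpleGraph V).edgeSet → ℝ) : ENNReal :=
  ENNReal.ofReal (truncMin (edgesTo A v) η w) +
    {w | ∀ e ∈ edgesTo A v, η ≤ w e}.indicator (fun w => ⨅ e ∈ edgesTo A v, cap B (w e)) w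

/-- If some edge to A is lighter than η, the truncated minimum is attained at an edge; otherwise the
least cut-off weight is the second summand. -/
lemma exists_cap_le_attachCap (hw : ∀ e, 0 ≤ w e) (B : ENNReal) (η : ℝ) {A : Finset V}
    (hA : A.Nonempty) {v : V} (hv : v ∉ A) :
    ∃ u ∈ A, cap B (edgeWt w u v) ≤ attachCap B η A v w := by
  have hne : (edgesTo A v).Nonempty := by
    rw [← Finset.card_pos, card_edgesTo hv]
    exact hA.card_pos
  suffices ∃ e ∈ edgesTo A v, cap B (w e) ≤ attachCap B η A v w by
    obtain ⟨e, he, hle⟩ := this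
    obtain ⟨u, h, hu, rfl⟩ := exists_of_mem_edgesTo hv he
    exact ⟨u, hu, by rwa [edgeWt_of_ne w h]⟩
  by_cases h : ∀ e ∈ edgesTo A v, η ≤ w e
  · obtain ⟨e, he, hmin⟩ := (edgesTo A v).exists_min_image (fun e => cap B (w e)) hne
    refine ⟨e, he, le_trans ?_ le_add_self⟩
    rw [Set.indicator_of_mem (show w ∈ {w : (⊤ : SimpleGraph V).edgeSet → ℝ |
      ∀ e ∈ edgesTo A v, η ≤ w e} from h)]
    exact le_iInf₂ hmin
  · push Not at h
    obtain ⟨e, he, heq⟩ := exists_eq_truncMin (fun e _ => hw e) h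
    refine ⟨e, he, le_trans ?_ le_self_add⟩
    rw [← heq]
    exact cap_le _ _

end Explore

/-! ### The event that some level of an exploration could fail. -/

section LevelBad

variable {V : Type*} [Fintype V] [DecidableEq V] [Fintype (⊤ : SimpleGraph V).edgeSet]
  {μ : Measure ℝ} [IsProbabilityMeasure μ]

/-- Some set of `a` vertices avoiding `r` is joined to few vertices by edges of weight less than
`t`, or the total weight of these edges is large. -/
def levelBad (r : V) (a : ℕ) (h c t : ℝ) : Set ((⊤ : SimpleGraph V).edgeSet → ℝ) :=
  {w | ∃ S : Finset V, (S.card = a ∧ r ∉ S) ∧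
    ((hits r S t w).card < h ∨ c < t * ∑ e ∈ touch S \ touch {r}, below t (w e))}

/-- The edges at r play no role in a failure, which makes the fallback star at r independent of it.
-/
lemma levelBad_congr {r : V} {a : ℕ} {h c t : ℝ} {x y : (⊤ : SimpleGraph V).edgeSet → ℝ}
    (hxy : ∀ e, e ∉ touch {r} → x e = y e) (hx : x ∈ levelBad r a h c t) :
    y ∈ levelBad r a h c t := by
  obtain ⟨S, hS, hor⟩ := hx
  have h1 : ∀ e ∈ touch S \ touch {r}, x e = y e := fun e he => hxy e (Finset.mem_sdiff.1 he).2
  refine ⟨S, hS, ?_⟩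
  have h2 : ∑ e ∈ touch S \ touch {r}, below t (x e) = ∑ e ∈ touch S \ touch {r}, below t (y e) :=
    Finset.sum_congr rfl fun e he => by rw [h1 e he]
  rwa [← hits_congr hS.2 t h1, ← h2]

lemma measurableSet_levelBad (r : V) (a : ℕ) (h c t : ℝ) :
    MeasurableSet (levelBad r a h c t) := by
  have : levelBad r a h c t = ⋃ S : Finset V, {_w | S.card = a ∧ r ∉ S} ∩
      ((⋃ H : Finset V, {w | hits r S t w = H} ∩ {_w | (H.card : ℝ) < h}) ∪
        {w | c < t * ∑ e ∈ touch S \ touch {r}, below t (w e)}) := by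
    ext w
    simp only [levelBad, Set.mem_iUnion, Set.mem_inter_iff, Set.mem_union, Set.mem_ofPred_eq,
      exists_eq_left']
  rw [this]
  refine MeasurableSet.iUnion fun S => (MeasurableSet.const _).inter (MeasurableSet.union ?_ ?_)
  · exact MeasurableSet.iUnion fun H => (measurableSet_hits S H t).inter (MeasurableSet.const _)
  · refine measurableSet_lt measurable_const (Measurable.const_mul ?_ _)
    exact Finset.measurable_sum _ fun e _ => (measurable_below t).comp (measurable_pi_apply e)

/-- With y = (1-δ)at ≤ δ one has 1 - e^(-y) ≥ y - y² ≥ (1-δ)y. -/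
lemma NearZero.le_one_sub_pow {δ η t : ℝ} (h : NearZero μ δ η) (hδ : 0 < δ) (hδ1 : δ < 1)
    (ht : 0 < t) (htη : t ≤ η) {a : ℕ} (hat : a * t ≤ δ) :
    (1 - δ) ^ 2 * (a * t) ≤ 1 - μ.real (Set.Ici t) ^ a := by
  have h1 : μ.real (Set.Ici t) ^ a ≤ Real.exp (-((1 - δ) * (a * t))) := by
    calc μ.real (Set.Ici t) ^ a ≤ Real.exp (-((1 - δ) * t)) ^ a := by
          gcongr
          exact h.tail_upper t ht htη
      _ = _ := by
          rw [← Real.exp_nat_mul]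
          congr 1
          ring
  set y := (1 - δ) * (a * t) with hy
  have hat0 : 0 ≤ a * t := by positivity
  have hy0 : 0 ≤ y := mul_nonneg (by linarith) hat0
  have hyδ : y ≤ δ := by nlinarith
  have h2 : Real.exp (-y) ≤ 1 - y + y ^ 2 := by
    have := Real.abs_exp_sub_one_sub_id_le (x := -y) (by rw [abs_neg, abs_of_nonneg hy0]; linarith)
    have := (abs_le.1 this).2
    nlinarith
  nlinarith

/-- Vertices outside S ∪ {r} are hit independently, since they use disjoint sets of edges, and each
is missed with probability P(W ≥ t)^|S|. -/
lemma measure_hits_card_lt_le {δ η t : ℝ} (h : NearZero μ δ η) (hδ : 0 < δ) (hδ1 : δ < 1)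
    (ht : 0 < t) (htη : t ≤ η) {r : V} {S : Finset V} (hat : S.card * t ≤ δ)
    (hcard : S.card + 1 ≤ δ * Fintype.card V) :
    (Measure.pi fun _ : (⊤ : SimpleGraph V).edgeSet => μ)
      {w | ((hits r S t w).card : ℝ) <
        (1 - δ) * ((1 - δ) * Fintype.card V * ((1 - δ) ^ 2 * (S.card * t)))} ≤
      ENNReal.ofReal (Real.exp (-(δ ^ 2 / 4 *
        ((1 - δ) * Fintype.card V * ((1 - δ) ^ 2 * (S.card * t)))))) := by
  classical
  set B : Finset V := Finset.univ.filter fun v => v ≠ r ∧ v ∉ S with hB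
  let H : V → Set ((⊤ : SimpleGraph V).edgeSet → ℝ) := fun v => {w | ∀ e ∈ edgesTo S v, t ≤ w e}
  have hHm : ∀ v, MeasurableSet (H v) := by
    intro v
    have : H v = ⋂ e ∈ edgesTo S v, {w | t ≤ w e} := by ext; simp [H]
    rw [this]
    exact Finset.measurableSet_biInter _ fun e _ =>
      measurableSet_le measurable_const (measurable_pi_apply e)
  have hsum : ∀ w, ∑ v ∈ B, (H v)ᶜ.indicator (fun _ => (1 : ℝ)) w = (hits r S t w).card := by
    intro w
    have e : hits r S t w = B.filter fun v => w ∈ (H v)ᶜ := by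
      ext v
      simp only [mem_hits, hB, Finset.mem_filter, Finset.mem_univ, true_and, H,
        Set.mem_compl_iff, Set.mem_ofPred_eq]
      push Not
      rfl
    rw [e, Finset.card_filter]
    push_cast
    exact Finset.sum_congr rfl fun v _ => by simp only [Set.indicator]
  have h1δ : 0 < 1 - δ := by linarith
  refine (measure_mono ?_).trans (chernoff_lower (μ := μ)
    (X := fun v => (H v)ᶜ.indicator fun _ => (1 : ℝ))
    (D := fun v => (edgesTo S v : Set (⊤ : SimpleGraph V).edgeSet)) B
    (fun v _ => measurable_const.indicator (hHm v).compl) (fun v _ w => ?_) ?_ ?_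
    (p := (1 - δ) ^ 2 * (S.card * t)) ?_ ?_ ?_ hδ hδ1.le)
  · intro w hw
    have hw' : ((hits r S t w).card : ℝ) <
        (1 - δ) * ((1 - δ) * Fintype.card V * ((1 - δ) ^ 2 * (S.card * t))) := hw
    rw [← hsum w] at hw'
    exact hw'.le
  · by_cases hw : w ∈ (H v)ᶜ
    · rw [Set.indicator_of_mem hw]; simp
    · rw [Set.indicator_of_notMem hw]; simp
  · intro v _ x y hxy
    have : x ∈ (H v)ᶜ ↔ y ∈ (H v)ᶜ := by
      refine not_congr (forall₂_congr fun e he => ?_)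
      rw [hxy e he]
    by_cases hx : x ∈ (H v)ᶜ
    · rw [Set.indicator_of_mem hx, Set.indicator_of_mem (this.1 hx)]
    · rw [Set.indicator_of_notMem hx, Set.indicator_of_notMem (fun hy => hx (this.2 hy))]
  · exact fun u hu v hv huv => disjoint_edgesTo (Finset.mem_filter.1 hu).2.2
      (Finset.mem_filter.1 hv).2.2 huv
  · intro v hv
    have hvS := (Finset.mem_filter.1 hv).2.2
    have e : (Measure.pi fun _ : (⊤ : SimpleGraph V).edgeSet => μ).real (H v) =
        μ.real (Set.Ici t) ^ S.card := by
      simp only [H, Measure.real, pi_forall_le, card_edgesTo hvS, ENNReal.toReal_pow]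
    rw [integral_indicator_const _ (hHm v).compl, probReal_compl_eq_one_sub (hHm v), e, smul_eq_mul,
      mul_one]
    exact h.le_one_sub_pow hδ hδ1 ht htη hat
  · have hp : 0 ≤ (1 - δ) ^ 2 * (S.card * t) := by positivity
    refine mul_le_mul_of_nonneg_right ?_ hp
    have h1 : Fintype.card V ≤ B.card + (S.card + 1) := by
      have h2 : (Finset.univ : Finset V) ⊆ B ∪ insert r S := by
        intro v _
        by_cases hv : v ∈ insert r S
        · exact Finset.mem_union_right _ hv
        · refine Finset.mem_union_left _ (Finset.mem_filter.2 ⟨Finset.mem_univ _, ?_⟩)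
          simpa using hv
      exact (Finset.card_le_card h2).trans ((Finset.card_union_le _ _).trans
        (Nat.add_le_add_left (Finset.card_insert_le _ _) _))
    have h2 : (Fintype.card V : ℝ) ≤ B.card + (S.card + 1) := by exact_mod_cast h1
    linarith
  · positivity

set_option maxHeartbeats 1000000 in
-- The union bound covers every possible level, so no conditioning on the exploration is needed. In
-- the cost bound, one factor 1 + δ is for rounding the level size and one for Chernoff, 1 + 3δ is
-- for the mean of `below`, and κ² is for the enlarged threshold.
lemma exists_measure_levelBad_le {δ η κ : ℝ} (h : NearZero μ δ η) (h0 : ∀ᵐ x ∂μ, 0 ≤ x)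
    (hδ : 0 < δ) (hδ1 : δ ≤ 1 / 10) (hκ : κ * (1 - δ) ^ 4 = 1 + 2 * δ) :
    ∃ Z : ℝ, ∀ (n m k ρ : ℕ) (z : ℝ), Params n m k ρ z → Z ≤ z → ∀ i, i + 1 < k →
      ∀ (r : Fin n) (t : ℝ), t = 2 * κ * z ^ 2 ^ (k - (i + 1)) / n →
      (Measure.pi fun _ : (⊤ : SimpleGraph (Fin n)).edgeSet => μ)
        (levelBad r ⌈levelSize k ρ z i⌉₊ ((1 + 2 * δ) * levelSize k ρ z (i + 1))
          ((1 + δ) ^ 2 * (1 + 3 * δ) * κ ^ 2 * (2 ^ i * unit n m z / 2 ^ k)) t) ≤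
      ENNReal.ofReal (2 * Real.exp (-(δ ^ 2 / 8 * z ^ 2 ^ (k - 1)))) := by
  obtain ⟨Z, hZ⟩ := exists_log_levelSize_le (show 0 < δ ^ 2 / 16 by positivity)
    (Real.exp_pos 1)
  have hη := h.pos
  have h1δ : 0 < 1 - δ := by linarith
  have hκ1 : 1 ≤ κ := by
    have : (1 - δ) ^ 4 ≤ 1 := pow_le_one₀ h1δ.le (by linarith)
    by_contra hlt
    have h2 : 0 < (1 - δ) ^ 4 := by positivity
    nlinarith
  have hκ2 : κ ≤ 2 := by
    have h1 : (1 : ℝ) - 4 * δ ≤ (1 - δ) ^ 4 := by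
      have := one_add_mul_le_pow (show (-2 : ℝ) ≤ -δ by linarith) 4
      push_cast at this
      have e : (1 + -δ) ^ 4 = (1 - δ) ^ 4 := by ring
      rw [e] at this
      linarith
    have h2 : (0.6 : ℝ) ≤ (1 - δ) ^ 4 := by linarith
    nlinarith
  refine ⟨max (max Z ((4 / η) ^ 2)) (max ((8 / δ) ^ 2) (1 / δ)),
    fun n m k ρ z hP hz i hi r t ht => ?_⟩
  simp only [max_le_iff] at hz
  obtain ⟨⟨hz1, hz2⟩, hz3, hz4⟩ := hz
  have hlog := hZ n m k ρ z hP hz1 i hi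
  have hz0 := hP.z_pos
  have hn := hP.n_pos
  have hzn := hP.z_le_n
  have hu := hP.unit_pos
  have hun := hP.unit_mul_n
  have hsη : 4 / η ≤ √z := Real.le_sqrt_of_sq_le hz2
  have hsδ : 8 / δ ≤ unit n m z := (Real.le_sqrt_of_sq_le hz3).trans hP.sqrt_le_unit
  have hsq0 : 0 < √z := Real.sqrt_pos.2 hz0
  have hslope := hP.slope_le hi
  have hsucc := hP.levelSize_succ (show i < k by omega)
  have hpow := hP.pow_le_levelSize (show 1 ≤ i + 1 by omega)
  have hzpow := hP.z_le_pow
  have hl1 := hP.one_le_levelSize i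
  have hlast := hP.levelSize_last_le (show i + 1 ≤ k - 1 by omega)
  have hmul := Params.levelSize_mul k ρ z i
  have hceil : (⌈levelSize k ρ z i⌉₊ : ℝ) ≤ (1 + δ) * levelSize k ρ z i := by
    rcases Nat.eq_zero_or_pos i with rfl | hi0
    · rw [Params.levelSize_zero, Nat.ceil_natCast]
      linarith [mul_pos hδ hP.rho_pos]
    · have h1 := hP.pow_le_levelSize (show 1 ≤ i from hi0)
      have h2 := Nat.ceil_lt_add_one (show 0 ≤ levelSize k ρ z i by linarith)
      rw [div_le_iff₀ hδ] at hz4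
      have h3 : z * δ ≤ levelSize k ρ z i * δ :=
        mul_le_mul_of_nonneg_right (by linarith) hδ.le
      linarith
  have hxx : z ^ 2 ^ (k - i) = (z ^ 2 ^ (k - (i + 1))) ^ 2 := by
    rw [← pow_mul, ← pow_succ]
    congr 2
    omega
  rw [hxx] at hmul
  set ℓ := levelSize k ρ z i with hℓ
  set ℓ' := levelSize k ρ z (i + 1) with hℓ'
  set Q := z ^ 2 ^ (k - 1)
  set y := z ^ 2 ^ (k - (i + 1)) with hy
  have hy0 : 0 < y := by positivity
  have hy1 : 1 ≤ y := one_le_pow₀ (by linarith [hP.two_le_z])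
  have ht0 : 0 < t := by rw [ht]; positivity
  have hnt : n * t = 2 * κ * y := by rw [ht]; field_simp
  have htη : t ≤ η := by
    calc t = κ * (2 * y / n) := by rw [ht]; ring
      _ ≤ 2 * (2 / √z) := by gcongr
      _ ≤ η := by
        rw [div_le_iff₀ hη] at hsη
        rw [mul_div_assoc', div_le_iff₀ hsq0]
        linarith
  have hℓ'n : 4 * ℓ' ≤ δ * n := by
    have : 2 / unit n m z ≤ δ / 4 := by
      rw [div_le_iff₀ hδ] at hsδ
      rw [div_le_iff₀ hu]
      linarith
    linarith [mul_le_mul_of_nonneg_left this hn.le]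
  have hℓ0 : 0 < ℓ := by linarith
  have hℓℓ' : 2 * ℓ ≤ ℓ' := by
    rw [hsucc]
    linarith [mul_le_mul_of_nonneg_left hy1 hℓ0.le]
  set a := ⌈ℓ⌉₊ with ha
  have haℓ : ℓ ≤ a := Nat.le_ceil _
  have ha1 : 1 ≤ a := Nat.one_le_ceil_iff.2 hℓ0
  have ha0 : (0 : ℝ) < a := by exact_mod_cast ha1
  have ha2 : (a : ℝ) ≤ 2 * ℓ :=
    hceil.trans (mul_le_mul_of_nonneg_right (by linarith) hℓ0.le)
  have hcard : (a : ℝ) + 1 ≤ δ * n := by linarith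
  have haV : a ≤ Fintype.card (Fin n) := by
    rw [Fintype.card_fin]
    have : (a : ℝ) ≤ n := by linarith [mul_le_of_le_one_left hn.le (show δ ≤ 1 by linarith)]
    exact_mod_cast this
  have hat : a * t ≤ δ := by
    have h1 : n * (a * t) ≤ n * δ := by
      calc n * (a * t) = a * (2 * κ * y) := by rw [← hnt]; ring
        _ ≤ 2 * ℓ * (2 * 2 * y) := by gcongr
        _ = 4 * ℓ' := by rw [hsucc]; ring
        _ ≤ n * δ := by linarith
    exact le_of_mul_le_mul_left h1 hn
  have hlog' : a * Real.log (Real.exp 1 * n / a) ≤ δ ^ 2 / 16 * ℓ' := by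
    have h1 : Real.log (Real.exp 1 * n / a) ≤ δ ^ 2 / 16 * y := by
      refine le_trans (Real.log_le_log (by positivity) ?_) hlog
      rw [mul_div_assoc]
      gcongr
    calc a * Real.log (Real.exp 1 * n / a) ≤ a * (δ ^ 2 / 16 * y) := by gcongr
      _ ≤ 2 * ℓ * (δ ^ 2 / 16 * y) := by gcongr
      _ = δ ^ 2 / 16 * ℓ' := by rw [hsucc]; ring
  -- The four lost factors 1 - δ are two for the hitting probability, one for the excluded vertices
  -- and one for Chernoff; κ compensates for them.
  have hlam : (1 + 2 * δ) * ℓ' ≤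
      (1 - δ) * ((1 - δ) * n * ((1 - δ) ^ 2 * (a * t))) := by
    calc (1 + 2 * δ) * ℓ' = κ * (1 - δ) ^ 4 * (ℓ * (2 * y)) := by rw [hκ, hsucc]
      _ = (1 - δ) ^ 4 * (ℓ * (2 * κ * y)) := by ring
      _ ≤ (1 - δ) ^ 4 * (a * (2 * κ * y)) := by gcongr
      _ = _ := by rw [← hnt]; ring
  have hlam' : ℓ' ≤ (1 - δ) * n * ((1 - δ) ^ 2 * (a * t)) := by
    refine le_trans ?_ (hlam.trans (mul_le_of_le_one_left (by positivity) (by linarith)))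
    linarith [mul_pos hδ (show 0 < ℓ' by linarith)]
  have key1 := measure_exists_card_eq_le (V := Fin n)
    (Measure.pi fun _ : (⊤ : SimpleGraph (Fin n)).edgeSet => μ) ha1 haV
    (fun S w => ((hits r S t w).card : ℝ) < (1 + 2 * δ) * ℓ') (q := δ ^ 2 / 4 * ℓ') (by
      intro S hS
      have h2 := measure_hits_card_lt_le h hδ (by linarith) ht0 htη (r := r) (S := S)
        (by rwa [hS]) (by rwa [hS, Fintype.card_fin])
      rw [hS, Fintype.card_fin] at h2
      refine (measure_mono fun w hw => ?_).trans (h2.trans (ENNReal.ofReal_le_ofReal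
        (Real.exp_le_exp.2 (neg_le_neg ?_))))
      · have hw' : ((hits r S t w).card : ℝ) < (1 + 2 * δ) * ℓ' := hw
        exact hw'.trans_le hlam
      · gcongr)
  have key2 := measure_exists_edge_sum_ge (V := Fin n) (μ := μ) (measurable_below t)
    (below_mem ht0) (h.integral_below_le (by linarith) h0 ht0 htη) hδ (by linarith) ha1 haV
    (fun S => touch S \ touch {r})
    (fun S => (Finset.card_le_card Finset.sdiff_subset).trans (card_touch_le S))
  rw [Fintype.card_fin] at key1 key2
  have hant : ℓ' / 2 ≤ a * n * ((1 + 3 * δ) * t / 2) := by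
    calc ℓ' / 2 = ℓ * y := by rw [hsucc]; ring
      _ ≤ a * (κ * y) := by
        have : y ≤ κ * y := le_mul_of_one_le_left hy0.le hκ1
        gcongr
      _ = a * (n * t) / 2 := by rw [hnt]; ring
      _ ≤ (1 + 3 * δ) * (a * (n * t) / 2) := by
        refine le_mul_of_one_le_left (by positivity) (by linarith)
      _ = _ := by ring
  have hsub : levelBad r a ((1 + 2 * δ) * ℓ')
      ((1 + δ) ^ 2 * (1 + 3 * δ) * κ ^ 2 * (2 ^ i * unit n m z / 2 ^ k)) t ⊆
      {w | ∃ S : Finset (Fin n), S.card = a ∧ ((hits r S t w).card : ℝ) < (1 + 2 * δ) * ℓ'} ∪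
      {w | ∃ S : Finset (Fin n), S.card = a ∧ (1 + δ) * (a * n * ((1 + 3 * δ) * t / 2)) ≤
        ∑ e ∈ touch S \ touch {r}, below t (w e)} := by
    rintro w ⟨S, hS, hor⟩
    rcases hor with hor | hor
    · exact Or.inl ⟨S, hS.1, hor⟩
    · refine Or.inr ⟨S, hS.1, ?_⟩
      have hC : t * ((1 + δ) * (a * n * ((1 + 3 * δ) * t / 2))) ≤
          (1 + δ) ^ 2 * (1 + 3 * δ) * κ ^ 2 * (2 ^ i * unit n m z / 2 ^ k) := by
        have hun' : unit n m z = ρ * z ^ 2 ^ k * 2 ^ (k + 1) / n := by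
          rw [eq_div_iff hn.ne']; exact hun
        calc t * ((1 + δ) * (a * n * ((1 + 3 * δ) * t / 2)))
            = (1 + δ) * (1 + 3 * δ) * (a * (n * t * (n * t)) / (2 * n)) := by
              field_simp
          _ = (1 + δ) * (1 + 3 * δ) * κ ^ 2 * (a * y ^ 2 * 2 / n) := by
              rw [hnt]
              field_simp
          _ ≤ (1 + δ) * (1 + 3 * δ) * κ ^ 2 * (((1 + δ) * ℓ) * y ^ 2 * 2 / n) := by gcongr
          _ = (1 + δ) ^ 2 * (1 + 3 * δ) * κ ^ 2 * ((ℓ * y ^ 2) * 2 / n) := by ring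
          _ = _ := by
              rw [hmul, hun', pow_succ (2 : ℝ) k]
              field_simp
      exact (lt_of_mul_lt_mul_left (hC.trans_lt hor) ht0.le).le
  refine (measure_mono hsub).trans ((measure_union_le _ _).trans ?_)
  rw [two_mul (Real.exp _), ENNReal.ofReal_add (Real.exp_pos _).le (Real.exp_pos _).le]
  have hδ2 : 0 < δ ^ 2 := by positivity
  have hQ2 : δ ^ 2 / 16 * (2 * Q) ≤ δ ^ 2 / 16 * ℓ' := by gcongr
  refine add_le_add (key1.trans (ENNReal.ofReal_le_ofReal (Real.exp_le_exp.2 ?_)))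
    (key2.trans (ENNReal.ofReal_le_ofReal (Real.exp_le_exp.2 ?_)))
  · linarith [mul_pos hδ2 (show 0 < ℓ' by linarith)]
  · have : δ ^ 2 / 4 * (ℓ' / 2) ≤ δ ^ 2 / 4 * (a * n * ((1 + 3 * δ) * t / 2)) := by gcongr
    linarith

end LevelBad

/-! ### Costs of the explored forest, of attaching the terminals and of the fallback. -/

section Explore

variable {V : Type*} [Fintype V] [DecidableEq V] [Fintype (⊤ : SimpleGraph V).edgeSet]
  {μ : Measure ℝ} [IsProbabilityMeasure μ] {r : V} {R T : Finset V} {N : ℕ → ℕ} {t : ℕ → ℝ}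
  {w : (⊤ : SimpleGraph V).edgeSet → ℝ}

lemma measurable_attachCap (B : ENNReal) (η : ℝ) (A : Finset V) (v : V) :
    Measurable (attachCap B η A v) := by
  unfold attachCap
  refine (measurable_truncMin _ _).ennreal_ofReal.add (Measurable.indicator ?_ ?_)
  · exact Measurable.iInf fun e => Measurable.iInf fun _ =>
      (measurable_cap B).comp (measurable_pi_apply e)
  · have : {w : (⊤ : SimpleGraph V).edgeSet → ℝ | ∀ e ∈ edgesTo A v, η ≤ w e} =
        ⋂ e ∈ edgesTo A v, {w | η ≤ w e} := by ext; simp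
    rw [this]
    exact Finset.measurableSet_biInter _ fun e _ =>
      measurableSet_le measurable_const (measurable_pi_apply e)

lemma dependsOn_attachCap (B : ENNReal) (η : ℝ) (A : Finset V) (v : V) :
    DependsOn (attachCap B η A v) (edgesTo A v : Set (⊤ : SimpleGraph V).edgeSet) := by
  intro x y hxy
  have h1 : (∀ e ∈ edgesTo A v, η ≤ x e) ↔ ∀ e ∈ edgesTo A v, η ≤ y e :=
    forall₂_congr fun e he => by rw [hxy e he]
  have h2 : (⨅ e ∈ edgesTo A v, cap B (x e)) = ⨅ e ∈ edgesTo A v, cap B (y e) :=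
    iInf_congr fun e => iInf_congr fun he => by rw [hxy e he]
  simp only [attachCap, Set.indicator, Set.mem_ofPred_eq, dependsOn_truncMin _ _ hxy, h1, h2]

lemma lintegral_attachCap_le {δ η : ℝ} (h : NearZero μ δ η) (hδ : δ < 1) (B : ENNReal)
    {A : Finset V} (hA : A.Nonempty) {v : V} (hv : v ∉ A) :
    ∫⁻ w, attachCap B η A v w ∂(Measure.pi fun _ : (⊤ : SimpleGraph V).edgeSet => μ) ≤
      ENNReal.ofReal (1 / ((1 - δ) * A.card)) +
        (∫⁻ x, cap B x ∂μ) * μ (Set.Ici η) ^ (A.card - 1) := by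
  have hc := card_edgesTo hv
  have hne : (edgesTo A v).Nonempty := by
    rw [← Finset.card_pos, hc]
    exact hA.card_pos
  unfold attachCap
  rw [lintegral_add_left (measurable_truncMin _ _).ennreal_ofReal, ← hc]
  exact add_le_add (lintegral_truncMin_le hne h.pos.le (by linarith) h.tail_upper)
    (lintegral_iInf_le hne (measurable_cap B) η)

/-- An edge from the last level to an unexplored vertex meets no earlier level, so it has not been
examined. -/
lemma disjoint_touch_edgesTo {A U : Finset V} {v : V} (hv : v ∉ A ∪ U) :
    Disjoint (touch (U \ A) \ touch {r} : Set (⊤ : SimpleGraph V).edgeSet) (edgesTo A v) := by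
  rw [Finset.mem_union, not_or] at hv
  refine Set.disjoint_left.2 fun e he he' => ?_
  obtain ⟨u, h, hu, rfl⟩ := exists_of_mem_edgesTo hv.1 he'
  obtain ⟨x, hx, hxe⟩ := mem_touch.1 he.1
  rw [Finset.mem_sdiff] at hx
  rcases Sym2.mem_iff.1 hxe with rfl | rfl
  · exact hx.2 hu
  · exact hv.2 hx.1

/-- The expected cost of attaching the terminals to the last level of the exploration. -/
lemma lintegral_sum_attachCap_le {δ η : ℝ} (h : NearZero μ δ η) (hδ : δ < 1) (B : ENNReal)
    (hr : r ∉ R) (T : Finset V) {a : ℕ} (ha : 1 ≤ a) (i : ℕ) :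
    ∫⁻ w, (if (explore r R N t w i).1.card = a then
        ∑ v ∈ T \ ((explore r R N t w i).1 ∪ (explore r R N t w i).2),
          attachCap B η (explore r R N t w i).1 v w else 0)
      ∂(Measure.pi fun _ : (⊤ : SimpleGraph V).edgeSet => μ) ≤
      T.card * (ENNReal.ofReal (1 / ((1 - δ) * a)) +
        (∫⁻ x, cap B x ∂μ) * μ (Set.Ici η) ^ (a - 1)) := by
  refine lintegral_explore_le hr i (G := fun p w => if p.1.card = a then
      ∑ v ∈ T \ (p.1 ∪ p.2), attachCap B η p.1 v w else 0)
    (D := fun p => ⋃ v ∈ T \ (p.1 ∪ p.2), (edgesTo p.1 v : Set (⊤ : SimpleGraph V).edgeSet))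
    (fun p => ?_) (fun p => ?_) (fun p => ?_) (fun p => ?_)
  · split_ifs
    · exact Finset.measurable_sum _ fun v _ => measurable_attachCap _ _ _ _
    · exact measurable_const
  · intro x y hxy
    simp only
    split_ifs
    · refine Finset.sum_congr rfl fun v hv => dependsOn_attachCap _ _ _ _ fun e he => hxy e ?_
      exact Set.mem_biUnion (show v ∈ (T \ (p.1 ∪ p.2) : Finset V) from hv) he
    · rfl
  · refine Set.disjoint_iUnion₂_right.2 fun v hv => ?_
    exact disjoint_touch_edgesTo (Finset.mem_sdiff.1 hv).2
  · split_ifs with hp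
    · rw [lintegral_finsetSum _ fun v _ => measurable_attachCap _ _ _ _]
      have hne : p.1.Nonempty := by
        rw [← Finset.card_pos]
        omega
      calc _ ≤ ∑ v ∈ T \ (p.1 ∪ p.2), (ENNReal.ofReal (1 / ((1 - δ) * a)) +
            (∫⁻ x, cap B x ∂μ) * μ (Set.Ici η) ^ (a - 1)) := by
            refine Finset.sum_le_sum fun v hv => ?_
            rw [← hp]
            refine lintegral_attachCap_le h hδ B hne fun hvA => ?_
            exact (Finset.mem_sdiff.1 hv).2 (Finset.mem_union_left _ hvA)
        _ ≤ _ := by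
            rw [Finset.sum_const, nsmul_eq_mul]
            gcongr
            exact Finset.sdiff_subset
    · simp

lemma card_pick_le (N : ℕ) (H : Finset V) : (pick N H).card ≤ N := by
  by_cases h : N ≤ H.card
  · exact (card_pick h).le
  · simp [pick, h]

/-- The cost of the forest obtained from a successful exploration, in terms of cut off weights. -/
lemma min_le_of_explore (hw : ∀ e, 0 ≤ w e) (hr : r ∉ R) {K : ℕ} {C : ℕ → ℝ} (h0 : R.card = N 0)
    (hN : 1 ≤ N K)
    (hhits : ∀ i < K, (explore r R N t w i).1.card = N i →
      N (i + 1) ≤ (hits r (explore r R N t w i).1 (t (i + 1)) w \ (explore r R N t w i).2).card)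
    (hcost : ∀ i < K, (explore r R N t w i).1.card = N i → t (i + 1) *
      ∑ e ∈ touch (explore r R N t w i).1 \ touch {r}, below (t (i + 1)) (w e) ≤ C i)
    {F B : ENNReal} (η : ℝ)
    (hF : ∀ A lev par, IsForest R (K + 1) T A lev par → F ≤ ENNReal.ofReal (forestCost w R A par)) :
    min F B ≤ ENNReal.ofReal (∑ i ∈ Finset.range K, C i) +
      if (explore r R N t w K).1.card = N K then
        ∑ v ∈ T \ ((explore r R N t w K).1 ∪ (explore r R N t w K).2),
          attachCap B η (explore r R N t w K).1 v w else 0 := by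
  have hcard := fun i (hi : i ≤ K) => card_explore_fst h0 hhits hi
  obtain ⟨lev, par, hFor, hlev, hc⟩ := exists_isForest_explore hw hr (C := C)
    (fun i hi => hcost i hi (hcard i hi.le)) le_rfl
  have hsub := explore_fst_subset (r := r) (R := R) (N := N) (t := t) (w := w) K
  rw [if_pos (hcard K le_rfl), Finset.union_eq_right.2 hsub]
  set A := (explore r R N t w K).1
  set U := (explore r R N t w K).2
  have hAne : A.Nonempty := by
    rw [← Finset.card_pos, hcard K le_rfl]
    omega
  have hg : ∀ v, ∃ u ∈ A, v ∉ A → cap B (edgeWt w u v) ≤ attachCap B η A v w := by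
    intro v
    by_cases hv : v ∈ A
    · exact ⟨v, hv, fun h => absurd hv h⟩
    · obtain ⟨u, hu, h⟩ := exists_cap_le_attachCap hw B η hAne hv
      exact ⟨u, hu, fun _ => h⟩
  choose g hgA hg using hg
  have hd : Disjoint U (T \ U) := Finset.disjoint_sdiff
  have hF' := hFor.extend hd (g := g) fun v _ => ⟨hsub (hgA v), hlev _ (hgA v)⟩
  have hFle := hF _ _ _ (hF'.mono le_rfl (by
    rw [Finset.union_sdiff_self_eq_union]
    exact Finset.subset_union_right))
  rw [forestCost_extend w hFor.root_mem hd] at hFle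
  calc min F B ≤ cap B (forestCost w R U par + ∑ v ∈ T \ U, edgeWt w (g v) v) :=
        min_le_min hFle le_rfl
    _ ≤ cap B (forestCost w R U par) + ∑ v ∈ T \ U, cap B (edgeWt w (g v) v) :=
        (cap_add_le _ _ _).trans (add_le_add le_rfl (cap_sum_le _ _ _))
    _ ≤ _ := by
        refine add_le_add ((cap_le _ _).trans (ENNReal.ofReal_le_ofReal hc)) ?_
        exact Finset.sum_le_sum fun v hv => hg v fun h => (Finset.mem_sdiff.1 hv).2 (hsub h)

/-- The fallback: attach all terminals to a vertex which is not explored. -/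
lemma min_le_star {k : ℕ} (hk : 2 ≤ k) {r₀ : V} (hr₀ : r₀ ∈ R) (hr : r ∉ R)
    {F B : ENNReal}
    (hF : ∀ A lev par, IsForest R k T A lev par → F ≤ ENNReal.ofReal (forestCost w R A par)) :
    min F B ≤ cap B (edgeWt w r₀ r) + ∑ v ∈ T \ (R ∪ {r}), cap B (edgeWt w r v) := by
  obtain ⟨A, lev, par, hFor, hc⟩ := exists_isForest_star w hk hr₀ hr T
  refine (min_le_min (hF A lev par hFor) le_rfl).trans ?_
  rw [hc]
  exact (cap_add_le _ _ _).trans (add_le_add le_rfl (cap_sum_le _ _ _))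

lemma lintegral_cap_edgeWt (B : ENNReal) {u v : V} (h : u ≠ v) :
    ∫⁻ w, cap B (edgeWt w u v) ∂(Measure.pi fun _ : (⊤ : SimpleGraph V).edgeSet => μ) =
      ∫⁻ x, cap B x ∂μ := by
  simp_rw [edgeWt_of_ne _ h]
  exact (measurePreserving_eval (fun _ : (⊤ : SimpleGraph V).edgeSet => μ)
    (mkEdge h)).lintegral_comp (measurable_cap B)

lemma measurable_cap_edgeWt (B : ENNReal) (u v : V) :
    Measurable fun w : (⊤ : SimpleGraph V).edgeSet → ℝ => cap B (edgeWt w u v) := by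
  by_cases h : u ≠ v
  · simp_rw [edgeWt_of_ne _ h]
    exact (measurable_cap B).comp (measurable_pi_apply _)
  · simp only [edgeWt, h, dif_neg, not_false_eq_true]
    exact measurable_const

/-- The expected cost of the fallback, on an event which does not depend on it. -/
lemma lintegral_indicator_star_le {E : Set ((⊤ : SimpleGraph V).edgeSet → ℝ)}
    (hE : MeasurableSet E)
    (hEr : ∀ x y, (∀ e, e ∉ touch {r} → x e = y e) → x ∈ E → y ∈ E) (B : ENNReal) {r₀ : V}
    (hr₀ : r₀ ∈ R) (hr : r ∉ R) (T : Finset V) :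
    ∫⁻ w, E.indicator (fun w => cap B (edgeWt w r₀ r) +
        ∑ v ∈ T \ (R ∪ {r}), cap B (edgeWt w r v)) w
      ∂(Measure.pi fun _ : (⊤ : SimpleGraph V).edgeSet => μ) ≤
      (Measure.pi fun _ : (⊤ : SimpleGraph V).edgeSet => μ) E *
        ((T.card + 1) * ∫⁻ x, cap B x ∂μ) := by
  have hne : r₀ ≠ r := fun h => hr (h ▸ hr₀)
  have hnev : ∀ v ∈ T \ (R ∪ {r}), r ≠ v := fun v hv h =>
    (Finset.mem_sdiff.1 hv).2 (by simp [h])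
  have hm : Measurable fun w : (⊤ : SimpleGraph V).edgeSet → ℝ => cap B (edgeWt w r₀ r) +
      ∑ v ∈ T \ (R ∪ {r}), cap B (edgeWt w r v) :=
    (measurable_cap_edgeWt B _ _).add (Finset.measurable_sum _ fun v _ =>
      measurable_cap_edgeWt B _ _)
  have e : ∀ w, E.indicator (fun w => cap B (edgeWt w r₀ r) +
        ∑ v ∈ T \ (R ∪ {r}), cap B (edgeWt w r v)) w = E.indicator 1 w *
        (cap B (edgeWt w r₀ r) + ∑ v ∈ T \ (R ∪ {r}), cap B (edgeWt w r v)) := by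
    intro w
    by_cases hw : w ∈ E
    · rw [Set.indicator_of_mem hw, Set.indicator_of_mem hw, Pi.one_apply, one_mul]
    · rw [Set.indicator_of_notMem hw, Set.indicator_of_notMem hw, zero_mul]
  simp_rw [e]
  rw [lintegral_mul_of_dependsOn_disjoint (S := (touch {r} : Set (⊤ : SimpleGraph V).edgeSet)ᶜ)
    (T := touch {r}) (measurable_one.indicator hE) hm, lintegral_indicator_one hE]
  · gcongr
    rw [lintegral_add_left (measurable_cap_edgeWt B _ _),
      lintegral_finsetSum _ fun v _ => measurable_cap_edgeWt B _ _,
      lintegral_cap_edgeWt B hne, Finset.sum_congr rfl fun v hv =>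
      lintegral_cap_edgeWt (μ := μ) B (hnev v hv), Finset.sum_const, nsmul_eq_mul, add_mul, one_mul,
      add_comm]
    gcongr
    exact Finset.sdiff_subset
  · intro x y hxy
    have : x ∈ E ↔ y ∈ E := ⟨hEr x y fun e he => hxy e he, hEr y x fun e he => (hxy e he).symm⟩
    by_cases hx : x ∈ E
    · rw [Set.indicator_of_mem hx, Set.indicator_of_mem (this.1 hx)]; rfl
    · rw [Set.indicator_of_notMem hx, Set.indicator_of_notMem (fun hy => hx (this.2 hy))]
  · intro x y hxy
    have hmem : ∀ v (h : r ≠ v), mkEdge h ∈ touch {r} := fun v h =>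
      mkEdge_mem_touch h (Finset.mem_singleton_self r)
    have h1 : edgeWt x r₀ r = edgeWt y r₀ r := by
      rw [edgeWt_comm x, edgeWt_comm y, edgeWt_of_ne _ hne.symm, edgeWt_of_ne _ hne.symm]
      exact hxy _ (hmem _ _)
    simp only [h1]
    congr 1
    refine Finset.sum_congr rfl fun v hv => ?_
    rw [edgeWt_of_ne _ (hnev v hv), edgeWt_of_ne _ (hnev v hv), hxy _ (hmem _ _)]
  · exact disjoint_compl_left

end Explore

/-! ### The upper bound for the expected cut-off cost, depth at least two. -/

section Upper

variable {μ : Measure ℝ} [IsProbabilityMeasure μ]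

lemma ae_pi_nonneg {ι : Type*} [Fintype ι] (h0 : ∀ᵐ x ∂μ, 0 ≤ x) :
    ∀ᵐ w ∂(Measure.pi fun _ : ι => μ), ∀ e, 0 ≤ w e := by
  rw [ae_all_iff]
  intro e
  exact (measurePreserving_eval (fun _ : ι => μ) e).quasiMeasurePreserving.ae h0

/-- κ enlarges the thresholds enough to guarantee the required number of hits. The last two bounds
say that the resulting cost factor is within ε of 1 and also covers the factor 1/(1-δ) of the last
level. -/
lemma exists_delta {ε : ℝ} (hε : 0 < ε) : ∃ δ κ : ℝ, 0 < δ ∧ δ ≤ 1 / 10 ∧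
    κ * (1 - δ) ^ 4 = 1 + 2 * δ ∧ (1 + δ) ^ 2 * (1 + 3 * δ) * κ ^ 2 ≤ 1 + ε ∧
    1 / (1 - δ) ≤ (1 + δ) ^ 2 * (1 + 3 * δ) * κ ^ 2 := by
  let f : ℝ → ℝ := fun δ => (1 + δ) ^ 2 * (1 + 3 * δ) * ((1 + 2 * δ) / (1 - δ) ^ 4) ^ 2
  have hf : ContinuousAt f 0 := by
    refine ContinuousAt.mul (by fun_prop) (ContinuousAt.pow (ContinuousAt.div (by fun_prop)
      (by fun_prop) (by norm_num)) 2)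
  have h1 : ∀ᶠ δ in 𝓝[>] (0 : ℝ), f δ < 1 + ε := by
    refine (hf.eventually (gt_mem_nhds ?_)).filter_mono nhdsWithin_le_nhds
    simp only [f]
    norm_num
    exact hε
  obtain ⟨δ, hδ, h0, h2⟩ := (h1.and (Ioc_mem_nhdsGT (show (0 : ℝ) < 1 / 10 by norm_num))).exists
  have h1δ : 0 < 1 - δ := by linarith
  refine ⟨δ, (1 + 2 * δ) / (1 - δ) ^ 4, h0, h2, by field_simp, hδ.le, ?_⟩
  have h3 : 1 / (1 - δ) ≤ (1 + 2 * δ) / (1 - δ) ^ 4 := by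
    have h4 : (1 - δ) ^ 4 ≤ 1 - δ := by
      calc (1 - δ) ^ 4 ≤ (1 - δ) ^ 1 := pow_le_pow_of_le_one h1δ.le (by linarith) (by norm_num)
        _ = 1 - δ := pow_one _
    gcongr
    linarith
  have h5 : 1 ≤ (1 + 2 * δ) / (1 - δ) ^ 4 := by
    refine le_trans ?_ h3
    rw [one_le_div h1δ]
    linarith
  set κ := (1 + 2 * δ) / (1 - δ) ^ 4
  have h6 : κ ≤ κ ^ 2 := by nlinarith
  have h7 : 1 ≤ (1 + δ) ^ 2 * (1 + 3 * δ) := by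
    have h8 : 1 ≤ (1 + δ) ^ 2 := one_le_pow₀ (by linarith)
    nlinarith
  calc 1 / (1 - δ) ≤ κ ^ 2 := h3.trans h6
    _ ≤ _ := le_mul_of_one_le_left (by positivity) h7

lemma Params.m_le {n m k ρ : ℕ} {z : ℝ} (h : Params n m k ρ z) :
    (m : ℝ) ≤ 8 * (z ^ 2 ^ (k - 1)) ^ 3 ∧ 1 ≤ unit n m z := by
  have h1 := h.n_mul_unit_le
  have h2 := h.sqrt_le_unit
  have h3 : 1 ≤ √z := by
    rw [Real.one_le_sqrt]
    linarith [h.two_le_z]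
  have h4 : (m : ℝ) ≤ n := by exact_mod_cast h.m_le_n
  have h5 := h.n_pos
  have h6 : 1 ≤ unit n m z := h3.trans h2
  refine ⟨h4.trans (le_trans ?_ h1), h6⟩
  exact le_mul_of_one_le_right h5.le h6

/-- The numbers of vertices required and provided on each level. -/
lemma Params.ceil_add_le {n m k ρ : ℕ} {z δ : ℝ} (h : Params n m k ρ z) (hδ : 0 < δ)
    (hz : 4 / δ ≤ z) {i : ℕ} (hi : i + 1 < k) :
    ⌈levelSize k ρ z (i + 1)⌉₊ + 4 * levelSize k ρ z i ≤
      (1 + 2 * δ) * levelSize k ρ z (i + 1) := by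
  have h1 := h.levelSize_succ (show i < k by omega)
  have h2 := h.pow_le_levelSize (show 1 ≤ i + 1 by omega)
  have h3 := h.z_le_pow
  have h0 := h.levelSize_pos i
  have hz0 := h.z_pos
  have h4 : z ≤ z ^ 2 ^ (k - (i + 1)) :=
    le_self_pow₀ (by linarith [h.two_le_z]) (by positivity)
  have h5 := Nat.ceil_lt_add_one (show 0 ≤ levelSize k ρ z (i + 1) by linarith)
  rw [div_le_iff₀ hδ] at hz
  have h6 : 1 ≤ δ * levelSize k ρ z (i + 1) := by
    have : z * δ ≤ levelSize k ρ z (i + 1) * δ := mul_le_mul_of_nonneg_right (by linarith) hδ.le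
    linarith
  have h7 : 4 * levelSize k ρ z i ≤ δ * levelSize k ρ z (i + 1) := by
    rw [h1]
    have : 4 ≤ δ * (2 * z ^ 2 ^ (k - (i + 1))) := by
      have : z * δ ≤ z ^ 2 ^ (k - (i + 1)) * δ := mul_le_mul_of_nonneg_right h4 hδ.le
      linarith
    calc 4 * levelSize k ρ z i ≤ (δ * (2 * z ^ 2 ^ (k - (i + 1)))) * levelSize k ρ z i := by gcongr
      _ = _ := by ring
  linarith

/-- Expected cost of a cheap forest, in terms of the bounds for the exploration. -/
lemma lintegral_min_le {δ η : ℝ} (hη : NearZero μ δ η) (h0 : ∀ᵐ x ∂μ, 0 ≤ x) (hδ : 0 < δ)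
    (hδ1 : δ < 1) {n m k ρ : ℕ} {z : ℝ} (hP : Params n m k ρ z) (hzδ : 4 / δ ≤ z) (hk : 2 ≤ k)
    {t : ℕ → ℝ} {C : ℕ → ℝ} {b : ℝ}
    (hbad : ∀ i, i + 1 < k → ∀ r : Fin n,
      (Measure.pi fun _ : (⊤ : SimpleGraph (Fin n)).edgeSet => μ)
        (levelBad r ⌈levelSize k ρ z i⌉₊ ((1 + 2 * δ) * levelSize k ρ z (i + 1)) (C i)
          (t (i + 1))) ≤ ENNReal.ofReal b)
    {R T : Finset (Fin n)} (hR : R.card = ρ) (hT : T.card = m) (hRn : ρ < n)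
    {F : ((⊤ : SimpleGraph (Fin n)).edgeSet → ℝ) → ENNReal}
    (hF : ∀ w, (∀ e, 0 ≤ w e) → ∀ A lev par, IsForest R k T A lev par →
      F w ≤ ENNReal.ofReal (forestCost w R A par)) (B : ENNReal) :
    ∫⁻ w, min (F w) B ∂(Measure.pi fun _ : (⊤ : SimpleGraph (Fin n)).edgeSet => μ) ≤
      ENNReal.ofReal (∑ i ∈ Finset.range (k - 1), C i) +
        m * (ENNReal.ofReal (1 / ((1 - δ) * ⌈levelSize k ρ z (k - 1)⌉₊)) +
          (∫⁻ x, cap B x ∂μ) * μ (Set.Ici η) ^ (⌈levelSize k ρ z (k - 1)⌉₊ - 1)) +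
        ((k - 1 : ℕ) * ENNReal.ofReal b) * ((m + 1) * ∫⁻ x, cap B x ∂μ) := by
  obtain ⟨K, rfl⟩ : ∃ K, k = K + 1 := ⟨k - 1, by omega⟩
  rw [Nat.add_sub_cancel]
  -- The vertex r is kept out of the exploration and serves as the centre of the fallback star.
  obtain ⟨r, hr⟩ : ∃ r : Fin n, r ∉ R := by
    by_contra hcon
    push Not at hcon
    have := Finset.card_le_card (show (Finset.univ : Finset (Fin n)) ⊆ R from fun v _ => hcon v)
    rw [Finset.card_univ, Fintype.card_fin] at this
    omega
  obtain ⟨r₀, hr₀⟩ : R.Nonempty := by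
    rw [← Finset.card_pos, hR]
    exact hP.one_le_rho
  set N : ℕ → ℕ := fun i => ⌈levelSize (K + 1) ρ z i⌉₊ with hN
  set ν := Measure.pi fun _ : (⊤ : SimpleGraph (Fin n)).edgeSet => μ
  set E : Set ((⊤ : SimpleGraph (Fin n)).edgeSet → ℝ) := ⋃ i ∈ Finset.range K,
    levelBad r (N i) ((1 + 2 * δ) * levelSize (K + 1) ρ z (i + 1)) (C i) (t (i + 1)) with hE
  have hEm : MeasurableSet E :=
    Finset.measurableSet_biUnion _ fun i _ => measurableSet_levelBad _ _ _ _ _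
  have hEr : ∀ x y, (∀ e, e ∉ touch {r} → x e = y e) → x ∈ E → y ∈ E := by
    intro x y hxy hx
    simp only [hE, Set.mem_iUnion] at hx ⊢
    obtain ⟨i, hi, hx⟩ := hx
    exact ⟨i, hi, levelBad_congr hxy hx⟩
  have hEν : ν E ≤ K * ENNReal.ofReal b := by
    refine (measure_biUnion_finset_le _ _).trans ?_
    calc _ ≤ ∑ i ∈ Finset.range K, ENNReal.ofReal b := Finset.sum_le_sum fun i hi =>
          hbad i (by have := Finset.mem_range.1 hi; omega) r
      _ = _ := by rw [Finset.sum_const, nsmul_eq_mul, Finset.card_range]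
  have hN1 : ∀ i, 1 ≤ N i := fun i => Nat.one_le_ceil_iff.2 (hP.levelSize_pos i)
  have hRN : R.card = N 0 := by
    rw [hN]
    simp only [Params.levelSize_zero, Nat.ceil_natCast, hR]
  set S : ((⊤ : SimpleGraph (Fin n)).edgeSet → ℝ) → ENNReal := E.indicator fun w =>
    cap B (edgeWt w r₀ r) + ∑ v ∈ T \ (R ∪ {r}), cap B (edgeWt w r v) with hS
  have hSm : Measurable S := ((measurable_cap_edgeWt B _ _).add
    (Finset.measurable_sum _ fun v _ => measurable_cap_edgeWt B _ _)).indicator hEm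
  have hmain : ∀ᵐ w ∂ν, min (F w) B ≤ ENNReal.ofReal (∑ i ∈ Finset.range K, C i) +
      (if (explore r R N t w K).1.card = N K then
        ∑ v ∈ T \ ((explore r R N t w K).1 ∪ (explore r R N t w K).2),
          attachCap B η (explore r R N t w K).1 v w else 0) + S w := by
    filter_upwards [ae_pi_nonneg (ι := (⊤ : SimpleGraph (Fin n)).edgeSet) h0] with w hw
    by_cases hwE : w ∈ E
    · rw [hS, Set.indicator_of_mem hwE]
      exact (min_le_star hk hr₀ hr (hF w hw)).trans le_add_self
    · refine le_trans ?_ le_self_add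
      have hgood : ∀ i < K, (explore r R N t w i).1.card = N i →
          (1 + 2 * δ) * levelSize (K + 1) ρ z (i + 1) ≤
            (hits r (explore r R N t w i).1 (t (i + 1)) w).card ∧
          t (i + 1) * ∑ e ∈ touch (explore r R N t w i).1 \ touch {r},
            below (t (i + 1)) (w e) ≤ C i := by
        intro i hi hc
        have hnb : w ∉ levelBad r (N i) ((1 + 2 * δ) * levelSize (K + 1) ρ z (i + 1)) (C i)
            (t (i + 1)) := fun h => hwE (Set.mem_biUnion (show i ∈ (Finset.range K : Set ℕ) by
              simpa using hi) h)
        by_contra hcon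
        refine hnb ⟨(explore r R N t w i).1,
          ⟨hc, fun h => notMem_explore hr i (explore_fst_subset i h)⟩, ?_⟩
        rw [not_and_or, not_le, not_le] at hcon
        exact hcon
      refine min_le_of_explore hw hr hRN (hN1 K) (fun i hi hc => ?_)
        (fun i hi hc => (hgood i hi hc).2) η (hF w hw)
      have h1 := (hgood i hi hc).1
      have h2 := hP.ceil_add_le hδ hzδ (show i + 1 < K + 1 by omega)
      -- Level sizes grow so fast that all explored vertices together are at most four times the
      -- nominal size of the last level; discarding them from the hits is covered by the surplus 2δ.
      have h3 : ∀ i ≤ K, ((explore r R N t w i).2.card : ℝ) ≤ 4 * levelSize (K + 1) ρ z i := by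
        intro i hi
        induction i with
        | zero =>
          rw [show (explore r R N t w 0).2 = R from rfl, hR, Params.levelSize_zero]
          linarith [hP.rho_pos]
        | succ i ih =>
          have h1 : (explore r R N t w (i + 1)).2.card ≤
              (explore r R N t w i).2.card + N (i + 1) :=
            (Finset.card_union_le _ _).trans (Nat.add_le_add_left (card_pick_le _ _) _)
          have h2 : ((explore r R N t w (i + 1)).2.card : ℝ) ≤
              (explore r R N t w i).2.card + N (i + 1) := by exact_mod_cast h1
          have h3 := hP.ceil_add_le hδ hzδ (show i + 1 < K + 1 by omega)
          have h4 := hP.levelSize_pos (i + 1)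
          have h5 : δ * levelSize (K + 1) ρ z (i + 1) ≤ levelSize (K + 1) ρ z (i + 1) :=
            mul_le_of_le_one_left h4.le hδ1.le
          have h6 := ih (by omega)
          simp only [hN] at h2
          linarith
      have h4 := h3 i hi.le
      have h5 : N (i + 1) + (explore r R N t w i).2.card ≤
          (hits r (explore r R N t w i).1 (t (i + 1)) w).card := by
        have : (N (i + 1) : ℝ) + (explore r R N t w i).2.card ≤
          (hits r (explore r R N t w i).1 (t (i + 1)) w).card := by
          simp only [hN]
          linarith
        exact_mod_cast this
      have h6 := Finset.le_card_sdiff (explore r R N t w i).2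
        (hits r (explore r R N t w i).1 (t (i + 1)) w)
      omega
  calc _ ≤ ∫⁻ w, (ENNReal.ofReal (∑ i ∈ Finset.range K, C i) +
      (if (explore r R N t w K).1.card = N K then
        ∑ v ∈ T \ ((explore r R N t w K).1 ∪ (explore r R N t w K).2),
          attachCap B η (explore r R N t w K).1 v w else 0) + S w) ∂ν := lintegral_mono_ae hmain
    _ ≤ _ := by
      rw [lintegral_add_right _ hSm, lintegral_add_left measurable_const, lintegral_const,
        measure_univ, mul_one]
      refine add_le_add (add_le_add le_rfl ?_) ?_
      · have := lintegral_sum_attachCap_le (t := t) (N := N) hη hδ1 B hr T (hN1 K) K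
        rwa [hT] at this
      · refine (lintegral_indicator_star_le hEm hEr B hr₀ hr T).trans ?_
        rw [hT]
        gcongr

/-- The expected cost of a cheap forest. -/
theorem exists_lintegral_min_le_of_two_le (hμ : HasDensityOneAtZero μ) {ε C₀ : ℝ} (hε : 0 < ε)
    (hC₀ : 0 < C₀) :
    ∃ Z : ℝ, ∀ (n m k ρ : ℕ) (z : ℝ), Params n m k ρ z → Z ≤ z → 2 ≤ k →
      ∀ R T : Finset (Fin n), R.card = ρ → T.card = m →
      ∀ B : ENNReal, ∫⁻ x, cap B x ∂μ ≤ ENNReal.ofReal (C₀ * unit n m z) →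
      ∀ F : ((⊤ : SimpleGraph (Fin n)).edgeSet → ℝ) → ENNReal,
      (∀ w, (∀ e, 0 ≤ w e) → ∀ A lev par, IsForest R k T A lev par →
        F w ≤ ENNReal.ofReal (forestCost w R A par)) →
      ∫⁻ w, min (F w) B ∂(Measure.pi fun _ : (⊤ : SimpleGraph (Fin n)).edgeSet => μ) ≤
        ENNReal.ofReal ((1 - ((2 : ℝ) ^ k)⁻¹ + ε) * unit n m z) := by
  obtain ⟨δ, κ, hδ, hδ1, hκ, hκε, hκδ⟩ := exists_delta (half_pos hε)
  obtain ⟨η, -, hη⟩ := hμ.nearZero hδ (by linarith)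
  obtain ⟨Z, hZ⟩ := exists_measure_levelBad_le hη hμ.nonneg hδ hδ1 hκ
  have hη0 := hη.pos
  have h1δ : 0 < 1 - δ := by linarith
  obtain ⟨X₁, -, hX₁⟩ := exists_pow_mul_exp_le 3 (show 0 < (1 - δ) * η by positivity)
    (show 0 < ε / 4 / (8 * C₀) by positivity)
  obtain ⟨X₂, -, hX₂⟩ := exists_pow_mul_exp_le 4 (show 0 < δ ^ 2 / 8 by positivity)
    (show 0 < ε / 4 / (32 * C₀) by positivity)
  refine ⟨max (max Z (4 / δ)) (max (max X₁ X₂) 3),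
    fun n m k ρ z hP hz hk R T hR hT B hB F hF => ?_⟩
  simp only [max_le_iff] at hz
  obtain ⟨⟨hz1, hz2⟩, ⟨hz3, hz4⟩, hz5⟩ := hz
  have hu := hP.unit_pos
  have hzQ := hP.z_le_pow
  obtain ⟨hmQ, hu1⟩ := hP.m_le
  have hkQ := hP.k_le_pow
  have hMQ := hP.pow_le_levelSize (show 1 ≤ k - 1 by omega)
  have hMs := hP.levelSize_last_mul
  have hm := hP.m_pos
  have hm1 : (1 : ℝ) ≤ m := by exact_mod_cast hP.one_le_m
  have hρn : ρ < n := by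
    have h1 : (3 : ℝ) ≤ n := hz5.trans hP.z_le_n
    have h2 : 3 ≤ n := by exact_mod_cast h1
    have := hP.rho_le_two
    omega
  set s := unit n m z
  set Q := z ^ 2 ^ (k - 1)
  set M := levelSize k ρ z (k - 1)
  set K₂ := (1 + δ) ^ 2 * (1 + 3 * δ) * κ ^ 2
  have hQ1 : 1 ≤ Q := by linarith
  have hM0 : 0 < M := by linarith
  set C : ℕ → ℝ := fun i => K₂ * (2 ^ i * s / 2 ^ k)
  set b : ℝ := 2 * Real.exp (-(δ ^ 2 / 8 * Q))
  have hb : 0 ≤ b := by positivity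
  have key := lintegral_min_le hη hμ.nonneg hδ (by linarith) hP hz2 hk
    (t := fun i => 2 * κ * z ^ 2 ^ (k - i) / n) (C := C) (b := b)
    (fun i hi r => hZ n m k ρ z hP hz1 i hi r _ rfl) hR hT hρn hF B
  refine key.trans ?_
  -- A given terminal outside the last level has no edge lighter than η to it only with probability
  -- exponentially small in Q, as M ≥ 2Q.
  have hp : μ (Set.Ici η) ^ (⌈M⌉₊ - 1) ≤ ENNReal.ofReal (Real.exp (-((1 - δ) * η * Q))) := by
    have h1 : μ (Set.Ici η) ≤ ENNReal.ofReal (Real.exp (-((1 - δ) * η))) := by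
      rw [← ofReal_measureReal]
      exact ENNReal.ofReal_le_ofReal (hη.tail_upper η hη0 le_rfl)
    calc _ ≤ ENNReal.ofReal (Real.exp (-((1 - δ) * η))) ^ (⌈M⌉₊ - 1) := by gcongr
      _ = ENNReal.ofReal (Real.exp ((⌈M⌉₊ - 1 : ℕ) * -((1 - δ) * η))) := by
        rw [← ENNReal.ofReal_pow (Real.exp_pos _).le, Real.exp_nat_mul]
      _ ≤ _ := by
        refine ENNReal.ofReal_le_ofReal (Real.exp_le_exp.2 ?_)
        have h2 : Q ≤ (⌈M⌉₊ - 1 : ℕ) := by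
          rw [Nat.cast_sub (Nat.one_le_ceil_iff.2 hM0)]
          have := Nat.le_ceil M
          push_cast
          linarith
        have h3 : 0 < (1 - δ) * η := by positivity
        nlinarith
  -- The inner levels contribute the geometric sum s/4 + ... + s/2^k, up to the factor K₂.
  have hsumC : ∑ i ∈ Finset.range (k - 1), C i ≤ K₂ * (s / 2 - s * ((2 : ℝ) ^ k)⁻¹) := by
    refine le_of_eq ?_
    obtain ⟨K, rfl⟩ : ∃ K, k = K + 1 := ⟨k - 1, by omega⟩
    simp only [C]
    rw [Nat.add_sub_cancel, ← Finset.mul_sum, ← Finset.sum_div, ← Finset.sum_mul,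
      geom_sum_eq (by norm_num), pow_succ (2 : ℝ) K]
    field_simp
    ring
  have hlast : (m : ℝ) * (1 / ((1 - δ) * ⌈M⌉₊)) ≤ K₂ * (s / 2) := by
    have hMc := Nat.le_ceil M
    calc (m : ℝ) * (1 / ((1 - δ) * ⌈M⌉₊)) ≤ m * (1 / ((1 - δ) * M)) := by gcongr
      _ = 1 / (1 - δ) * (s / 2) := by
        have : (m : ℝ) = M * s / 2 := by linarith
        rw [this]
        field_simp
      _ ≤ _ := by gcongr
  have hbd1 : (m : ℝ) * (C₀ * s * Real.exp (-((1 - δ) * η * Q))) ≤ ε / 4 * s := by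
    have h1 := hX₁ Q (hz3.trans hzQ)
    rw [le_div_iff₀ (by positivity)] at h1
    calc (m : ℝ) * (C₀ * s * Real.exp (-((1 - δ) * η * Q)))
        ≤ 8 * Q ^ 3 * (C₀ * s * Real.exp (-((1 - δ) * η * Q))) := by gcongr
      _ = Q ^ 3 * Real.exp (-((1 - δ) * η * Q)) * (8 * C₀) * s := by ring
      _ ≤ _ := by gcongr
  -- Failure probability times the cost of the fallback: k ≤ Q and m + 1 ≤ 16Q³ are polynomial in Q,
  -- while b is exponentially small.
  have hbd2 : ((k - 1 : ℕ) * b) * ((m + 1) * (C₀ * s)) ≤ ε / 4 * s := by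
    have h1 := hX₂ Q (hz4.trans hzQ)
    rw [le_div_iff₀ (by positivity)] at h1
    have h2 : ((k - 1 : ℕ) : ℝ) ≤ Q := by
      refine le_trans ?_ hkQ
      exact_mod_cast Nat.sub_le k 1
    calc ((k - 1 : ℕ) * b) * ((m + 1) * (C₀ * s)) ≤ (Q * b) * ((16 * Q ^ 3) * (C₀ * s)) := by
          gcongr
          linarith
      _ = Q ^ 4 * Real.exp (-(δ ^ 2 / 8 * Q)) * (32 * C₀) * s := by ring
      _ ≤ _ := by gcongr
  have hCs : 0 ≤ C₀ * s := by positivity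
  have hK₂0 : 0 ≤ K₂ * (s / 2 - s * ((2 : ℝ) ^ k)⁻¹) := by
    have h1 : ((2 : ℝ) ^ k)⁻¹ ≤ 2⁻¹ := by
      refine inv_anti₀ (by norm_num) ?_
      calc (2 : ℝ) = 2 ^ 1 := by norm_num
        _ ≤ 2 ^ k := pow_le_pow_right₀ (by norm_num) (by omega)
    refine mul_nonneg (by positivity) ?_
    have := mul_le_mul_of_nonneg_left h1 hu.le
    linarith
  calc _ ≤ ENNReal.ofReal (K₂ * (s / 2 - s * ((2 : ℝ) ^ k)⁻¹)) +
        ENNReal.ofReal m * (ENNReal.ofReal (1 / ((1 - δ) * ⌈M⌉₊)) +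
          ENNReal.ofReal (C₀ * s) * ENNReal.ofReal (Real.exp (-((1 - δ) * η * Q)))) +
        (ENNReal.ofReal (k - 1 : ℕ) * ENNReal.ofReal b) *
          (ENNReal.ofReal (m + 1) * ENNReal.ofReal (C₀ * s)) := by
        rw [ENNReal.ofReal_natCast, ENNReal.ofReal_natCast, ENNReal.ofReal_add hm.le zero_le_one,
          ENNReal.ofReal_natCast, ENNReal.ofReal_one]
        gcongr
    _ = ENNReal.ofReal (K₂ * (s / 2 - s * ((2 : ℝ) ^ k)⁻¹) +
        m * (1 / ((1 - δ) * ⌈M⌉₊) + C₀ * s * Real.exp (-((1 - δ) * η * Q))) +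
        ((k - 1 : ℕ) * b) * ((m + 1) * (C₀ * s))) := by
        have hm2 : (0 : ℝ) ≤ m + 1 := by positivity
        have hkb : 0 ≤ ((k - 1 : ℕ) : ℝ) * b := by positivity
        rw [← ENNReal.ofReal_mul hCs, ← ENNReal.ofReal_add (by positivity) (by positivity),
          ← ENNReal.ofReal_mul hm.le, ← ENNReal.ofReal_mul (Nat.cast_nonneg _),
          ← ENNReal.ofReal_mul hm2, ← ENNReal.ofReal_mul hkb, ← ENNReal.ofReal_add hK₂0
          (by positivity), ← ENNReal.ofReal_add (by positivity) (by positivity)]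
    _ ≤ _ := by
        refine ENNReal.ofReal_le_ofReal ?_
        have h2 : 0 ≤ 1 - ((2 : ℝ) ^ k)⁻¹ := by
          have : ((2 : ℝ) ^ k)⁻¹ ≤ 1 := inv_le_one_of_one_le₀ (one_le_pow₀ (by norm_num))
          linarith
        have h3 : K₂ * ((1 - ((2 : ℝ) ^ k)⁻¹) * s) ≤ (1 + ε / 2) * ((1 - ((2 : ℝ) ^ k)⁻¹) * s) := by
          gcongr
        have h4 : ε / 2 * ((1 - ((2 : ℝ) ^ k)⁻¹) * s) ≤ ε / 2 * s := by
          have : 0 < ((2 : ℝ) ^ k)⁻¹ := by positivity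
          gcongr
          exact mul_le_of_le_one_left hu.le (by linarith)
        linarith

end Upper

/-! ### Depth one with exponential weights. -/

section Exponential

variable {μ : Measure ℝ} [IsProbabilityMeasure μ] {ι : Type*} [Fintype ι]

lemma truncMin_mono (A : Finset ι) (w : ι → ℝ) : Monotone fun t => truncMin A t w := by
  intro s t hst
  refine max_le_max le_rfl ?_
  rw [Finset.le_fold_min]
  exact ⟨(Finset.fold_min_le _).2 (Or.inl le_rfl) |>.trans hst,
    fun e he => (Finset.fold_min_le _).2 (Or.inr ⟨e, he, le_rfl⟩)⟩

/-- Monotone convergence as the truncation level N of `truncMin` tends to infinity; the tail bound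
is needed at all distances. -/
lemma lintegral_iInf_ofReal_le (h0 : ∀ᵐ x ∂μ, 0 ≤ x) {A : Finset ι} (hA : A.Nonempty) {c : ℝ}
    (hc : 0 < c) (h : ∀ y, 0 < y → μ.real (Set.Ici y) ≤ Real.exp (-(c * y))) :
    ∫⁻ w, ⨅ e ∈ A, ENNReal.ofReal (w e) ∂(Measure.pi fun _ : ι => μ) ≤
      ENNReal.ofReal (1 / (c * A.card)) := by
  calc _ ≤ ∫⁻ w, ⨆ N : ℕ, ENNReal.ofReal (truncMin A N w) ∂(Measure.pi fun _ : ι => μ) := by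
        refine lintegral_mono_ae ?_
        filter_upwards [ae_pi_nonneg (ι := ι) h0] with w hw
        obtain ⟨e, he⟩ := hA
        obtain ⟨N, hN⟩ := exists_nat_gt (w e)
        obtain ⟨e', he', heq⟩ := exists_eq_truncMin (A := A) (t := N) (fun e _ => hw e) ⟨e, he, hN⟩
        refine (iInf₂_le e' he').trans ?_
        rw [heq]
        exact le_iSup (fun N : ℕ => ENNReal.ofReal (truncMin A N w)) N
    _ = ⨆ N : ℕ, ∫⁻ w, ENNReal.ofReal (truncMin A N w) ∂(Measure.pi fun _ : ι => μ) := by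
        refine lintegral_iSup (fun N => (measurable_truncMin A N).ennreal_ofReal) ?_
        intro N N' hN w
        exact ENNReal.ofReal_le_ofReal (truncMin_mono A w (by exact_mod_cast hN))
    _ ≤ _ := iSup_le fun N =>
        lintegral_truncMin_le hA (Nat.cast_nonneg N) hc fun y hy _ => h y hy

variable {V : Type*} [Fintype V] [DecidableEq V] [Fintype (⊤ : SimpleGraph V).edgeSet]
  {R T : Finset V}

lemma le_sum_iInf_of_forest {w : (⊤ : SimpleGraph V).edgeSet → ℝ} (hR : R.Nonempty)
    {F : ENNReal}
    (hF : ∀ A lev par, IsForest R 1 T A lev par → F ≤ ENNReal.ofReal (forestCost w R A par)) :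
    F ≤ ∑ v ∈ T \ R, ⨅ e ∈ edgesTo R v, ENNReal.ofReal (w e) := by
  have hg : ∀ v, ∃ u ∈ R, v ∉ R →
      ENNReal.ofReal (edgeWt w u v) ≤ ⨅ e ∈ edgesTo R v, ENNReal.ofReal (w e) := by
    intro v
    by_cases hv : v ∈ R
    · exact ⟨v, hv, fun h => absurd hv h⟩
    · have hne : (edgesTo R v).Nonempty := by
        rw [← Finset.card_pos, card_edgesTo hv]
        exact hR.card_pos
      obtain ⟨e, he, hmin⟩ := (edgesTo R v).exists_min_image (fun e => ENNReal.ofReal (w e)) hne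
      obtain ⟨u, h, hu, rfl⟩ := exists_of_mem_edgesTo hv he
      refine ⟨u, hu, fun _ => ?_⟩
      rw [edgeWt_of_ne w h]
      exact le_iInf₂ hmin
  choose g hgR hg using hg
  have hd : Disjoint R (T \ R) := Finset.disjoint_sdiff
  have h1 := (isForest_root R id).extend hd (g := g) fun v _ => ⟨hgR v, rfl⟩
  refine (hF _ _ _ (h1.mono le_rfl ?_)).trans ?_
  · rw [Finset.union_sdiff_self_eq_union]
    exact Finset.subset_union_right
  · rw [forestCost_extend w (Finset.Subset.refl _) hd, forestCost_root, zero_add]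
    have h2 : ∀ s : Finset V, ENNReal.ofReal (∑ v ∈ s, edgeWt w (g v) v) ≤
        ∑ v ∈ s, ENNReal.ofReal (edgeWt w (g v) v) := by
      intro s
      induction s using Finset.induction_on with
      | empty => simp
      | insert a s ha ih =>
        rw [Finset.sum_insert ha, Finset.sum_insert ha]
        exact ENNReal.ofReal_add_le.trans (add_le_add le_rfl ih)
    exact (h2 _).trans (Finset.sum_le_sum fun v hv => hg v (Finset.mem_sdiff.1 hv).2)

/-- Each terminal outside R pays the minimum of |R| exponential weights, of mean 1/|R|. The total
m/ρ is exactly half the unit when k = 1. -/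
lemma lintegral_le_of_exp (hμ : μ = expMeasure 1) (h0 : ∀ᵐ x ∂μ, 0 ≤ x) (hR : R.Nonempty)
    {F : ((⊤ : SimpleGraph V).edgeSet → ℝ) → ENNReal}
    (hF : ∀ w, (∀ e, 0 ≤ w e) → ∀ A lev par, IsForest R 1 T A lev par →
      F w ≤ ENNReal.ofReal (forestCost w R A par)) :
    ∫⁻ w, F w ∂(Measure.pi fun _ : (⊤ : SimpleGraph V).edgeSet => μ) ≤
      T.card * ENNReal.ofReal (1 / R.card) := by
  have htail : ∀ y, 0 < y → μ.real (Set.Ici y) ≤ Real.exp (-(1 * y)) := by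
    intro y hy
    rw [hμ, expMeasure_real_Ici hy.le, one_mul]
  have hm : ∀ v : V, Measurable fun w : (⊤ : SimpleGraph V).edgeSet → ℝ =>
      ⨅ e ∈ edgesTo R v, ENNReal.ofReal (w e) := fun v =>
    Measurable.iInf fun e => Measurable.iInf fun _ => (measurable_pi_apply e).ennreal_ofReal
  calc _ ≤ ∫⁻ w, ∑ v ∈ T \ R, ⨅ e ∈ edgesTo R v, ENNReal.ofReal (w e)
        ∂(Measure.pi fun _ : (⊤ : SimpleGraph V).edgeSet => μ) := by
        refine lintegral_mono_ae ?_
        filter_upwards [ae_pi_nonneg (ι := (⊤ : SimpleGraph V).edgeSet) h0] with w hw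
        exact le_sum_iInf_of_forest hR (hF w hw)
    _ = ∑ v ∈ T \ R, ∫⁻ w, ⨅ e ∈ edgesTo R v, ENNReal.ofReal (w e)
        ∂(Measure.pi fun _ : (⊤ : SimpleGraph V).edgeSet => μ) :=
        lintegral_finsetSum _ fun v _ => hm v
    _ ≤ ∑ v ∈ T \ R, ENNReal.ofReal (1 / R.card) := by
        refine Finset.sum_le_sum fun v hv => ?_
        have hc := card_edgesTo (Finset.mem_sdiff.1 hv).2
        have hne : (edgesTo R v).Nonempty := by
          rw [← Finset.card_pos, hc]
          exact hR.card_pos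
        refine (lintegral_iInf_ofReal_le h0 hne one_pos htail).trans ?_
        rw [hc, one_mul]
    _ ≤ _ := by
        rw [Finset.sum_const, nsmul_eq_mul]
        gcongr
        exact Finset.sdiff_subset

/-- The expected cost of a cheap forest. -/
theorem exists_lintegral_min_le (hμ : HasDensityOneAtZero μ) {ε : ℝ} (hε : 0 < ε) :
    ∃ Z : ℝ, ∀ (n m k ρ : ℕ) (z : ℝ), Params n m k ρ z → Z ≤ z →
      (2 ≤ k ∨ (k = 1 ∧ μ = expMeasure 1)) →
      ∀ R T : Finset (Fin n), R.card = ρ → T.card = m →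
      ∀ B : ENNReal, ∫⁻ x, cap B x ∂μ ≤ ENNReal.ofReal (unit n m z) →
      ∀ F : ((⊤ : SimpleGraph (Fin n)).edgeSet → ℝ) → ENNReal,
      (∀ w, (∀ e, 0 ≤ w e) → ∀ A lev par, IsForest R k T A lev par →
        F w ≤ ENNReal.ofReal (forestCost w R A par)) →
      ∫⁻ w, min (F w) B ∂(Measure.pi fun _ : (⊤ : SimpleGraph (Fin n)).edgeSet => μ) ≤
        ENNReal.ofReal ((1 - ((2 : ℝ) ^ k)⁻¹ + ε) * unit n m z) := by
  obtain ⟨Z, hZ⟩ := exists_lintegral_min_le_of_two_le hμ hε one_pos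
  refine ⟨Z, fun n m k ρ z hP hz hk R T hR hT B hB F hF => ?_⟩
  rcases hk with hk | ⟨rfl, hk⟩
  · exact hZ n m k ρ z hP hz hk R T hR hT B (by rwa [one_mul]) F hF
  · have hRne : R.Nonempty := by
      rw [← Finset.card_pos, hR]
      exact hP.one_le_rho
    calc _ ≤ ∫⁻ w, F w ∂(Measure.pi fun _ : (⊤ : SimpleGraph (Fin n)).edgeSet => μ) :=
          lintegral_mono fun w => min_le_left _ _
      _ ≤ T.card * ENNReal.ofReal (1 / R.card) := lintegral_le_of_exp hk hμ.nonneg hRne hF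
      _ ≤ _ := by
          rw [hR, hT, ← ENNReal.ofReal_natCast, ← ENNReal.ofReal_mul (Nat.cast_nonneg _)]
          refine ENNReal.ofReal_le_ofReal ?_
          have h1 := hP.levelSize_last_mul
          rw [Nat.sub_self, Params.levelSize_zero] at h1
          have h2 := hP.rho_pos
          have h3 := hP.unit_pos
          have : (m : ℝ) * (1 / ρ) = unit n m z / 2 := by
            field_simp
            linarith
          rw [this]
          have := mul_pos hε h3
          norm_num
          linarith

end Exponential

/-! ### From bounds on means and lower tails to convergence. -/

section Moments

variable {Ω : Type*} [MeasurableSpace Ω] {P : Measure Ω} [IsProbabilityMeasure P]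

/-- A random variable which is rarely small and whose mean is not large is rarely large. -/
lemma measureReal_ge_le {X : Ω → ℝ} (hX : Measurable X) {a s η γ : ℝ} (ha0 : 0 ≤ a)
    (ha1 : a ≤ 1) (hs : 0 < s) (hη : 0 < η) (hγ : 0 < γ) (hγ1 : γ ≤ 1)
    (hlow : P.real {ω | X ω < (a - η) * s} ≤ η)
    (hup : ∫⁻ ω, min (ENNReal.ofReal (X ω)) (ENNReal.ofReal (2 * s)) ∂P ≤
      ENNReal.ofReal ((a + η) * s)) :
    γ * P.real {ω | (a + γ) * s ≤ X ω} ≤ 3 * η := by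
  set Y : Ω → ℝ := fun ω => min (max (X ω) 0) (2 * s) with hY
  have hYm : Measurable Y := (hX.max measurable_const).min measurable_const
  have hY0 : ∀ ω, 0 ≤ Y ω := fun ω => le_min (le_max_right _ _) (by positivity)
  have hYi : Integrable Y P := Integrable.of_mem_Icc 0 (2 * s) hYm.aemeasurable
    (Eventually.of_forall fun ω => ⟨hY0 ω, min_le_right _ _⟩)
  have hYup : ∫ ω, Y ω ∂P ≤ (a + η) * s := by
    refine (ENNReal.ofReal_le_ofReal_iff (by positivity)).1 (le_trans (le_of_eq ?_) hup)
    rw [ofReal_integral_eq_lintegral_ofReal hYi (Eventually.of_forall hY0)]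
    refine lintegral_congr fun ω => ?_
    simp only [hY]
    rw [ENNReal.ofReal_min, ENNReal.ofReal_max, ENNReal.ofReal_zero, max_eq_left zero_le]
  set A := {ω | X ω < (a - η) * s}
  set C := {ω | (a + γ) * s ≤ X ω}
  have hA : MeasurableSet A := measurableSet_lt hX measurable_const
  have hC : MeasurableSet C := measurableSet_le measurable_const hX
  -- Pointwise Y ≥ (a-η)s - s·1_A + γs·1_C. Cutting off at 2s does no harm on C, because a + γ ≤ 2.
  have hle : ∫ ω, ((a - η) * s - A.indicator (fun _ => s) ω + C.indicator (fun _ => γ * s) ω) ∂P ≤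
      ∫ ω, Y ω ∂P := by
    refine integral_mono (((integrable_const _).sub ((integrable_const _).indicator hA)).add
      ((integrable_const _).indicator hC)) hYi fun ω => ?_
    have has : 0 ≤ (1 - a) * s := mul_nonneg (by linarith) hs.le
    have hηs : 0 < η * s := by positivity
    have hγs : 0 < γ * s := by positivity
    have hγs' : 0 ≤ (1 - γ) * s := mul_nonneg (by linarith) hs.le
    have has0 : 0 ≤ a * s := by positivity
    simp only
    by_cases hωA : ω ∈ A
    · have hωC : ω ∉ C := fun h => by
        have h1 : X ω < (a - η) * s := hωA
        have h2 : (a + γ) * s ≤ X ω := h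
        linarith
      rw [Set.indicator_of_mem hωA, Set.indicator_of_notMem hωC]
      have := hY0 ω
      linarith
    · rw [Set.indicator_of_notMem hωA]
      have h1 : (a - η) * s ≤ X ω := not_lt.1 hωA
      by_cases hωC : ω ∈ C
      · have h2 : (a + γ) * s ≤ X ω := hωC
        rw [Set.indicator_of_mem hωC]
        refine le_min (le_max_of_le_left ?_) ?_ <;> linarith
      · rw [Set.indicator_of_notMem hωC]
        refine le_min (le_max_of_le_left ?_) ?_ <;> linarith
  have hi : Integrable (fun ω => (a - η) * s - A.indicator (fun _ => s) ω) P :=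
    (integrable_const _).sub ((integrable_const _).indicator hA)
  rw [integral_add hi ((integrable_const _).indicator hC), integral_sub (integrable_const _)
    ((integrable_const _).indicator hA), integral_indicator_const _ hA,
    integral_indicator_const _ hC, integral_const, probReal_univ] at hle
  simp only [smul_eq_mul, one_mul] at hle
  have h1 : P.real A * s ≤ η * s := by gcongr
  have h2 : (γ * P.real C) * s ≤ (3 * η) * s := by nlinarith
  exact le_of_mul_le_mul_right h2 hs

lemma le_integral_of_measureReal_lt_le {X : Ω → ℝ} (hX : Measurable X) (hXi : Integrable X P)
    (hX0 : ∀ᵐ ω ∂P, 0 ≤ X ω) {a s η : ℝ} (ha1 : a ≤ 1) (hs : 0 < s) (hη : 0 < η)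
    (hlow : P.real {ω | X ω < (a - η) * s} ≤ η) : (a - 2 * η) * s ≤ ∫ ω, X ω ∂P := by
  set A := {ω | X ω < (a - η) * s}
  have hA : MeasurableSet A := measurableSet_lt hX measurable_const
  have hle : ∫ ω, ((a - η) * s - A.indicator (fun _ => s) ω) ∂P ≤ ∫ ω, X ω ∂P := by
    refine integral_mono_ae ((integrable_const _).sub ((integrable_const _).indicator hA)) hXi ?_
    filter_upwards [hX0] with ω hω
    by_cases hωA : ω ∈ A
    · rw [Set.indicator_of_mem hωA]
      have : 0 ≤ (1 - a) * s := mul_nonneg (by linarith) hs.le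
      have hηs : 0 < η * s := by positivity
      linarith
    · rw [Set.indicator_of_notMem hωA, sub_zero]
      exact not_lt.1 hωA
  rw [integral_sub (integrable_const _) ((integrable_const _).indicator hA),
    integral_indicator_const _ hA, integral_const, probReal_univ] at hle
  simp only [smul_eq_mul, one_mul] at hle
  have h1 : P.real A * s ≤ η * s := by gcongr
  linarith

lemma integral_le_of_lintegral_le {X : Ω → ℝ} (hXi : Integrable X P) (hX0 : ∀ᵐ ω ∂P, 0 ≤ X ω)
    {b : ℝ} (hb : 0 ≤ b) (h : ∫⁻ ω, ENNReal.ofReal (X ω) ∂P ≤ ENNReal.ofReal b) :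
    ∫ ω, X ω ∂P ≤ b := by
  rw [← ofReal_integral_eq_lintegral_ofReal hXi hX0] at h
  exact (ENNReal.ofReal_le_ofReal_iff hb).1 h

variable {Ω : ℕ → Type*} [∀ j, MeasurableSpace (Ω j)] {P : ∀ j, Measure (Ω j)}
  [∀ j, IsProbabilityMeasure (P j)] {X : ∀ j, Ω j → ℝ} {a s : ℕ → ℝ}

lemma asympInProbability_of_bounds (hX : ∀ j, Measurable (X j)) (ha0 : ∀ j, 0 ≤ a j)
    (ha1 : ∀ j, a j ≤ 1) (hs : ∀ᶠ j in atTop, 0 < s j)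
    (hlow : ∀ ε, 0 < ε → ∀ᶠ j in atTop,
      P j {ω | X j ω < (a j - ε) * s j} ≤ ENNReal.ofReal ε)
    (hup : ∀ ε, 0 < ε → ∀ᶠ j in atTop,
      ∫⁻ ω, min (ENNReal.ofReal (X j ω)) (ENNReal.ofReal (2 * s j)) ∂(P j) ≤
        ENNReal.ofReal ((a j + ε) * s j)) :
    AsympInProbability P X a s := by
  intro ε hε
  rw [ENNReal.tendsto_nhds_zero]
  intro δ hδ
  obtain ⟨d, hd0, hdδ⟩ : ∃ d : ℝ, 0 < d ∧ ENNReal.ofReal d ≤ δ := by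
    rcases eq_or_ne δ ⊤ with rfl | hδ'
    · exact ⟨1, one_pos, le_top⟩
    · exact ⟨δ.toReal, ENNReal.toReal_pos hδ.ne' hδ', ENNReal.ofReal_toReal_le⟩
  set γ := min ε 1 with hγ
  have hγ0 : 0 < γ := lt_min hε one_pos
  -- The two tails together have probability at most η + 3η/γ ≤ d/8 + 3d/8.
  set η := min (γ / 2) (γ * d / 8) with hη
  have hη0 : 0 < η := by positivity
  filter_upwards [hs, hlow η hη0, hup η hη0] with j hsj hl hu
  have hγε : γ ≤ ε := min_le_left _ _
  have hηγ : η ≤ γ / 2 := min_le_left _ _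
  have hηd : η ≤ γ * d / 8 := min_le_right _ _
  have hl' : (P j).real {ω | X j ω < (a j - η) * s j} ≤ η :=
    ENNReal.toReal_le_of_le_ofReal hη0.le hl
  have h3 := measureReal_ge_le (hX j) (ha0 j) (ha1 j) hsj hη0 hγ0 (min_le_right _ _) hl' hu
  have hsub : {ω | ε ≤ |X j ω / s j - a j|} ⊆
      {ω | X j ω < (a j - η) * s j} ∪ {ω | (a j + γ) * s j ≤ X j ω} := by
    intro ω hω
    have hω' : ε ≤ |X j ω / s j - a j| := hω
    rcases le_abs'.1 hω' with h | h
    · left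
      have : X j ω / s j < a j - η := by linarith
      rwa [div_lt_iff₀ hsj] at this
    · right
      have : a j + γ ≤ X j ω / s j := by linarith
      rwa [le_div_iff₀ hsj] at this
  have hγ1 : γ ≤ 1 := min_le_right _ _
  have h4 : (P j).real {ω | ε ≤ |X j ω / s j - a j|} ≤ d := by
    have h5 := (measureReal_mono hsub).trans (measureReal_union_le (μ := P j) _ _)
    have h6 : (P j).real {ω | (a j + γ) * s j ≤ X j ω} ≤ 3 / 8 * d := by
      have : γ * (P j).real {ω | (a j + γ) * s j ≤ X j ω} ≤ γ * (3 / 8 * d) := by linarith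
      exact le_of_mul_le_mul_left this hγ0
    have h7 : γ * d ≤ d := mul_le_of_le_one_left hd0.le hγ1
    linarith
  refine le_trans ?_ hdδ
  rw [← ofReal_measureReal]
  exact ENNReal.ofReal_le_ofReal h4

lemma asympInExpectation_of_bounds (hX : ∀ j, Measurable (X j)) (hXi : ∀ j, Integrable (X j) (P j))
    (hX0 : ∀ j, ∀ᵐ ω ∂(P j), 0 ≤ X j ω) (ha0 : ∀ j, 0 ≤ a j)
    (ha1 : ∀ j, a j ≤ 1) (hs : ∀ᶠ j in atTop, 0 < s j)
    (hlow : ∀ ε, 0 < ε → ∀ᶠ j in atTop,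
      P j {ω | X j ω < (a j - ε) * s j} ≤ ENNReal.ofReal ε)
    (hup : ∀ ε, 0 < ε → ∀ᶠ j in atTop,
      ∫⁻ ω, ENNReal.ofReal (X j ω) ∂(P j) ≤ ENNReal.ofReal ((a j + ε) * s j)) :
    AsympInExpectation P X a s := by
  refine ⟨hXi, ?_⟩
  rw [Metric.tendsto_atTop']
  intro ε hε
  have hη0 : 0 < ε / 4 := by positivity
  obtain ⟨N, hN⟩ := eventually_atTop.1 (hs.and ((hlow _ hη0).and (hup _ hη0)))
  refine ⟨N, fun j hj => ?_⟩
  obtain ⟨hsj, hl, hu⟩ := hN j hj.le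
  have hl' : (P j).real {ω | X j ω < (a j - ε / 4) * s j} ≤ ε / 4 :=
    ENNReal.toReal_le_of_le_ofReal hη0.le hl
  have h1 := le_integral_of_measureReal_lt_le (hX j) (hXi j) (hX0 j) (ha1 j) hsj hη0 hl'
  have h2 := integral_le_of_lintegral_le (hXi j) (hX0 j)
    (mul_nonneg (by linarith [ha0 j]) hsj.le) hu
  rw [← le_div_iff₀ hsj] at h1
  rw [← div_le_iff₀ hsj] at h2
  rw [Real.dist_eq, sub_zero, abs_lt]
  constructor <;> linarith

end Moments

/-! ### The growth condition on the depth in terms of the parameter z. -/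

section Regime

/-- With Λ = log(en/m) ≥ 1, the logarithm of x = √(2mn)/(ρ 2^k) is at least log n - Λ/2 - 2^k, so
that log z = log x/(2^k - 1) ≥ YΛ. This yields both z ≥ e^Y and, as Y ≥ 4, z ≥ (n/m)^4. -/
lemma exists_params_of_log_le {n m k ρ : ℕ} {Y : ℝ} (hm : 1 ≤ m) (hmn : m ≤ n) (hk : 1 ≤ k)
    (hρ1 : 1 ≤ ρ) (hρ2 : ρ ≤ 2) (hY : 4 ≤ Y)
    (h : (Y + 2) * Real.log (Real.exp 1 * n / m) * 2 ^ k ≤ Real.log n) :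
    ∃ z : ℝ, Params n m k ρ z ∧ Y ≤ z ∧ unit n m z = scale n m k (√(2 * m * n) / ρ) := by
  have hm0 : (0 : ℝ) < m := by exact_mod_cast hm
  have hn0 : (0 : ℝ) < n := by exact_mod_cast hm.trans hmn
  have hρ0 : (0 : ℝ) < ρ := by exact_mod_cast hρ1
  have hmn' : (m : ℝ) ≤ n := by exact_mod_cast hmn
  have hk2 : (2 : ℝ) ≤ 2 ^ k := by
    calc (2 : ℝ) = 2 ^ 1 := by norm_num
      _ ≤ 2 ^ k := pow_le_pow_right₀ (by norm_num) hk
  set Λ := Real.log (Real.exp 1 * n / m) with hΛ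
  have hΛeq : Λ = 1 + Real.log n - Real.log m := by
    rw [hΛ, Real.log_div (by positivity) hm0.ne', Real.log_mul (by positivity) hn0.ne',
      Real.log_exp]
  have hΛ1 : 1 ≤ Λ := by
    have := Real.log_le_log hm0 hmn'
    linarith
  set x := √(2 * m * n) / ρ / 2 ^ k with hx
  have hx0 : 0 < x := by positivity
  set z := x ^ (1 / ((2 : ℝ) ^ k - 1)) with hz
  have hz0 : 0 < z := Real.rpow_pos_of_pos hx0 _
  have hlogx : Real.log n - Λ / 2 - 2 ^ k ≤ Real.log x := by
    rw [hx, Real.log_div (by positivity) (by positivity), Real.log_div (by positivity)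
      (by positivity), Real.log_sqrt (by positivity), Real.log_mul (by positivity) hn0.ne',
      Real.log_mul (by norm_num) hm0.ne', Real.log_pow]
    have h1 : Real.log ρ ≤ Real.log 2 := Real.log_le_log hρ0 (by exact_mod_cast hρ2)
    have h2 : Real.log 2 ≤ 1 := by linarith [Real.log_two_lt_d9]
    have h3 : 0 ≤ Real.log 2 := Real.log_nonneg (by norm_num)
    have h4 : (k : ℝ) + 1 ≤ 2 ^ k := by exact_mod_cast Nat.lt_two_pow_self
    have h5 : (k : ℝ) * Real.log 2 ≤ k := mul_le_of_le_one_right (Nat.cast_nonneg k) h2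
    linarith
  have hlogz : Y * Λ ≤ Real.log z := by
    rw [hz, Real.log_rpow hx0, one_div_mul_eq_div, le_div_iff₀ (by linarith)]
    have h1 : 0 ≤ Y * Λ := by positivity
    have h2 : Λ * 2 ≤ Λ * 2 ^ k := by gcongr
    have h3 : (2 : ℝ) ^ k ≤ Λ * 2 ^ k := le_mul_of_one_le_left (by positivity) hΛ1
    nlinarith
  have hYz : Y + 1 ≤ z := by
    have h1 : Y ≤ Real.log z := (le_mul_of_one_le_right (by linarith) hΛ1).trans hlogz
    rw [Real.le_log_iff_exp_le hz0] at h1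
    exact (Real.add_one_le_exp Y).trans h1
  refine ⟨z, ⟨hk, hm, hmn, hρ1, hρ2, by linarith, ?_, ?_⟩, by linarith, rfl⟩
  · have h1 : z ^ (2 ^ k - 1) = x := by
      rw [hz, ← Real.rpow_natCast, ← Real.rpow_mul hx0.le]
      have : ((2 ^ k - 1 : ℕ) : ℝ) = 2 ^ k - 1 := by
        rw [Nat.cast_sub Nat.one_le_two_pow]
        push_cast
        rfl
      rw [this, one_div_mul_cancel (by linarith), Real.rpow_one]
    have h2 : z ^ 2 ^ k = x * z := by
      rw [← h1, ← pow_succ, Nat.sub_add_cancel Nat.one_le_two_pow]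
    rw [h2, hx]
    field_simp
  · have h1 : (4 : ℕ) * Real.log (n / m) ≤ Real.log z := by
      rw [Real.log_div hn0.ne' hm0.ne']
      push_cast
      nlinarith
    rw [← Real.log_pow] at h1
    exact (Real.log_le_log_iff (by positivity) hz0).1 h1

lemma eventually_exists_params {n m k : ℕ → ℕ} (hn : Tendsto n atTop atTop) (hm : ∀ j, 1 ≤ m j)
    (hmn : ∀ j, m j ≤ n j) (hk : ∀ j, 1 ≤ k j)
    (hkn : Tendsto (fun j => Real.logb 2 (Real.log (n j))
      - Real.logb 2 (Real.log (Real.exp 1 * n j / m j)) - k j) atTop atTop) {ρ : ℕ}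
    (hρ1 : 1 ≤ ρ) (hρ2 : ρ ≤ 2) (Z : ℝ) :
    ∀ᶠ j in atTop, ∃ z : ℝ, Params (n j) (m j) (k j) ρ z ∧ Z ≤ z ∧
      unit (n j) (m j) z = scale (n j) (m j) (k j) (√(2 * m j * n j) / ρ) := by
  set Y := max Z 4 with hY
  have hY4 : 4 ≤ Y := le_max_right _ _
  filter_upwards [hkn.eventually (eventually_ge_atTop (Real.logb 2 (Y + 2))),
    hn.eventually (eventually_ge_atTop 2)] with j hj hnj
  have hn1 : (1 : ℝ) < n j := by exact_mod_cast hnj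
  have hlogn : 0 < Real.log (n j) := Real.log_pos hn1
  have hm0 : (0 : ℝ) < m j := by exact_mod_cast hm j
  have hmn' : (m j : ℝ) ≤ n j := by exact_mod_cast hmn j
  have hΛ : 0 < Real.log (Real.exp 1 * n j / m j) := by
    refine Real.log_pos ?_
    rw [one_lt_div hm0]
    nlinarith [Real.exp_one_gt_d9]
  obtain ⟨z, h1, h2, h3⟩ := exists_params_of_log_le (hm j) (hmn j) (hk j) hρ1 hρ2 hY4 (by
    have h4 : Real.logb 2 (Y + 2) + Real.logb 2 (Real.log (Real.exp 1 * n j / m j)) + k j ≤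
      Real.logb 2 (Real.log (n j)) := by linarith
    rw [Real.le_logb_iff_rpow_le (by norm_num) hlogn, Real.rpow_add (by norm_num),
      Real.rpow_add (by norm_num), Real.rpow_logb (by norm_num) (by norm_num) (by linarith),
      Real.rpow_logb (by norm_num) (by norm_num) hΛ, Real.rpow_natCast] at h4
    exact h4)
  exact ⟨z, h1, (le_max_left _ _).trans h2, h3⟩

end Regime

/-! ### Limits along a sequence of complete graphs. -/

section Sequence

variable {μ : Measure ℝ} [IsProbabilityMeasure μ] {n m k : ℕ → ℕ} {T : ∀ j, Finset (Fin (n j))}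
  {ρ : ℕ} {s : ℕ → ℝ} {X : ∀ j, ((⊤ : SimpleGraph (Fin (n j))).edgeSet → ℝ) → ℝ}

lemma eventually_measure_lt_le (hμ : HasDensityOneAtZero μ) (hT : ∀ j, (T j).card = m j)
    (hk : ∀ j, 2 ≤ k j ∨ (k j = 1 ∧ μ = expMeasure 1))
    (hreg : ∀ Z : ℝ, ∀ᶠ j in atTop, ∃ z : ℝ, Params (n j) (m j) (k j) ρ z ∧ Z ≤ z ∧
      unit (n j) (m j) z = s j)
    (hX : ∀ j w, (∀ e, 0 ≤ w e) → ∀ c, (∀ R A lev par, R.card ≤ ρ →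
      IsForest R (k j) (T j) A lev par → c ≤ forestCost w R A par) → c ≤ X j w)
    {ε : ℝ} (hε : 0 < ε) :
    ∀ᶠ j in atTop, (Measure.pi fun _ : (⊤ : SimpleGraph (Fin (n j))).edgeSet => μ)
      {w | X j w < (1 - ((2 : ℝ) ^ k j)⁻¹ - ε) * s j} ≤ ENNReal.ofReal ε := by
  obtain ⟨Z, hZ⟩ := exists_measure_forestCost_lt_le hμ hε
  filter_upwards [hreg Z] with j hj
  obtain ⟨z, hP, hz, hs⟩ := hj
  have h1 := hZ _ _ _ _ z hP hz ((hk j).imp id fun h => h.2) (T j) (hT j)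
  rw [hs] at h1
  refine le_trans (measure_mono_ae ?_) h1
  filter_upwards [ae_pi_nonneg (ι := (⊤ : SimpleGraph (Fin (n j))).edgeSet) hμ.nonneg] with w hw
  intro hlt
  have hlt' : X j w < (1 - ((2 : ℝ) ^ k j)⁻¹ - ε) * s j := hlt
  refine ⟨hw, ?_⟩
  by_contra hcon
  push Not at hcon
  exact absurd hlt' (not_lt.2 (hX j w hw _ hcon))

/-- The function f is an extra cost: zero, or the weight of the central edge between two roots. Its
cut-off mean is o(s), so it does not affect the limit. -/
lemma eventually_lintegral_min_le (hμ : HasDensityOneAtZero μ) (hT : ∀ j, (T j).card = m j)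
    (hk : ∀ j, 2 ≤ k j ∨ (k j = 1 ∧ μ = expMeasure 1))
    (hreg : ∀ Z : ℝ, ∀ᶠ j in atTop, ∃ z : ℝ, Params (n j) (m j) (k j) ρ z ∧ Z ≤ z ∧
      unit (n j) (m j) z = s j) {B : ℕ → ENNReal}
    (hB : ∀ ε, 0 < ε → ∀ᶠ j in atTop, ∫⁻ x, cap (B j) x ∂μ ≤ ENNReal.ofReal (ε * s j))
    (hX : ∀ᶠ j in atTop, ∃ (R : Finset (Fin (n j)))
      (f : ((⊤ : SimpleGraph (Fin (n j))).edgeSet → ℝ) → ℝ), R.card = ρ ∧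
      (∀ b, Measurable fun w => cap b (f w)) ∧
      (∀ b, ∫⁻ w, cap b (f w) ∂(Measure.pi fun _ : (⊤ : SimpleGraph (Fin (n j))).edgeSet => μ) ≤
        ∫⁻ x, cap b x ∂μ) ∧
      ∀ w, (∀ e, 0 ≤ w e) → ∀ A lev par, IsForest R (k j) (T j) A lev par →
        X j w ≤ forestCost w R A par + f w)
    {ε : ℝ} (hε : 0 < ε) :
    ∀ᶠ j in atTop, ∫⁻ w, min (ENNReal.ofReal (X j w)) (B j)
      ∂(Measure.pi fun _ : (⊤ : SimpleGraph (Fin (n j))).edgeSet => μ) ≤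
      ENNReal.ofReal ((1 - ((2 : ℝ) ^ k j)⁻¹ + ε) * s j) := by
  obtain ⟨Z, hZ⟩ := exists_lintegral_min_le hμ (half_pos hε)
  filter_upwards [hreg Z, hB _ (half_pos hε), hB 1 one_pos, hX] with j hj hB1 hB2 hXj
  obtain ⟨z, hP, hz, hs⟩ := hj
  obtain ⟨R, f, hR, hfm, hf, hXR⟩ := hXj
  have hs0 : 0 < s j := hs ▸ hP.unit_pos
  rw [one_mul, ← hs] at hB2
  have h1 := hZ _ _ _ _ z hP hz (hk j) R (T j) hR (hT j) (B j) hB2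
    (fun w => ENNReal.ofReal (X j w - f w)) fun w hw A lev par hF =>
      ENNReal.ofReal_le_ofReal (by linarith [hXR w hw A lev par hF])
  rw [hs] at h1
  have ha : 0 ≤ 1 - ((2 : ℝ) ^ k j)⁻¹ := by
    have : ((2 : ℝ) ^ k j)⁻¹ ≤ 1 := inv_le_one_of_one_le₀ (one_le_pow₀ (by norm_num))
    linarith
  calc _ ≤ ∫⁻ w, (min (ENNReal.ofReal (X j w - f w)) (B j) + cap (B j) (f w))
        ∂(Measure.pi fun _ : (⊤ : SimpleGraph (Fin (n j))).edgeSet => μ) := by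
        refine lintegral_mono fun w => ?_
        have := cap_add_le (B j) (X j w - f w) (f w)
        rwa [sub_add_cancel] at this
    _ ≤ ENNReal.ofReal ((1 - ((2 : ℝ) ^ k j)⁻¹ + ε / 2) * s j) + ENNReal.ofReal (ε / 2 * s j) := by
        rw [lintegral_add_right _ (hfm _)]
        exact add_le_add h1 ((hf _).trans hB1)
    _ = _ := by
        rw [← ENNReal.ofReal_add (by positivity) (by positivity)]
        congr 1
        ring

lemma tendsto_of_params (hreg : ∀ Z : ℝ, ∀ᶠ j in atTop, ∃ z : ℝ,
    Params (n j) (m j) (k j) ρ z ∧ Z ≤ z ∧ unit (n j) (m j) z = s j) : Tendsto s atTop atTop := by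
  refine tendsto_atTop.2 fun Y => ?_
  filter_upwards [hreg (Y ^ 2)] with j hj
  obtain ⟨z, hP, hz, hs⟩ := hj
  rw [← hs]
  exact (Real.le_sqrt_of_sq_le hz).trans hP.sqrt_le_unit

lemma eventually_lintegral_cap_top_le (hs : Tendsto s atTop atTop)
    (hi : Integrable (fun x : ℝ => x) μ) {ε : ℝ} (hε : 0 < ε) :
    ∀ᶠ j in atTop, ∫⁻ x, cap ⊤ x ∂μ ≤ ENNReal.ofReal (ε * s j) := by
  have h1 : ∫⁻ x, cap ⊤ x ∂μ < ⊤ := by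
    simp only [cap, min_top_right]
    exact hi.lintegral_lt_top
  filter_upwards [hs.eventually (eventually_ge_atTop ((∫⁻ x, cap ⊤ x ∂μ).toReal / ε))] with j hj
  rw [← ENNReal.ofReal_toReal h1.ne]
  refine ENNReal.ofReal_le_ofReal ?_
  rw [div_le_iff₀ hε] at hj
  linarith

/-- min(W, 2s) has mean at most (ε/2)s + 2s·P(W > εs/2), and the probability tends to 0 for any law.
-/
lemma eventually_lintegral_cap_le (hs : Tendsto s atTop atTop) {ε : ℝ} (hε : 0 < ε) :
    ∀ᶠ j in atTop, ∫⁻ x, cap (ENNReal.ofReal (2 * s j)) x ∂μ ≤ ENNReal.ofReal (ε * s j) := by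
  have h1 : Tendsto (fun y : ℝ => μ.real (Set.Iic y)) atTop (𝓝 1) :=
    (tendsto_cdf_atTop μ).congr fun y => cdf_eq_real μ y
  have h2 : Tendsto (fun j => μ.real (Set.Iic (ε / 2 * s j))) atTop (𝓝 1) :=
    h1.comp (hs.const_mul_atTop (half_pos hε))
  have h3 : (1 : ℝ) - ε / 4 < 1 := by linarith
  filter_upwards [h2.eventually (lt_mem_nhds h3), hs.eventually (eventually_gt_atTop 0)] with j hj hsj
  have h4 : μ (Set.Ioi (ε / 2 * s j)) ≤ ENNReal.ofReal (ε / 4) := by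
    rw [← ofReal_measureReal]
    refine ENNReal.ofReal_le_ofReal ?_
    rw [← Set.compl_Iic, probReal_compl_eq_one_sub measurableSet_Iic]
    linarith
  calc ∫⁻ x, cap (ENNReal.ofReal (2 * s j)) x ∂μ
      ≤ ∫⁻ x, (ENNReal.ofReal (ε / 2 * s j) +
          (Set.Ioi (ε / 2 * s j)).indicator (fun _ => ENNReal.ofReal (2 * s j)) x) ∂μ := by
        refine lintegral_mono fun x => ?_
        by_cases hx : x ∈ Set.Ioi (ε / 2 * s j)
        · rw [Set.indicator_of_mem hx]
          exact (min_le_right _ _).trans le_add_self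
        · refine (min_le_left _ _).trans ((ENNReal.ofReal_le_ofReal ?_).trans le_self_add)
          simpa using hx
    _ = ENNReal.ofReal (ε / 2 * s j) + ENNReal.ofReal (2 * s j) * μ (Set.Ioi (ε / 2 * s j)) := by
        rw [lintegral_add_left measurable_const, lintegral_const, measure_univ, mul_one,
          lintegral_indicator_const measurableSet_Ioi]
    _ ≤ ENNReal.ofReal (ε / 2 * s j) + ENNReal.ofReal (2 * s j) * ENNReal.ofReal (ε / 4) := by
        gcongr
    _ = _ := by
        rw [← ENNReal.ofReal_mul (by positivity), ← ENNReal.ofReal_add (by positivity)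
          (by positivity)]
        congr 1
        ring

/-- The asymptotics of a minimum weight, given upper and lower bounds in terms of forests. -/
theorem asymp_of_forest_bounds (hμ : HasDensityOneAtZero μ) (hT : ∀ j, (T j).card = m j)
    (hk : ∀ j, 2 ≤ k j ∨ (k j = 1 ∧ μ = expMeasure 1))
    (hreg : ∀ Z : ℝ, ∀ᶠ j in atTop, ∃ z : ℝ, Params (n j) (m j) (k j) ρ z ∧ Z ≤ z ∧
      unit (n j) (m j) z = s j)
    (hXm : ∀ j, Measurable (X j)) (hX0 : ∀ j w, (∀ e, 0 ≤ w e) → 0 ≤ X j w)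
    (hXabs : ∀ j w, |X j w| ≤ ∑ e, |w e|)
    (hlow : ∀ j w, (∀ e, 0 ≤ w e) → ∀ c, (∀ R A lev par, R.card ≤ ρ →
      IsForest R (k j) (T j) A lev par → c ≤ forestCost w R A par) → c ≤ X j w)
    (hup : ∀ᶠ j in atTop, ∃ (R : Finset (Fin (n j)))
      (f : ((⊤ : SimpleGraph (Fin (n j))).edgeSet → ℝ) → ℝ), R.card = ρ ∧
      (∀ b, Measurable fun w => cap b (f w)) ∧
      (∀ b, ∫⁻ w, cap b (f w) ∂(Measure.pi fun _ : (⊤ : SimpleGraph (Fin (n j))).edgeSet => μ) ≤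
        ∫⁻ x, cap b x ∂μ) ∧
      ∀ w, (∀ e, 0 ≤ w e) → ∀ A lev par, IsForest R (k j) (T j) A lev par →
        X j w ≤ forestCost w R A par + f w) :
    AsympInProbability (fun j => Measure.pi fun _ : (⊤ : SimpleGraph (Fin (n j))).edgeSet => μ) X
      (fun j => 1 - ((2 : ℝ) ^ k j)⁻¹) s ∧
    (Integrable (fun x : ℝ => x) μ →
      AsympInExpectation (fun j => Measure.pi fun _ : (⊤ : SimpleGraph (Fin (n j))).edgeSet => μ) X
        (fun j => 1 - ((2 : ℝ) ^ k j)⁻¹) s) := by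
  have hs := tendsto_of_params hreg
  have hs0 := hs.eventually (eventually_gt_atTop 0)
  have ha0 : ∀ j, 0 ≤ 1 - ((2 : ℝ) ^ k j)⁻¹ := fun j => by
    have : ((2 : ℝ) ^ k j)⁻¹ ≤ 1 := inv_le_one_of_one_le₀ (one_le_pow₀ (by norm_num))
    linarith
  have ha1 : ∀ j, 1 - ((2 : ℝ) ^ k j)⁻¹ ≤ 1 := fun j => by
    have : 0 < ((2 : ℝ) ^ k j)⁻¹ := by positivity
    linarith
  refine ⟨asympInProbability_of_bounds hXm ha0 ha1 hs0
    (fun ε hε => eventually_measure_lt_le hμ hT hk hreg hlow hε)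
    (fun ε hε => eventually_lintegral_min_le hμ hT hk hreg
      (fun ε hε => eventually_lintegral_cap_le hs hε) hup hε), fun hi => ?_⟩
  refine asympInExpectation_of_bounds hXm (fun j => ?_) (fun j => ?_) ha0 ha1 hs0
    (fun ε hε => eventually_measure_lt_le hμ hT hk hreg hlow hε) (fun ε hε => ?_)
  · refine Integrable.mono' (g := fun w => ∑ e, |w e|) ?_ (hXm j).aestronglyMeasurable
      (Eventually.of_forall fun w => ?_)
    · refine integrable_finsetSum _ fun e _ => Integrable.abs ?_
      exact (measurePreserving_eval (fun _ : (⊤ : SimpleGraph (Fin (n j))).edgeSet => μ)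
        e).integrable_comp_of_integrable hi
    · rw [Real.norm_eq_abs]
      exact hXabs j w
  · filter_upwards [ae_pi_nonneg (ι := (⊤ : SimpleGraph (Fin (n j))).edgeSet) hμ.nonneg] with w hw
    exact hX0 j w hw
  · have := eventually_lintegral_min_le hμ hT hk hreg (B := fun _ => ⊤)
      (fun ε hε => eventually_lintegral_cap_top_le hs hi hε) hup hε
    simpa only [min_top_right] using this

end Sequence

/-! ### From the product measure to arbitrary probability spaces. -/

section Transfer

variable {μ : Measure ℝ} [IsProbabilityMeasure μ] {ι : ℕ → Type*} [∀ j, Fintype (ι j)]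
  {Ω : ℕ → Type*} [∀ j, MeasurableSpace (Ω j)] {P : ∀ j, Measure (Ω j)}
  [∀ j, IsProbabilityMeasure (P j)] {w : ∀ j, ι j → Ω j → ℝ} {X : ∀ j, (ι j → ℝ) → ℝ}
  {a s : ℕ → ℝ}

/-- Independence and a common law make the weight vector distributed as the product measure, where
all estimates live. -/
lemma map_eq_pi (hlaw : ∀ j e, HasLaw (w j e) μ (P j)) (hind : ∀ j, iIndepFun (w j) (P j))
    (j : ℕ) : (P j).map (fun ω e => w j e ω) = Measure.pi fun _ : ι j => μ := by
  rw [(iIndepFun_iff_map_fun_eq_pi_map fun e => (hlaw j e).aemeasurable).1 (hind j)]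
  congr 1
  funext e
  exact (hlaw j e).map_eq

lemma asympInProbability_comp (hlaw : ∀ j e, HasLaw (w j e) μ (P j))
    (hind : ∀ j, iIndepFun (w j) (P j)) (hX : ∀ j, Measurable (X j))
    (h : AsympInProbability (fun j => Measure.pi fun _ : ι j => μ) X a s) :
    AsympInProbability P (fun j ω => X j fun e => w j e ω) a s := by
  intro ε hε
  refine (h ε hε).congr fun j => ?_
  beta_reduce
  rw [← map_eq_pi hlaw hind j, Measure.map_apply_of_aemeasurable
    (aemeasurable_pi_lambda _ fun e => (hlaw j e).aemeasurable)]
  · rfl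
  · exact measurableSet_le measurable_const ((((hX j).div_const _).sub_const _).abs)

lemma asympInExpectation_comp (hlaw : ∀ j e, HasLaw (w j e) μ (P j))
    (hind : ∀ j, iIndepFun (w j) (P j)) (hX : ∀ j, Measurable (X j))
    (h : AsympInExpectation (fun j => Measure.pi fun _ : ι j => μ) X a s) :
    AsympInExpectation P (fun j ω => X j fun e => w j e ω) a s := by
  have hw : ∀ j, AEMeasurable (fun ω e => w j e ω) (P j) := fun j =>
    aemeasurable_pi_lambda _ fun e => (hlaw j e).aemeasurable
  refine ⟨fun j => ?_, h.2.congr fun j => ?_⟩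
  · have h1 : Integrable (X j) (Measure.pi fun _ : ι j => μ) := h.1 j
    rw [← map_eq_pi hlaw hind j] at h1
    exact h1.comp_aemeasurable (hw j)
  · simp only
    rw [← map_eq_pi hlaw hind j, integral_map (hw j) (hX j).aestronglyMeasurable]

end Transfer

end SteinerTree

/-! ### The asymptotics of the three minimum weights. -/

theorem theorem3
    -- the law of an edge weight
    (μ : Measure ℝ) [IsProbabilityMeasure μ] (hμ : SteinerTree.HasDensityOneAtZero μ)
    -- a sequence of complete graphs, with terminal sets, roots and depth bounds
    (n m k : ℕ → ℕ) (hn : Tendsto n atTop atTop)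
    (T : ∀ j, Finset (Fin (n j))) (hT : ∀ j, (T j).card = m j) (hm : ∀ j, 1 ≤ m j)
    (r : ∀ j, Fin (n j))
    (hk : ∀ j, 2 ≤ k j ∨ (k j = 1 ∧ μ = expMeasure 1))
    (hkn : Tendsto (fun j => Real.logb 2 (Real.log (n j))
      - Real.logb 2 (Real.log (Real.exp 1 * n j / m j)) - k j) atTop atTop)
    -- independent edge weights with law `μ`
    {Ω : ℕ → Type*} [∀ j, MeasurableSpace (Ω j)] (P : ∀ j, Measure (Ω j))
    [∀ j, IsProbabilityMeasure (P j)]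
    (w : ∀ j, (⊤ : SimpleGraph (Fin (n j))).edgeSet → Ω j → ℝ)
    (hlaw : ∀ j e, HasLaw (w j e) μ (P j)) (hind : ∀ j, iIndepFun (w j) (P j)) :
    let depthWt : ∀ j, Ω j → ℝ := fun j ω =>
      SteinerTree.minDepthWeight (fun e => w j e ω) (T j) (r j) (k j)
    let evenDiamWt : ∀ j, Ω j → ℝ := fun j ω =>
      SteinerTree.minDiamWeight (fun e => w j e ω) (T j) (2 * k j)
    let oddDiamWt : ∀ j, Ω j → ℝ := fun j ω =>
      SteinerTree.minDiamWeight (fun e => w j e ω) (T j) (2 * k j + 1)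
    let a : ℕ → ℝ := fun j => 1 - ((2 : ℝ) ^ k j)⁻¹
    let s : ℕ → ℝ := fun j => SteinerTree.scale (n j) (m j) (k j) (√(2 * m j * n j))
    let s' : ℕ → ℝ := fun j => SteinerTree.scale (n j) (m j) (k j) (√(m j * n j / 2))
    (SteinerTree.AsympInProbability P depthWt a s ∧
      SteinerTree.AsympInProbability P evenDiamWt a s ∧
      SteinerTree.AsympInProbability P oddDiamWt a s') ∧
    (Integrable (fun x : ℝ => x) μ →
      SteinerTree.AsympInExpectation P depthWt a s ∧
      SteinerTree.AsympInExpectation P evenDiamWt a s ∧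
      SteinerTree.AsympInExpectation P oddDiamWt a s') := by
  intro depthWt evenDiamWt oddDiamWt a s s'
  have hk1 : ∀ j, 1 ≤ k j := fun j => by have := hk j; omega
  have hmn : ∀ j, m j ≤ n j := fun j => by
    rw [← hT j]
    exact (Finset.card_le_univ _).trans_eq (Fintype.card_fin _)
  have hreg : ∀ Z : ℝ, ∀ᶠ j in atTop, ∃ z : ℝ, SteinerTree.Params (n j) (m j) (k j) 1 z ∧ Z ≤ z ∧
      SteinerTree.unit (n j) (m j) z = s j := fun Z => by
    simpa [s] using SteinerTree.eventually_exists_params hn hm hmn hk1 hkn le_rfl one_le_two Z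
  have hreg' : ∀ Z : ℝ, ∀ᶠ j in atTop, ∃ z : ℝ, SteinerTree.Params (n j) (m j) (k j) 2 z ∧ Z ≤ z ∧
      SteinerTree.unit (n j) (m j) z = s' j := fun Z => by
    -- Two roots halve the quantity √(2mn), which becomes √(mn/2).
    have hs' : ∀ j, √(2 * m j * n j) / (2 : ℕ) = √((m j : ℝ) * n j / 2) := fun j => by
      rw [show (2 : ℝ) * m j * n j = 2 ^ 2 * ((m j : ℝ) * n j / 2) by ring,
        Real.sqrt_mul (by norm_num), Real.sqrt_sq (by norm_num), Nat.cast_ofNat]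
      ring
    simpa only [hs'] using
      SteinerTree.eventually_exists_params hn hm hmn hk1 hkn one_le_two le_rfl Z
  have hdepth := SteinerTree.asymp_of_forest_bounds (T := T)
    (X := fun j w => SteinerTree.minDepthWeight w (T j) (r j) (k j)) hμ hT hk hreg
    (fun j => SteinerTree.measurable_sInf_weight _) (fun j w hw => SteinerTree.sInf_weight_nonneg hw _)
    (fun j w => SteinerTree.abs_sInf_weight_le w _)
    (fun j w hw c h => (SteinerTree.le_minDiamWeight_even hw (hk1 j) (r j) h).trans
      (SteinerTree.minDiamWeight_le_minDepthWeight hw (hk1 j) (r j)))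
    (Eventually.of_forall fun j => ⟨{r j}, fun _ => 0, Finset.card_singleton _,
      fun b => measurable_const, fun b => by simp [SteinerTree.cap], fun w hw A lev par hF => by
        simpa using SteinerTree.minDepthWeight_le_forestCost hw hF⟩)
  have heven := SteinerTree.asymp_of_forest_bounds (T := T)
    (X := fun j w => SteinerTree.minDiamWeight w (T j) (2 * k j)) hμ hT hk hreg
    (fun j => SteinerTree.measurable_sInf_weight _) (fun j w hw => SteinerTree.sInf_weight_nonneg hw _)
    (fun j w => SteinerTree.abs_sInf_weight_le w _)
    (fun j w hw c h => SteinerTree.le_minDiamWeight_even hw (hk1 j) (r j) h)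
    (Eventually.of_forall fun j => ⟨{r j}, fun _ => 0, Finset.card_singleton _,
      fun b => measurable_const, fun b => by simp [SteinerTree.cap], fun w hw A lev par hF => by
        simpa using (SteinerTree.minDiamWeight_le_minDepthWeight hw (hk1 j) (r j)).trans
          (SteinerTree.minDepthWeight_le_forestCost hw hF)⟩)
  have hodd := SteinerTree.asymp_of_forest_bounds (T := T)
    (X := fun j w => SteinerTree.minDiamWeight w (T j) (2 * k j + 1)) hμ hT hk hreg'
    (fun j => SteinerTree.measurable_sInf_weight _) (fun j w hw => SteinerTree.sInf_weight_nonneg hw _)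
    (fun j w => SteinerTree.abs_sInf_weight_le w _)
    (fun j w hw c h => SteinerTree.le_minDiamWeight_odd hw (hk1 j) (r j) h) (by
      -- A second root requires two vertices; the extra cost f is the weight of the edge between the
      -- roots.
      filter_upwards [hn.eventually (eventually_ge_atTop 2)] with j hj
      have : Nontrivial (Fin (n j)) := Fin.nontrivial_iff_two_le.2 hj
      obtain ⟨r₂, hr₂⟩ := exists_ne (r j)
      exact ⟨{r j, r₂}, fun w => SteinerTree.edgeWt w (r j) r₂, Finset.card_pair hr₂.symm,
        fun b => SteinerTree.measurable_cap_edgeWt b _ _,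
        fun b => (SteinerTree.lintegral_cap_edgeWt b hr₂.symm).le, fun w hw A lev par hF =>
          SteinerTree.minDiamWeight_le_forestCost_add hw hr₂.symm hF⟩)
  have hd := fun j => SteinerTree.measurable_sInf_weight
    {H | SteinerTree.IsSteinerTree (T j) H ∧ SteinerTree.HasDepthLE (r j) (k j) H}
  have he := fun j => SteinerTree.measurable_sInf_weight
    {H | SteinerTree.IsSteinerTree (T j) H ∧ SteinerTree.HasDiamLE (2 * k j) H}
  have ho := fun j => SteinerTree.measurable_sInf_weight
    {H | SteinerTree.IsSteinerTree (T j) H ∧ SteinerTree.HasDiamLE (2 * k j + 1) H}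
  have h1 := SteinerTree.asympInProbability_comp hlaw hind hd hdepth.1
  have h2 := SteinerTree.asympInProbability_comp hlaw hind he heven.1
  have h3 := SteinerTree.asympInProbability_comp hlaw hind ho hodd.1
  refine ⟨⟨h1, h2, h3⟩, fun hi => ?_⟩
  have h4 := SteinerTree.asympInExpectation_comp hlaw hind hd (hdepth.2 hi)
  have h5 := SteinerTree.asympInExpectation_comp hlaw hind he (heven.2 hi)
  have h6 := SteinerTree.asympInExpectation_comp hlaw hind ho (hodd.2 hi)
  exact ⟨h4, h5, h6⟩
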